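/- Let $f\in\mathbb{C}(x,y)$. Say that $\int f(x,\ln x)\,dx$ \emph{admits a telescoper} if on some polydisc there is an analytic function $I(x,h)$ with $\partial_x I=f(x,\ln x+h)$ and $L I=R(x,\ln x+h)$ for some non-zero $L\in\mathbb{C}[\partial_h]$ and some $R\in\mathbb{C}(x,y)$. Consider finite expressions $$\sum_{p\in\mathbb{Z}\setminus\{0\},\,\lambda\in\mathbb{C}} a_{p,\lambda}\,\mathrm{Ei}(p\ln x+\lambda)+\sum_{p\ge 1,\,r\ge 0,\,\lambda\in\mathbb{C}\setminus\{0\}} b_{p,r,\lambda}(\ln x)^r\,\mathrm{Li}_p(\lambda x)+\sum_{\lambda\in\mathbb{C}}\lambda\ln K_\lambda(x,\ln x)+H(x,\ln x)\qquad(*)$$ with $a_{p,\lambda},b_{p,r,\lambda}\in\mathbb{C}$ and $K_\lambda,H\in\mathbb{C}(x,y)$, $K_\lambda\neq 0$. We say that $(*)$ is an integral of $f(x,\ln x)$ if, on some non-empty open set on which all functions occurring (with principal branches) are holomorphic, its derivative is $f(x,\ln x)$. For a non-zero rational function, $\deg_x$ and $\deg_y$ denote the degree of the numerator minus the degree of the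 denominator, and $\deg 0=-\infty$; $\mathrm{den}$ is the denominator in lowest terms. Suppose that $\int f(x,\ln x)\,dx$ admits a telescoper. Then: 1. There is an integral of $f(x,\ln x)$ of the form $(*)$ such that every irreducible factor of $\mathrm{den}(H)$ is a factor of $\mathrm{den}(f)$, its multiplicity in $\mathrm{den}(H)$ being at least one less than in $\mathrm{den}(f)$, and such that $\deg_x H\le\max(0,\deg_x f+1)$ and $\deg_y H\le\max(0,\deg_y f+1)$. 2. For every integral of $f(x,\ln x)$ of the form $(*)$, the statement on $\mathrm{den}(H)$ and the bound $\deg_x H\le\max(0,\deg_x f+1)$ hold, and there is $c\in\mathbb{C}$ with $\deg_y(H-cy)\le\max(0,\deg_y f+1)$ (the term $c\,y=c\ln x$ can be moved from $H$ to the logarithmic sum). 3. If $f(x,\ln x)$ has an integral of the form $(*)$ with $H=0$, then $f$ has only simple poles, except possibly along $x=0$ (that is, no square of an irreducible polynomial other than $x$, up to a constant factor, divides $\mathrm{den}(f)$). 4. Conversely, if $f$ has only simple poles except possibly along $x=0$, then $H\in\mathbb{C}[x,\tfrac1x,y]$, i.e. $H(x,\ln x)\in\mathbb{C}[x,\tfrac1x,\ln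 x]$, for every integral of $f(x,\ln x)$ of the form $(*)$. -/

import Mathlib

open Complex

noncomputable section

/-- The field `ℂ(x,y)`. The outer polynomial variable is `y`, the inner one is `x`. -/
abbrev RatXY : Type := FractionRing (Polynomial (Polynomial ℂ))

namespace RatXY

/-- The polynomial `x`. -/
def polyX : Polynomial (Polynomial ℂ) := Polynomial.C Polynomial.X

/-- The rational function `x`. -/
def x : RatXY := algebraMap (Polynomial (Polynomial ℂ)) RatXY polyX

/-- The rational function `y`. -/
def y : RatXY := algebraMap (Polynomial (Polynomial ℂ)) RatXY Polynomial.X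

/-- Constants of `ℂ(x,y)`. -/
def const (c : ℂ) : RatXY :=
  algebraMap (Polynomial (Polynomial ℂ)) RatXY (Polynomial.C (Polynomial.C c))

/-- The numerator in lowest terms. -/
def num (f : RatXY) : Polynomial (Polynomial ℂ) :=
  IsFractionRing.num (Polynomial (Polynomial ℂ)) f

/-- The denominator in lowest terms. -/
def den (f : RatXY) : Polynomial (Polynomial ℂ) :=
  (IsFractionRing.den (Polynomial (Polynomial ℂ)) f : Polynomial (Polynomial ℂ))

/-- `f` has no pole at the point `(a,b)`. -/
def RegularAt (f : RatXY) (a b : ℂ) : Prop := (den f).evalEval a b ≠ 0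

/-- The value `f(a,b)` (meaningful where `f` is regular). -/
def eval (f : RatXY) (a b : ℂ) : ℂ := (num f).evalEval a b / (den f).evalEval a b

/-- Degree in `x` of a polynomial in `x, y`. -/
def polyDegX (p : Polynomial (Polynomial ℂ)) : ℕ :=
  p.support.sup fun j => (p.coeff j).natDegree

open scoped Classical in
/-- Degree in `x` of a rational function: degree of the numerator minus degree of the
denominator; the degree of `0` is `-∞`. -/
def degX (f : RatXY) : WithBot ℤ :=
  if f = 0 then ⊥ else (((polyDegX (num f) : ℤ) - (polyDegX (den f) : ℤ) : ℤ) : WithBot ℤ)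

open scoped Classical in
/-- Degree in `y` of a rational function: degree of the numerator minus degree of the
denominator; the degree of `0` is `-∞`. -/
def degY (f : RatXY) : WithBot ℤ :=
  if f = 0 then ⊥ else ((((num f).natDegree : ℤ) - ((den f).natDegree : ℤ) : ℤ) : WithBot ℤ)

/-- Every irreducible factor of `den H` is a factor of `den f`, and its multiplicity in `den H`
is at least one less than its multiplicity in `den f`. -/
def DenReduced (H f : RatXY) : Prop :=
  ∀ P : Polynomial (Polynomial ℂ), Irreducible P → P ∣ den H →
    emultiplicity P (den H) + 1 ≤ emultiplicity P (den f)

/-- All poles of `f` are simple, except possibly the one along `x = 0`. -/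
def SimplePolesAwayFromZero (f : RatXY) : Prop :=
  ∀ P : Polynomial (Polynomial ℂ), Irreducible P → ¬ Associated P polyX → ¬ P ^ 2 ∣ den f

/-- `H` belongs to `ℂ[x, 1/x, y]`. -/
def IsLaurent (H : RatXY) : Prop :=
  ∃ (q : Polynomial (Polynomial ℂ)) (n : ℕ),
    H = algebraMap (Polynomial (Polynomial ℂ)) RatXY q / x ^ n

/-- The integral of `f(x, ln x)` admits a telescoper. The general solution of `y' = 1/x` is
`y(x,h) = ln x + h`, and `∂ₕ y = 1`. On some polydisc there is an analytic `I(x,h)` with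
`∂ₓ I = f(x, ln x + h)` and `L I = R(x, ln x + h)` for a non-zero operator `L ∈ ℂ[∂ₕ]` and
a rational function `R`. -/
def AdmitsTelescoper (f : RatXY) : Prop :=
  ∃ (L : Polynomial ℂ) (R : RatXY) (I : ℂ → ℂ → ℂ) (x₀ h₀ : ℂ) (ρ : ℝ),
    L ≠ 0 ∧ 0 < ρ ∧
    AnalyticOnNhd ℂ (fun z : ℂ × ℂ => I z.1 z.2) (Metric.ball x₀ ρ ×ˢ Metric.ball h₀ ρ) ∧
    ∀ a ∈ Metric.ball x₀ ρ, ∀ h ∈ Metric.ball h₀ ρ,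
      a ∈ slitPlane ∧
      RegularAt f a (log a + h) ∧
      RegularAt R a (log a + h) ∧
      HasDerivAt (fun t => I t h) (eval f a (log a + h)) a ∧
      ∑ i ∈ Finset.range (L.natDegree + 1), L.coeff i * iteratedDeriv i (fun s => I a s) h
        = eval R a (log a + h)

end RatXY

/-- The exponential integral `Ei`, principal branch (cut along the negative real axis). -/
def expInt (z : ℂ) : ℂ :=
  (Real.eulerMascheroniConstant : ℂ) + log z +
    ∑' n : ℕ, z ^ (n + 1) / ((n + 1 : ℂ) * ((n + 1).factorial : ℂ))

/-- The polylogarithm `Li_p`, principal branch (cut along `[1, ∞)`):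
`Li_0 z = z / (1 - z)` and `Li_{p+1} z` is the integral of `Li_p w / w` along `[0, z]`. -/
def polyLog : ℕ → ℂ → ℂ
  | 0, z => z / (1 - z)
  | p + 1, z => ∫ t in (0 : ℝ)..1, polyLog p ((t : ℂ) * z) / (t : ℂ)

/-- The data of a finite expression
`∑ a_{p,μ} Ei(p ln x + μ) + ∑ b_{p,r,μ} (ln x)^r Li_p(μ x) + ∑ μ ln K_μ(x, ln x) + H(x, ln x)`. -/
structure LogExpr where
  /-- coefficients `a_{p,μ}` -/
  a : ℤ × ℂ →₀ ℂ
  /-- coefficients `b_{p,r,μ}` -/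
  b : ℕ × ℕ × ℂ →₀ ℂ
  /-- the finitely many `μ` in the logarithmic sum -/
  S : Finset ℂ
  K : ℂ → RatXY
  H : RatXY
  a_index : ∀ i ∈ a.support, i.1 ≠ 0
  b_index : ∀ i ∈ b.support, 1 ≤ i.1 ∧ i.2.2 ≠ 0
  K_ne_zero : ∀ μ ∈ S, K μ ≠ 0

namespace LogExpr

/-- The function of one variable denoted by the expression. -/
def toFun (E : LogExpr) (t : ℂ) : ℂ :=
  (∑ i ∈ E.a.support, E.a i * expInt ((i.1 : ℂ) * log t + i.2)) +
  (∑ i ∈ E.b.support, E.b i * (log t) ^ i.2.1 * polyLog i.1 (i.2.2 * t)) +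
  (∑ μ ∈ E.S, μ * log (RatXY.eval (E.K μ) t (log t))) +
  RatXY.eval E.H t (log t)

/-- Every function occurring in the expression is holomorphic at `t`. -/
def RegularAt (E : LogExpr) (t : ℂ) : Prop :=
  t ∈ slitPlane ∧
  (∀ i ∈ E.a.support, (i.1 : ℂ) * log t + i.2 ∈ slitPlane) ∧
  (∀ i ∈ E.b.support, 1 - i.2.2 * t ∈ slitPlane) ∧
  (∀ μ ∈ E.S, RatXY.RegularAt (E.K μ) t (log t) ∧
    RatXY.eval (E.K μ) t (log t) ∈ slitPlane) ∧
  RatXY.RegularAt E.H t (log t)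

/-- On some non-empty open set the expression is an antiderivative of `f(x, ln x)`. -/
def IsIntegralOf (E : LogExpr) (f : RatXY) : Prop :=
  ∃ U : Set ℂ, IsOpen U ∧ U.Nonempty ∧ ∀ t ∈ U,
    E.RegularAt t ∧ RatXY.RegularAt f t (log t) ∧
    HasDerivAt E.toFun (RatXY.eval f t (log t)) t

end LogExpr

end

/-! Let D = ∂_x + (1/x) ∂_y be the derivation of ℂ(x,y) along the curves y = ln x + h. On these
curves ∂_h is ∂_y, which commutes with D. Differentiating the analytic telescoping relation in x
gives L(∂_y) f = D R in ℂ(x,y) (`RatXY.AdmitsTelescoper.exists_aeval_eq`).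

Existence of an integral: Hermite reduction over ℂ(x)[y] (`exists_hermite_reduction`) writes f = D G
+ q + Σ c_P / P with q in ℂ(x)[y] and P monic irreducible. Since P does not divide D P, modulo P one
has c_P = s D(P), and the class v of s in ℂ(x)[y]/(P) serves as a residue. Up to derivatives, ∂_y
acts on residues as a derivation τ with τ y - τ x / x = 1 (`HasResidue.deriv`, `residueDeriv_root`),
and derivatives have residue 0, so L(τ) v = 0. Such an equation has few solutions
(`residue_classification`). If y is not constant in the residue field, an eigenvalue l ≠ 0 is
impossible, because a trace down to ℂ(y) would make a nonzero constant a proper fraction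
(`eigenvalue_eq_zero`); a solution of τ v = c with c ≠ 0 is impossible because 1/x has no rational
primitive. Hence v is constant, which gives a logarithm of P. The exception is P = y - c, where τ =
-x d/dx and v is a Laurent polynomial in x; this gives terms x^(k-1) / (y - c), integrated by Ei, or
by a logarithm for k = 0. The polynomial q is integrated by parts, which produces the
polylogarithms.

Every integral is formal: x and ln x are algebraically independent, and the products (ln x)^r
Li_p(μx) are linearly independent modulo ℂ(x, ln x) (`RatXY.eq_zero_of_polyLogSum_eq`). So the
polylogarithms cancel in the derivative of any integral, and f is D H plus explicit rational terms
(`LogExpr.IsIntegralOf.formal`). The remaining claims are algebra with this identity.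

Denominators: away from x = 0 all terms except D H have at most simple poles, while x D maps no
irreducible polynomial P other than x to a multiple of P (`RatXY.not_dvd_eulerSub`). A pole of H of
order n ≥ 1 is therefore a pole of f of order at least n + 1 (`RatXY.pow_succ_dvd_den`). This
settles parts 3 and 4 and most of the statement on denominators.

Places x = 0, x = ∞ and y = ∞: Laurent coefficients of the identity are compared. In x, a polar
coefficient h(y) of H could be cancelled only by Ei terms, through n h + h' + Σ c_i / (n y + μ_i) =
0, which forces h = 0 (`RatX.eq_zero_of_deriv_add_sum`). In y, residues in x show that the only
polar term that can be cancelled without trace is c y (`RatXY.exists_degY_le_of_formal`); it is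
exchanged for the logarithm c ln x. -/

set_option linter.unusedSectionVars false

/-! ### Extension of derivations to fraction fields. -/

section FractionFieldDerivation

variable {k R K : Type*} [Field k] [CommRing R] [IsDomain R] [Field K] [Algebra R K]
  [IsFractionRing R K] [Algebra k R] [Algebra k K] [IsScalarTower k R K]

/-- A derivation with values in the fraction field, as a ring homomorphism to the dual numbers. -/
noncomputable def dualNumberHom (d : Derivation k R K) : R →+* TrivSqZeroExt K K where
  toFun r := .inl (algebraMap R K r) + .inr (d r)
  map_one' := by simp
  map_zero' := by simp
  map_mul' a b := by
    ext
    · simp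
    · simp only [map_mul, Derivation.leibniz, TrivSqZeroExt.snd_add, TrivSqZeroExt.snd_inl,
        TrivSqZeroExt.snd_inr, TrivSqZeroExt.snd_mul, TrivSqZeroExt.fst_add,
        TrivSqZeroExt.fst_inl, TrivSqZeroExt.fst_inr, Algebra.smul_def, MulOpposite.smul_eq_mul_unop,
        MulOpposite.unop_op, zero_add, add_zero, Algebra.algebraMap_self_apply]
      ring
  map_add' a b := by
    ext <;> simp

/-- The extension of `dualNumberHom` to the fraction field. -/
noncomputable def dualNumberLift (d : Derivation k R K) : K →+* TrivSqZeroExt K K :=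
  IsLocalization.lift (M := nonZeroDivisors R) (g := dualNumberHom d) fun y => by
    rw [TrivSqZeroExt.isUnit_iff_isUnit_fst, isUnit_iff_ne_zero]
    simp only [dualNumberHom, RingHom.coe_mk, MonoidHom.coe_mk, OneHom.coe_mk,
      TrivSqZeroExt.fst_add, TrivSqZeroExt.fst_inl, TrivSqZeroExt.fst_inr, add_zero]
    exact IsFractionRing.to_map_ne_zero_of_mem_nonZeroDivisors y.2

lemma dualNumberLift_algebraMap (d : Derivation k R K) (r : R) :
    dualNumberLift d (algebraMap R K r) = .inl (algebraMap R K r) + .inr (d r) :=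
  IsLocalization.lift_eq _ r

lemma fst_dualNumberLift (d : Derivation k R K) (g : K) : (dualNumberLift d g).fst = g := by
  have h : (TrivSqZeroExt.fstHom ℤ K K).toRingHom.comp (dualNumberLift d) = RingHom.id K := by
    apply IsLocalization.ringHom_ext (nonZeroDivisors R)
    ext r
    simp [dualNumberLift_algebraMap]
  exact congrArg (fun f : K →+* K => f g) h

/-- The extension of a derivation to the fraction field. -/
noncomputable def Derivation.toFractionField (d : Derivation k R K) : Derivation k K K :=
  Derivation.mk'
    -- The quotient rule needs no well-definedness check: the lift to dual numbers exists by
    -- localization, and the Leibniz rule is multiplicativity read in the infinitesimal component.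
    { toFun := fun g => (dualNumberLift d g).snd
      map_add' := fun a b => by simp
      map_smul' := fun c g => by
        have h : dualNumberLift d (algebraMap k K c) = .inl (algebraMap k K c) := by
          rw [IsScalarTower.algebraMap_apply k R K, dualNumberLift_algebraMap]
          simp
        rw [Algebra.smul_def, map_mul, TrivSqZeroExt.snd_mul, h]
        simp [Algebra.smul_def, fst_dualNumberLift] }
    fun a b => by
      simp [TrivSqZeroExt.snd_mul, fst_dualNumberLift, mul_comm]

lemma Derivation.toFractionField_algebraMap (d : Derivation k R K) (r : R) :
    d.toFractionField (algebraMap R K r) = d r := by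
  change (dualNumberLift d (algebraMap R K r)).snd = d r
  simp [dualNumberLift_algebraMap]

/-- Additive maps out of a fraction field satisfying the Leibniz rule along a homomorphism agree
when they agree on the ring. -/
lemma eq_of_leibniz_of_fractionRing {L : Type*} [Field L] (φ : K →+* L) (d₁ d₂ : K → L)
    (h₁ : ∀ a b, d₁ (a * b) = φ a * d₁ b + φ b * d₁ a)
    (h₂ : ∀ a b, d₂ (a * b) = φ a * d₂ b + φ b * d₂ a)
    (h : ∀ r : R, d₁ (algebraMap R K r) = d₂ (algebraMap R K r)) (g : K) : d₁ g = d₂ g := by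
  obtain ⟨a, b, hb, rfl⟩ := IsFractionRing.div_surjective (A := R) g
  have hb0 : algebraMap R K b ≠ 0 := IsFractionRing.to_map_ne_zero_of_mem_nonZeroDivisors hb
  -- The product rule for (a / b) * b = a determines the value at a / b from the values at a and b.
  have e₁ := h₁ (algebraMap R K a / algebraMap R K b) (algebraMap R K b)
  have e₂ := h₂ (algebraMap R K a / algebraMap R K b) (algebraMap R K b)
  rw [div_mul_cancel₀ _ hb0] at e₁ e₂
  have hφ : φ (algebraMap R K b) ≠ 0 := by simpa using hb0
  rw [h a, e₂, h b] at e₁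
  exact (mul_left_cancel₀ hφ (add_left_cancel e₁)).symm

end FractionFieldDerivation

/-! ### Local rings at a prime element and pole orders. -/

section LocalRing

variable {R : Type*} (K : Type*) [CommRing R] [IsDomain R] [Field K] [Algebra R K]
  [IsFractionRing R K]

/-- The elements of the fraction field that are regular along the prime element `P`. -/
def regularAlong {P : R} (hP : Prime P) : Subring K where
  carrier := {g | ∃ a b, ¬ P ∣ b ∧ g * algebraMap R K b = algebraMap R K a}
  mul_mem' := by
    rintro g h ⟨a, b, hb, e⟩ ⟨a', b', hb', e'⟩
    refine ⟨a * a', b * b', fun hd => (hP.dvd_or_dvd hd).elim hb hb', ?_⟩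
    rw [map_mul, map_mul, ← e, ← e']
    ring
  one_mem' := ⟨1, 1, fun h => hP.not_isUnit (isUnit_of_dvd_one h), by simp⟩
  add_mem' := by
    rintro g h ⟨a, b, hb, e⟩ ⟨a', b', hb', e'⟩
    refine ⟨a * b' + a' * b, b * b', fun hd => (hP.dvd_or_dvd hd).elim hb hb', ?_⟩
    simp only [map_mul, map_add, ← e, ← e']
    ring
  zero_mem' := ⟨0, 1, fun h => hP.not_isUnit (isUnit_of_dvd_one h), by simp⟩
  neg_mem' := by
    rintro g ⟨a, b, hb, e⟩
    exact ⟨-a, b, hb, by rw [map_neg, ← e]; ring⟩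

variable {K} {P : R} (hP : Prime P)

lemma algebraMap_mem_regularAlong (a : R) : algebraMap R K a ∈ regularAlong K hP :=
  ⟨a, 1, fun h => hP.not_isUnit (isUnit_of_dvd_one h), by simp⟩

lemma inv_mem_regularAlong {b : R} (hb : ¬ P ∣ b) : (algebraMap R K b)⁻¹ ∈ regularAlong K hP := by
  have : algebraMap R K b ≠ 0 := by
    rw [Ne, IsFractionRing.to_map_eq_zero_iff]
    rintro rfl
    exact hb (dvd_zero _)
  exact ⟨1, b, hb, by simp [this]⟩

/-- Turns the absence of a pole into a divisibility; this is how the numerator of a simple pole is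
shown to vanish modulo P. -/
lemma dvd_of_div_mem_regularAlong {a : R}
    (h : algebraMap R K a / algebraMap R K P ∈ regularAlong K hP) : P ∣ a := by
  obtain ⟨c, b, hb, e⟩ := h
  have hP0 : algebraMap R K P ≠ 0 := by
    rw [Ne, IsFractionRing.to_map_eq_zero_iff]
    exact hP.ne_zero
  rw [div_mul_eq_mul_div, div_eq_iff hP0, ← map_mul, ← map_mul] at e
  have e' := IsFractionRing.injective R K e
  exact (hP.dvd_or_dvd (show P ∣ a * b from e' ▸ Dvd.intro_left c rfl)).resolve_right hb

/-- Pole orders are not defined as numbers: regularity of P ^ n * g says that the order is at most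
n. This lemma supplies the starting bound for descents on n. -/
lemma exists_pow_mul_mem_regularAlong [WfDvdMonoid R] (g : K) :
    ∃ n : ℕ, algebraMap R K P ^ n * g ∈ regularAlong K hP := by
  obtain ⟨a, b, hb, rfl⟩ := IsFractionRing.div_surjective (A := R) g
  obtain ⟨n, c, hc, rfl⟩ := WfDvdMonoid.max_power_factor (nonZeroDivisors.ne_zero hb) hP.irreducible
  have hP0 : algebraMap R K P ≠ 0 := by
    rw [Ne, IsFractionRing.to_map_eq_zero_iff]
    exact hP.ne_zero
  refine ⟨n, ?_⟩
  have : algebraMap R K P ^ n * (algebraMap R K a / algebraMap R K (P ^ n * c)) =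
      algebraMap R K a * (algebraMap R K c)⁻¹ := by
    rw [map_mul, map_pow]
    field_simp
  rw [this]
  exact mul_mem (algebraMap_mem_regularAlong hP a) (inv_mem_regularAlong hP hc)

lemma mul_mem_regularAlong_iff {b : R} (hb : ¬ P ∣ b) (g : K) :
    algebraMap R K b * g ∈ regularAlong K hP ↔ g ∈ regularAlong K hP := by
  refine ⟨fun h => ?_, fun h => mul_mem (algebraMap_mem_regularAlong hP b) h⟩
  have hb0 : algebraMap R K b ≠ 0 := by
    rw [Ne, IsFractionRing.to_map_eq_zero_iff]
    rintro rfl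
    exact hb (dvd_zero _)
  have := mul_mem (inv_mem_regularAlong hP hb) h
  rwa [inv_mul_cancel_left₀ hb0] at this

variable {k : Type*} [Field k] [Algebra k K] (D : Derivation k K K)

/-- From g b = a one gets b D g = D a - g D b, and b is a unit of the local ring. -/
lemma derivation_mem_regularAlong (hD : ∀ r : R, D (algebraMap R K r) ∈ regularAlong K hP)
    {g : K} (hg : g ∈ regularAlong K hP) : D g ∈ regularAlong K hP := by
  obtain ⟨a, b, hb, e⟩ := id hg
  have e' := congrArg D e
  rw [D.leibniz, smul_eq_mul, smul_eq_mul] at e'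
  rw [← mul_mem_regularAlong_iff hP hb]
  have : algebraMap R K b * D g = D (algebraMap R K a) - g * D (algebraMap R K b) := by
    rw [← e']; ring
  rw [this]
  exact sub_mem (hD a) (mul_mem hg (hD b))

variable [CharZero k]

/-- Characteristic zero enters here: it allows cancelling the exponent that differentiation of a
power of P brings down. -/
lemma natCast_mul_mem_iff (S : Subring K) (hS : ∀ c : k, algebraMap k K c ∈ S) {n : ℕ}
    (hn : n ≠ 0) (g : K) : (n : K) * g ∈ S ↔ g ∈ S := by
  refine ⟨fun h => ?_, fun h => mul_mem (natCast_mem S n) h⟩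
  have := mul_mem (hS ((n : k)⁻¹)) h
  have hn' : (n : K) ≠ 0 := by
    rw [← map_natCast (algebraMap k K), Ne, map_eq_zero]
    exact_mod_cast hn
  rwa [map_inv₀, map_natCast, inv_mul_cancel_left₀ hn'] at this

variable [Algebra k R] [IsScalarTower k R K]

lemma constant_mem_regularAlong (c : k) : algebraMap k K c ∈ regularAlong K hP := by
  rw [IsScalarTower.algebraMap_apply k R K]
  exact algebraMap_mem_regularAlong hP _

/-- A pole of `g` along `P` yields a pole of `D g` whose order is one larger. -/
lemma pow_pred_mul_mem_regularAlong (hD : ∀ r : R, D (algebraMap R K r) ∈ regularAlong K hP)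
    {P' : R} (hP' : D (algebraMap R K P) = algebraMap R K P') (hPP' : ¬ P ∣ P') {n : ℕ} {g : K}
    (h₁ : algebraMap R K P ^ (n + 1) * g ∈ regularAlong K hP)
    (h₂ : algebraMap R K P ^ (n + 1) * D g ∈ regularAlong K hP) :
    algebraMap R K P ^ n * g ∈ regularAlong K hP := by
  -- D(P^(n+1) g) = P^(n+1) D g + (n+1) P^n P' g. The left side and the first summand are regular,
  -- and n+1 and P' are units of the local ring.
  have h₃ := derivation_mem_regularAlong hP D hD h₁
  rw [D.leibniz, D.leibniz_pow, hP'] at h₃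
  have h₄ := sub_mem h₃ h₂
  rw [← mul_mem_regularAlong_iff hP hPP', ← natCast_mul_mem_iff (k := k) (regularAlong K hP)
    (constant_mem_regularAlong hP) (Nat.succ_ne_zero n)]
  convert h₄ using 1
  simp only [smul_eq_mul, nsmul_eq_mul, Nat.add_sub_cancel]
  push_cast
  ring

/-- `D g + c g` never has a simple pole along `P`. -/
lemma mem_regularAlong_of_simple_pole [WfDvdMonoid R]
    (hD : ∀ r : R, D (algebraMap R K r) ∈ regularAlong K hP)
    {P' : R} (hP' : D (algebraMap R K P) = algebraMap R K P') (hPP' : ¬ P ∣ P') {c g : K}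
    (hc : c ∈ regularAlong K hP)
    (h : algebraMap R K P * (D g + c * g) ∈ regularAlong K hP) : g ∈ regularAlong K hP := by
  obtain ⟨n, hn⟩ := exists_pow_mul_mem_regularAlong hP g
  induction n with
  | zero => simpa using hn
  | succ n ih =>
    -- P^(n+1) D g is P^n times the regular element P (D g + c g), minus c P^(n+1) g; so the bound
    -- on the order of g drops by one.
    refine ih (pow_pred_mul_mem_regularAlong hP D hD hP' hPP' hn ?_)
    have h₁ := mul_mem (pow_mem (algebraMap_mem_regularAlong (K := K) hP P) n) h
    have h₂ := mul_mem hc hn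
    convert sub_mem h₁ h₂ using 1
    ring

end LocalRing

/-! ### Hermite reduction over a principal ideal domain. -/

section Hermite

variable {R K : Type*} [CommRing R] [IsDomain R] [IsPrincipalIdealRing R] [Field K] [Algebra R K]
  [IsFractionRing R K] {k : Type*} [Field k] [CharZero k] [Algebra k R] [Algebra k K]
  [IsScalarTower k R K]

/-- Hermite reduction for a derivation on the fraction field of a principal ideal domain:
modulo derivatives every element has only simple poles. Here `s` is a set of representatives of
the primes. -/
lemma exists_hermite_reduction (D : Derivation k K K) (s : Set R)
    (hs : ∀ P : R, Prime P → ∃ Q ∈ s, Associated P Q)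
    (hD : ∀ r : R, ∃ r', D (algebraMap R K r) = algebraMap R K r')
    (hP : ∀ P ∈ s, Prime P → ∃ P', D (algebraMap R K P) = algebraMap R K P' ∧ ¬ P ∣ P') (f : K) :
    ∃ (G : K) (q : R) (c : R →₀ R), (∀ P ∈ c.support, P ∈ s ∧ Prime P) ∧
      f = D G + algebraMap R K q +
        c.sum fun P a => algebraMap R K a / algebraMap R K P := by
  set M : K → Prop := fun f => ∃ (G : K) (q : R) (c : R →₀ R),
    (∀ P ∈ c.support, P ∈ s ∧ Prime P) ∧
      f = D G + algebraMap R K q +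
        c.sum fun P a => algebraMap R K a / algebraMap R K P with hM
  have hadd : ∀ f g, M f → M g → M (f + g) := by
    classical
    rintro f g ⟨G, q, c, hc, rfl⟩ ⟨G', q', c', hc', rfl⟩
    refine ⟨G + G', q + q', c + c', fun P h => ?_, ?_⟩
    · rcases Finset.mem_union.1 (Finsupp.support_add h) with h | h
      exacts [hc P h, hc' P h]
    · rw [Finsupp.sum_add_index' (by simp) (by intros; rw [map_add, add_div])]
      simp only [map_add]
      ring
  have hder : ∀ G, M (D G) := fun G => ⟨G, 0, 0, by simp, by simp⟩
  have hring : ∀ q, M (algebraMap R K q) := fun q => ⟨0, q, 0, by simp, by simp⟩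
  have hsimple : ∀ P ∈ s, Prime P → ∀ a : R, M (algebraMap R K a / algebraMap R K P) := by
    intro P hPs hP a
    refine ⟨0, 0, Finsupp.single P a, fun Q hQ => ?_, ?_⟩
    · rw [Finset.mem_singleton.1 (Finsupp.support_single_subset hQ)]
      exact ⟨hPs, hP⟩
    · rw [Finsupp.sum_single_index (by simp)]
      simp
  have hpow : ∀ P ∈ s, Prime P → ∀ (n : ℕ) (a : R),
      M (algebraMap R K a / algebraMap R K P ^ n) := by
    intro P hPs hPp n
    induction n with
    | zero => intro a; simpa using hring a
    | succ n ih =>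
      intro a
      rcases Nat.eq_zero_or_pos n with rfl | hn
      · simpa using hsimple P hPs hPp a
      obtain ⟨P', e, hPP'⟩ := hP P hPs hPp
      -- With u P + v P' = 1, split a = a u P + a v P'. The second part over P^(n+1) is the
      -- derivative of -a v / (n P^n) up to a pole of order n; this needs n > 0, so simple poles
      -- stay.
      obtain ⟨u, v, huv⟩ := (hPp.irreducible.coprime_iff_not_dvd.2 hPP' : IsCoprime P P')
      obtain ⟨w, hw⟩ := hD (a * v)
      have hP0 : algebraMap R K P ≠ 0 := by
        rw [Ne, IsFractionRing.to_map_eq_zero_iff]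
        exact hPp.ne_zero
      have hn' : (n : K) ≠ 0 := by
        rw [← map_natCast (algebraMap k K), Ne, map_eq_zero]
        exact_mod_cast hn.ne'
      have key : algebraMap R K a / algebraMap R K P ^ (n + 1) =
          D (-(algebraMap R K (a * v) / (n * algebraMap R K P ^ n))) +
          algebraMap R K (algebraMap k R (n : k)⁻¹ * w + a * u) / algebraMap R K P ^ n := by
        have e1 : algebraMap R K a = algebraMap R K (a * u) * algebraMap R K P +
            algebraMap R K (a * v) * algebraMap R K P' := by
          rw [← map_mul, ← map_mul, ← map_add]
          congr 1
          linear_combination (-a) * huv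
        obtain ⟨m, rfl⟩ := Nat.exists_eq_succ_of_ne_zero hn.ne'
        have hn1 : ((m + 1 : ℕ) : K) ≠ 0 := hn'
        rw [map_neg, D.leibniz_div, D.leibniz, D.leibniz_pow, D.map_natCast, hw, e, e1, map_add,
          map_mul (algebraMap R K) (algebraMap k R _), ← IsScalarTower.algebraMap_apply, map_inv₀,
          map_natCast]
        simp only [smul_eq_mul, nsmul_eq_mul, Nat.succ_eq_add_one, Nat.add_sub_cancel]
        field_simp
        ring
      rw [key]
      exact hadd _ _ (hder _) (ih _)
  have hden : ∀ b : R, b ≠ 0 → ∀ a : R, M (algebraMap R K a / algebraMap R K b) := by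
    intro b
    -- Partial fractions: coprime factors are separated by Bézout, and a prime power is moved to its
    -- representative in s.
    induction b using UniqueFactorizationMonoid.induction_on_coprime with
    | h0 => exact fun h => absurd rfl h
    | @h1 b hb =>
      intro _ a
      obtain ⟨u, rfl⟩ := hb
      have : algebraMap R K a / algebraMap R K u = algebraMap R K (a * ↑u⁻¹) := by
        rw [div_eq_iff, ← map_mul]
        · simp
        · rw [Ne, IsFractionRing.to_map_eq_zero_iff]
          exact u.ne_zero
      rw [this]
      exact hring _
    | @hpr P n hPp =>
      intro _ a
      obtain ⟨Q, hQs, u, rfl⟩ := hs P hPp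
      have hu : algebraMap R K (u : R) ≠ 0 := by
        rw [Ne, IsFractionRing.to_map_eq_zero_iff]
        exact u.ne_zero
      have hQ : Prime (P * u) := (Associated.prime ⟨u, rfl⟩ hPp)
      convert hpow _ hQs hQ n (a * u ^ n) using 1
      have hP0 : algebraMap R K P ≠ 0 := by
        rw [Ne, IsFractionRing.to_map_eq_zero_iff]
        exact hPp.ne_zero
      simp only [map_mul, map_pow]
      field_simp
      rw [mul_pow]
      ring
    | @hcp b₁ b₂ hb h₁ h₂ =>
      intro hne a
      have hb₁ := left_ne_zero_of_mul hne
      have hb₂ := right_ne_zero_of_mul hne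
      obtain ⟨u, v, huv⟩ := hb.isCoprime
      have e : algebraMap R K a / algebraMap R K (b₁ * b₂) =
          algebraMap R K (a * v) / algebraMap R K b₁ +
          algebraMap R K (a * u) / algebraMap R K b₂ := by
        have z₁ : algebraMap R K b₁ ≠ 0 := by
          rwa [Ne, IsFractionRing.to_map_eq_zero_iff]
        have z₂ : algebraMap R K b₂ ≠ 0 := by
          rwa [Ne, IsFractionRing.to_map_eq_zero_iff]
        rw [map_mul, div_add_div _ _ z₁ z₂, ← map_mul, ← map_mul, ← map_mul, ← map_add]
        congr 2
        linear_combination (-a) * huv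
      rw [e]
      exact hadd _ _ (h₁ hb₁ _) (h₂ hb₂ _)
  obtain ⟨a, b, hb, rfl⟩ := IsFractionRing.div_surjective (A := R) f
  exact hden b (nonZeroDivisors.ne_zero hb) a

end Hermite

/-! ### Norms and traces of logarithmic derivatives. -/

section NormTrace

open Matrix

/-- Jacobi's formula for a derivation. -/
lemma Matrix.derivation_det {k n F : Type*} [Fintype n] [DecidableEq n] [CommRing k] [CommRing F]
    [Algebra k F] (d : Derivation k F F) (M : Matrix n n F) :
    d M.det = (M.adjugate * M.map d).trace := by
  have hprod : ∀ (s : Finset n) (g : n → F), d (∏ i ∈ s, g i) =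
      ∑ i ∈ s, (∏ j ∈ s.erase i, g j) * d (g i) := by
    intro s g
    induction s using Finset.induction_on with
    | empty => simp
    | insert a s ha ih =>
      rw [Finset.prod_insert ha, d.leibniz, ih, Finset.sum_insert ha, Finset.erase_insert ha]
      simp only [smul_eq_mul, Finset.mul_sum]
      rw [add_comm]
      congr 1
      refine Finset.sum_congr rfl fun i hi => ?_
      rw [Finset.erase_insert_of_ne (by rintro rfl; exact ha hi), Finset.prod_insert (by simp [ha]),
        mul_assoc]
  have hrow : ∀ i, (M.updateRow i fun j => d (M i j)).det = ∑ j, M.adjugate j i * d (M i j) := by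
    intro i
    rw [det_eq_sum_mul_adjugate_row _ i]
    refine Finset.sum_congr rfl fun j _ => ?_
    rw [updateRow_self, adjugate_apply, adjugate_apply, updateRow_idem, mul_comm]
  have : d M.det = ∑ i, (M.updateRow i fun j => d (M i j)).det := by
    -- After transposition the factors of each permutation term are indexed by rows, so
    -- differentiating one factor means replacing one row.
    simp_rw [← det_transpose M, ← det_transpose (M.updateRow _ _), det_apply, map_sum]
    rw [Finset.sum_comm]
    refine Finset.sum_congr rfl fun σ _ => ?_
    rw [Units.smul_def, map_zsmul, hprod, Finset.smul_sum]
    refine Finset.sum_congr rfl fun i _ => ?_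
    congr 1
    rw [← Finset.mul_prod_erase _ _ (Finset.mem_univ i), mul_comm]
    congr 1
    · simp
    · refine Finset.prod_congr rfl fun j hj => ?_
      simp [updateRow_ne (Finset.ne_of_mem_erase hj)]
  rw [this, trace]
  simp_rw [hrow, diag, mul_apply, map_apply]
  rw [Finset.sum_comm]

/-- The norm of a finite field extension turns logarithmic derivatives into traces. -/
lemma trace_logDeriv_eq {k F E : Type*} [CommRing k] [Field F] [Field E] [Algebra F E]
    [FiniteDimensional F E] [Algebra k F] [Algebra k E] (dF : Derivation k F F)
    (dE : Derivation k E E)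
    (h : ∀ a, dE (algebraMap F E a) = algebraMap F E (dF a)) {u : E} (hu : u ≠ 0) :
    Algebra.trace F E (dE u / u) = dF (Algebra.norm F u) / Algebra.norm F u := by
  set b := Module.finBasis F E
  let n := Fin (Module.finrank F E)
  set A : Matrix n n F := Matrix.of fun i j => b.repr (dE (b j)) i with hA
  set m : E → Matrix n n F := fun z => Algebra.leftMulMatrix b z with hm
  have hrep : ∀ z i j, m z i j = b.repr (z * b j) i := Algebra.leftMulMatrix_eq_repr_mul b
  have hm1 : m 1 = 1 := map_one _
  have hmm : ∀ z w, m (z * w) = m z * m w := fun z w => map_mul _ z w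
  -- Multiplication by dE u is the commutator of dE with multiplication by u. In the basis b, dE is
  -- dF on coordinates plus the matrix A.
  have hcomm : m (dE u) = (m u).map dF + A * m u - m u * A := by
    ext i j
    have e₁ : u * b j = ∑ l, m u l j • b l := by
      have := b.sum_repr (u * b j)
      rw [← this]
      simp [hrep]
    have e₂ := congrArg (fun z => b.repr z i) (congrArg dE e₁)
    have e₃ : ∀ z : E, b.repr (u * z) i = ∑ l, m u i l * b.repr z l := by
      intro z
      conv_lhs => rw [← b.sum_repr z, Finset.mul_sum]
      simp only [mul_smul_comm, map_sum, map_smul, Finsupp.coe_finsetSum, Finset.sum_apply,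
        Finsupp.smul_apply, smul_eq_mul, hrep]
      exact Finset.sum_congr rfl fun l _ => mul_comm _ _
    have e₄ : ∀ l, dE (m u l j • b l) = m u l j • dE (b l) + dF (m u l j) • b l := by
      intro l
      rw [Algebra.smul_def, dE.leibniz, h, smul_eq_mul, smul_eq_mul, Algebra.smul_def,
        Algebra.smul_def, mul_comm (b l)]
    have e₅ : b.repr (b j * dE u) i = m (dE u) i j := by
      rw [hrep, mul_comm]
    simp only [dE.leibniz, smul_eq_mul, map_add, Finsupp.add_apply, e₃, e₅, map_sum, e₄,
      Finset.sum_add_distrib, map_smul, Finsupp.coe_finsetSum, Finset.sum_apply,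
      Finsupp.smul_apply, Module.Basis.repr_self, Finsupp.single_apply, smul_eq_mul, mul_ite,
      mul_one, mul_zero, Finset.sum_ite_eq', Finset.mem_univ, if_true] at e₂
    simp only [Matrix.sub_apply, Matrix.add_apply, map_apply, mul_apply, hA, of_apply]
    rw [eq_sub_iff_add_eq', e₂, add_comm]
    congr 1
    exact Finset.sum_congr rfl fun l _ => mul_comm _ _
  have hmu : m u * m u⁻¹ = 1 := by rw [← hmm, mul_inv_cancel₀ hu, hm1]
  have hmu' : m u⁻¹ * m u = 1 := by rw [← hmm, inv_mul_cancel₀ hu, hm1]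
  have hdet : (m u).det ≠ 0 := by
    intro h0
    have := congrArg Matrix.det hmu
    rw [det_mul, h0] at this
    simp at this
  have hadj : (m u).adjugate = (m u).det • m u⁻¹ := by
    have := congrArg (· * m u⁻¹) (adjugate_mul (m u))
    simpa [Matrix.mul_assoc, hmu] using this
  rw [Algebra.trace_eq_matrix_trace b, Algebra.norm_eq_matrix_det b, Matrix.derivation_det]
  change (m _).trace = (((m u).adjugate) * (m u).map dF).trace / (m u).det
  rw [eq_div_iff hdet, hadj, smul_mul, trace_smul, smul_eq_mul, mul_comm, div_eq_inv_mul]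
  rw [hmm, hcomm, mul_sub, mul_add]
  congr 1
  -- After multiplication by the inverse of m u, the two terms with A have equal trace and cancel;
  -- what is left is Jacobi's formula.
  rw [trace_sub, trace_add, ← Matrix.mul_assoc (m u⁻¹) (m u) A, hmu', one_mul,
    trace_mul_comm (m u⁻¹) (A * m u), Matrix.mul_assoc A, hmu, mul_one, add_sub_cancel_right]

end NormTrace

/-! ### Derivations acting on coefficients of polynomials. -/

section CoefficientDerivation

variable {k A : Type*} [CommRing k] [CommRing A] [Algebra k A]

/-- The derivation of `A[X]` acting on the coefficients. -/
noncomputable def coeffDerivation (d : Derivation k A A) :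
    Derivation k (Polynomial A) (Polynomial A) :=
  PolynomialModule.equivPolynomialSelf.compDer d.mapCoeffs

@[simp]
lemma coeff_coeffDerivation (d : Derivation k A A) (p : Polynomial A) (n : ℕ) :
    (coeffDerivation d p).coeff n = d (p.coeff n) := rfl

@[simp]
lemma coeffDerivation_C (d : Derivation k A A) (a : A) :
    coeffDerivation d (Polynomial.C a) = Polynomial.C (d a) := by
  ext n
  simp [Polynomial.coeff_C, apply_ite d]

@[simp]
lemma coeffDerivation_X (d : Derivation k A A) : coeffDerivation d Polynomial.X = 0 := by
  ext n
  simp [Polynomial.coeff_X, apply_ite d]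

lemma coeffDerivation_derivative (d : Derivation k A A) (p : Polynomial A) :
    coeffDerivation d (Polynomial.derivative p) =
      Polynomial.derivative (coeffDerivation d p) := by
  ext n
  simp [Polynomial.coeff_derivative, mul_comm]

/-- The chain rule for a derivation extending a multiple of `d`. -/
lemma derivation_aeval_eq {B : Type*} [CommRing B] [Algebra k B] [Algebra A B]
    (d : Derivation k A A) (τ : Derivation k B B) (w : B)
    (h : ∀ a, τ (algebraMap A B a) = algebraMap A B (d a) * w) (v : B) (p : Polynomial A) :
    τ (Polynomial.aeval v p) = Polynomial.aeval v (coeffDerivation d p) * w +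
      Polynomial.aeval v (Polynomial.derivative p) * τ v := by
  induction p using Polynomial.induction_on' with
  | add p q hp hq => simp only [map_add, hp, hq, add_mul]; ring
  | monomial n a =>
    have : coeffDerivation d (Polynomial.monomial n a) = Polynomial.monomial n (d a) := by
      ext m
      simp [Polynomial.coeff_monomial, apply_ite d]
    rw [this, Polynomial.derivative_monomial]
    simp only [Polynomial.aeval_monomial, τ.leibniz, τ.leibniz_pow, h, smul_eq_mul, nsmul_eq_mul,
      map_mul, map_natCast]
    ring

end CoefficientDerivation

/-! ### The field ℂ(x): derivation, residues, proper fractions. -/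

/-- The field `ℂ(x)` of rational functions in one variable. -/
abbrev RatX : Type := FractionRing (Polynomial ℂ)

namespace RatX

/-- The variable of `ℂ(x)`. -/
noncomputable def X : RatX := algebraMap (Polynomial ℂ) RatX Polynomial.X

/-- The derivation `d/dx` of `ℂ(x)`. -/
noncomputable def deriv : Derivation ℂ RatX RatX :=
  Derivation.toFractionField ((Algebra.linearMap (Polynomial ℂ) RatX).compDer
    Polynomial.derivative')

lemma deriv_algebraMap (p : Polynomial ℂ) :
    deriv (algebraMap (Polynomial ℂ) RatX p) =
      algebraMap (Polynomial ℂ) RatX (Polynomial.derivative p) := by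
  rw [deriv, Derivation.toFractionField_algebraMap]
  rfl

@[simp]
lemma deriv_X : deriv X = 1 := by
  rw [X, deriv_algebraMap, Polynomial.derivative_X, map_one]

lemma X_ne_zero : X ≠ 0 := by
  rw [X, Ne, IsFractionRing.to_map_eq_zero_iff]
  exact Polynomial.X_ne_zero

lemma algebraMap_ne_zero {p : Polynomial ℂ} (hp : p ≠ 0) :
    algebraMap (Polynomial ℂ) RatX p ≠ 0 := by
  rwa [Ne, IsFractionRing.to_map_eq_zero_iff]

lemma exists_eq_div (g : RatX) : ∃ a b : Polynomial ℂ, b ≠ 0 ∧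
    g = algebraMap (Polynomial ℂ) RatX a / algebraMap (Polynomial ℂ) RatX b := by
  obtain ⟨a, b, hb, rfl⟩ := IsFractionRing.div_surjective (A := Polynomial ℂ) g
  exact ⟨a, b, nonZeroDivisors.ne_zero hb, rfl⟩

/-- A derivation out of `ℂ(x)` along a homomorphism is determined by its value on `x`. -/
lemma derivation_eq {E : Type*} [Field E] [Algebra ℂ E] [Algebra RatX E] [IsScalarTower ℂ RatX E]
    (τ : Derivation ℂ E E) (a : RatX) :
    τ (algebraMap RatX E a) = algebraMap RatX E (deriv a) * τ (algebraMap RatX E X) := by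
  refine eq_of_leibniz_of_fractionRing (R := Polynomial ℂ) (algebraMap RatX E)
    (fun a => τ (algebraMap RatX E a))
    (fun a => algebraMap RatX E (deriv a) * τ (algebraMap RatX E X)) ?_ ?_ ?_ a
  · intro a b
    simp
  · intro a b
    simp only [Derivation.leibniz, smul_eq_mul, map_add, map_mul]
    ring
  · intro p
    simp only [deriv_algebraMap]
    induction p using Polynomial.induction_on' with
    | add p q hp hq => simp only [map_add, hp, hq, add_mul]
    | monomial n a =>
      have h : ∀ (n : ℕ) (a : ℂ), algebraMap RatX E (algebraMap (Polynomial ℂ) RatX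
          (Polynomial.monomial n a)) = algebraMap ℂ E a * algebraMap RatX E X ^ n := by
        intro n a
        rw [← Polynomial.C_mul_X_pow_eq_monomial, map_mul, map_mul, map_pow, map_pow, X,
          IsScalarTower.algebraMap_apply ℂ RatX E]
        rfl
      rw [Polynomial.derivative_monomial, h, h, τ.leibniz, τ.map_algebraMap, τ.leibniz_pow]
      simp only [smul_eq_mul, nsmul_eq_mul, map_mul, map_natCast]
      ring

lemma not_dvd_derivative {P : Polynomial ℂ} (hP : Irreducible P) :
    ¬ P ∣ Polynomial.derivative P := fun h =>
  absurd (Polynomial.eq_zero_of_dvd_of_natDegree_lt h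
    (Polynomial.natDegree_derivative_lt hP.natDegree_pos.ne')) fun h0 => by
      exact hP.natDegree_pos.ne' (Polynomial.derivative_eq_zero.1 h0)

lemma deriv_mem_regularAlong {P : Polynomial ℂ} (hP : Prime P) (r : Polynomial ℂ) :
    deriv (algebraMap _ RatX r) ∈ regularAlong RatX hP := by
  rw [deriv_algebraMap]
  exact algebraMap_mem_regularAlong hP _

lemma mem_regularAlong_of_simple_pole {P : Polynomial ℂ} (hP : Prime P) {c g : RatX}
    (hc : c ∈ regularAlong RatX hP)
    (h : algebraMap _ RatX P * (deriv g + c * g) ∈ regularAlong RatX hP) :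
    g ∈ regularAlong RatX hP :=
  _root_.mem_regularAlong_of_simple_pole hP deriv (deriv_mem_regularAlong hP) (deriv_algebraMap P)
    (not_dvd_derivative hP.irreducible) hc h

/-- A rational function without poles at finite distance is a polynomial. -/
lemma exists_polynomial_of_forall_regular {g : RatX}
    (h : ∀ (P : Polynomial ℂ) (hP : Prime P), g ∈ regularAlong RatX hP) :
    ∃ p, g = algebraMap (Polynomial ℂ) RatX p := by
  set a := IsFractionRing.num (Polynomial ℂ) g
  set b := (IsFractionRing.den (Polynomial ℂ) g).1 with hb
  have hb0 : b ≠ 0 := nonZeroDivisors.ne_zero (IsFractionRing.den (Polynomial ℂ) g).2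
  have hg : g * algebraMap _ RatX b = algebraMap _ RatX a := by
    have := IsFractionRing.mk'_num_den (Polynomial ℂ) g
    rw [IsFractionRing.mk'_eq_div, div_eq_iff (algebraMap_ne_zero hb0)] at this
    exact this.symm
  have hu : IsUnit b := by
    by_contra hu
    obtain ⟨P, hP, hPb⟩ := WfDvdMonoid.exists_irreducible_factor hu hb0
    obtain ⟨a', b', hb', e⟩ := h P hP.prime
    have e' : a' * b = a * b' := by
      apply IsFractionRing.injective (Polynomial ℂ) RatX
      rw [map_mul, map_mul, ← e, ← hg]
      ring
    have hPa : P ∣ a :=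
      (hP.prime.dvd_or_dvd (e' ▸ Dvd.dvd.mul_left hPb a')).resolve_right hb'
    exact hP.not_isUnit (IsFractionRing.num_den_reduced (Polynomial ℂ) g hPa hPb)
  obtain ⟨u, hu⟩ := hu
  refine ⟨a * ↑u⁻¹, ?_⟩
  rw [map_mul, ← hg, ← hu, mul_assoc, ← map_mul]
  simp

/-- A pole of g would give a pole of its derivative, so g is a polynomial, and then it is constant.
-/
lemma exists_const_of_deriv_eq_zero {g : RatX} (h : deriv g = 0) :
    ∃ c : ℂ, g = algebraMap ℂ RatX c := by
  obtain ⟨p, rfl⟩ := exists_polynomial_of_forall_regular (g := g) fun P hP =>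
    mem_regularAlong_of_simple_pole hP (zero_mem _) (by simp [h, zero_mem])
  rw [deriv_algebraMap, IsFractionRing.to_map_eq_zero_iff] at h
  refine ⟨p.coeff 0, ?_⟩
  conv_lhs => rw [Polynomial.eq_C_of_derivative_eq_zero h]
  rfl

/-- `X - c` as a prime polynomial. -/
lemma prime_X_sub_C (c : ℂ) : Prime (Polynomial.X - Polynomial.C c) := Polynomial.prime_X_sub_C c

/-- A finite sum of fractions `r_c / (x - c)` is a derivative only if all `r_c` vanish. -/
lemma residue_eq_zero_of_eq_deriv (s : Finset ℂ) (r : ℂ → ℂ) (g : RatX)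
    (h : deriv g = ∑ c ∈ s, algebraMap ℂ RatX (r c) / (X - algebraMap ℂ RatX c))
    {c : ℂ} (hc : c ∈ s) : r c = 0 := by
  classical
  have e : ∀ c, X - algebraMap ℂ RatX c =
      algebraMap _ RatX (Polynomial.X - Polynomial.C c) := by
    intro c
    rw [map_sub]
    rfl
  set P := Polynomial.X - Polynomial.C c with hPdef
  have hP : Prime P := prime_X_sub_C c
  have hreg : ∑ c ∈ s.erase c, algebraMap ℂ RatX (r c) / (X - algebraMap ℂ RatX c) ∈
      regularAlong RatX hP := by
    refine sum_mem fun d hd => ?_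
    rw [div_eq_mul_inv, e]
    refine mul_mem (constant_mem_regularAlong hP _) (inv_mem_regularAlong hP ?_)
    rw [hPdef, Polynomial.dvd_iff_isRoot]
    simpa [sub_eq_zero] using (Finset.ne_of_mem_erase hd).symm
  rw [← Finset.add_sum_erase _ _ hc] at h
  have hP0 : algebraMap _ RatX P ≠ 0 := algebraMap_ne_zero hP.ne_zero
  -- The derivative of g has at most a simple pole at c, hence g is regular there. Then so is its
  -- derivative, and the fraction with denominator x - c must have numerator zero.
  have hg : g ∈ regularAlong RatX hP := by
    refine mem_regularAlong_of_simple_pole hP (zero_mem _) ?_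
    rw [zero_mul, add_zero, h, mul_add, e, mul_div_cancel₀ _ hP0]
    exact add_mem (constant_mem_regularAlong hP _)
      (mul_mem (algebraMap_mem_regularAlong hP _) hreg)
  have hd := derivation_mem_regularAlong hP deriv (deriv_mem_regularAlong hP) hg
  have := sub_mem hd hreg
  rw [h, add_sub_cancel_right, e, IsScalarTower.algebraMap_apply ℂ (Polynomial ℂ) RatX] at this
  have hdvd := dvd_of_div_mem_regularAlong hP this
  rw [hPdef, Polynomial.dvd_iff_isRoot] at hdvd
  simpa using hdvd

/-- Quotients whose numerator has smaller degree than the denominator. -/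
def IsProper (g : RatX) : Prop := ∃ a b : Polynomial ℂ, a.degree < b.degree ∧
  g = algebraMap (Polynomial ℂ) RatX a / algebraMap (Polynomial ℂ) RatX b

lemma isProper_zero : IsProper 0 := ⟨0, 1, by simp, by simp⟩

lemma IsProper.add {g h : RatX} (hg : IsProper g) (hh : IsProper h) : IsProper (g + h) := by
  obtain ⟨a, b, hab, rfl⟩ := hg
  obtain ⟨a', b', hab', rfl⟩ := hh
  have hb : b ≠ 0 := by rintro rfl; simp at hab
  have hb' : b' ≠ 0 := by rintro rfl; simp at hab'
  refine ⟨a * b' + b * a', b * b', ?_, ?_⟩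
  · refine (Polynomial.degree_add_le _ _).trans_lt (max_lt ?_ ?_)
    · rw [Polynomial.degree_mul, Polynomial.degree_mul]
      exact WithBot.add_lt_add_right (by simpa using hb') hab
    · rw [Polynomial.degree_mul, Polynomial.degree_mul]
      exact WithBot.add_lt_add_left (by simpa using hb) hab'
  · rw [map_add, map_mul, map_mul, map_mul, div_add_div _ _ (algebraMap_ne_zero hb)
      (algebraMap_ne_zero hb')]

lemma IsProper.const_mul {g : RatX} (hg : IsProper g) (c : ℂ) :
    IsProper (algebraMap ℂ RatX c * g) := by
  obtain ⟨a, b, hab, rfl⟩ := hg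
  refine ⟨Polynomial.C c * a, b, ?_, ?_⟩
  · refine lt_of_le_of_lt ?_ hab
    rw [Polynomial.degree_mul]
    calc _ ≤ 0 + a.degree := by gcongr; exact Polynomial.degree_C_le
      _ = _ := zero_add _
  · rw [map_mul, mul_div_assoc]
    rfl

lemma IsProper.neg {g : RatX} (hg : IsProper g) : IsProper (-g) := by
  simpa using hg.const_mul (-1)

/-- A comparison of degrees. It is the source of contradictions wherever a proper fraction is
identified with a constant or a polynomial. -/
lemma IsProper.eq_zero_of_eq_algebraMap {g : RatX} (hg : IsProper g) {p : Polynomial ℂ}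
    (h : g = algebraMap _ RatX p) : p = 0 := by
  obtain ⟨a, b, hab, rfl⟩ := hg
  have hb : b ≠ 0 := by rintro rfl; simp at hab
  rw [div_eq_iff (algebraMap_ne_zero hb), ← map_mul] at h
  have h' := IsFractionRing.injective _ _ h
  by_contra hp
  rw [h', Polynomial.degree_mul] at hab
  have : (b.degree : WithBot ℕ) ≤ p.degree + b.degree := by
    rw [Polynomial.degree_eq_natDegree hb, Polynomial.degree_eq_natDegree hp]
    exact_mod_cast Nat.le_add_left _ _
  exact absurd hab (not_lt.2 this)

lemma isProper_derivative_div {p : Polynomial ℂ} (hp : p ≠ 0) :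
    IsProper (algebraMap _ RatX (Polynomial.derivative p) / algebraMap _ RatX p) :=
  ⟨_, _, Polynomial.degree_derivative_lt hp, rfl⟩

/-- For g = a / b this is a'/a - b'/b, and differentiation lowers the degree. -/
lemma isProper_logDeriv {g : RatX} (hg : g ≠ 0) : IsProper (deriv g / g) := by
  obtain ⟨a, b, hb, rfl⟩ := exists_eq_div g
  have ha : a ≠ 0 := by rintro rfl; simp at hg
  have ha' := algebraMap_ne_zero ha
  have hb' := algebraMap_ne_zero hb
  have : deriv (algebraMap _ RatX a / algebraMap _ RatX b) /
      (algebraMap _ RatX a / algebraMap _ RatX b) =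
      algebraMap _ RatX (Polynomial.derivative a) / algebraMap _ RatX a +
      -(algebraMap _ RatX (Polynomial.derivative b) / algebraMap _ RatX b) := by
    rw [Derivation.leibniz_div, deriv_algebraMap, deriv_algebraMap]
    simp only [smul_eq_mul]
    field_simp
    ring
  rw [this]
  exact (isProper_derivative_div ha).add (isProper_derivative_div hb).neg

end RatX

/-! ### Algebraic functions: eigenvalues and primitives. -/

section Classification

variable {E : Type*} [Field E] [Algebra ℂ E] [Algebra RatX E] [IsScalarTower ℂ RatX E]

/-- There is no solution of `τ u = l u` with `l ≠ 0` when `τ z - τ w / w = 1` for algebraic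
functions `u`, `w` of `z`. -/
lemma eigenvalue_eq_zero [FiniteDimensional RatX E] (τ : Derivation ℂ E E)
    (hz : τ (algebraMap RatX E RatX.X) ≠ 0) {u w : E} (hu : u ≠ 0) (hw : w ≠ 0)
    (h : τ (algebraMap RatX E RatX.X) - τ w / w = 1) {l : ℂ}
    (hl : τ u = algebraMap ℂ E l * u) : l = 0 := by
  set z := algebraMap RatX E RatX.X
  -- Normalised so that δ is d/dz and extends the derivation of ℂ(z); only then does the norm
  -- formula for traces apply.
  set δ : Derivation ℂ E E := (τ z)⁻¹ • τ with hδ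
  have hcompat : ∀ a, δ (algebraMap RatX E a) = algebraMap RatX E (RatX.deriv a) := by
    intro a
    rw [hδ, Derivation.smul_apply, RatX.derivation_eq τ a, smul_eq_mul, mul_comm (algebraMap _ _ _),
      inv_mul_cancel_left₀ hz]
  have htr : ∀ v : E, v ≠ 0 → RatX.IsProper (Algebra.trace RatX E (δ v / v)) := by
    intro v hv
    have := trace_logDeriv_eq RatX.deriv δ hcompat hv
    rw [this]
    exact RatX.isProper_logDeriv (Algebra.norm_ne_zero_iff.2 hv)
  -- Indeed δ u / u = l / τ z and δ w / w = 1 - 1 / τ z. The trace of this identity equates the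
  -- degree times l with a proper fraction.
  have e : algebraMap RatX E (algebraMap ℂ RatX l) =
      δ u / u + (algebraMap ℂ RatX l) • (δ w / w) := by
    rw [Algebra.smul_def, ← IsScalarTower.algebraMap_apply]
    simp only [hδ, Derivation.smul_apply, smul_eq_mul, hl]
    have hz' : τ z = 1 + τ w / w := by linear_combination h
    field_simp
    rw [hz']
    field_simp
  have e' := congrArg (Algebra.trace RatX E) e
  rw [Algebra.trace_algebraMap, map_add, map_smul] at e'
  have hp := (htr u hu).add ((htr w hw).const_mul l)
  rw [smul_eq_mul] at e'
  rw [← e', nsmul_eq_mul] at hp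
  have := hp.eq_zero_of_eq_algebraMap
    (p := Polynomial.C (Module.finrank RatX E * l)) (by
      rw [Polynomial.C_mul, map_mul]
      congr 1
      simp)
  rw [Polynomial.C_eq_zero, mul_eq_zero] at this
  exact this.resolve_left (by exact_mod_cast Module.finrank_pos.ne')

variable [Algebra.IsAlgebraic RatX E]

/-- If the derivative of an algebraic function is rational, it is the derivative of a rational
function; if it is zero, the function is constant. -/
lemma exists_rational_primitive (τ : Derivation ℂ E E)
    (hz : τ (algebraMap RatX E RatX.X) ≠ 0) {v : E} {r : RatX}
    (h : τ v = algebraMap RatX E r * τ (algebraMap RatX E RatX.X)) :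
    (∃ s, r = RatX.deriv s) ∧ (r = 0 → ∃ c : ℂ, v = algebraMap ℂ E c) := by
  have hintg : IsIntegral RatX v := (Algebra.IsAlgebraic.isAlgebraic v).isIntegral
  set p := minpoly RatX v with hp
  have hmonic : p.Monic := minpoly.monic hintg
  have hdeg : 0 < p.natDegree := minpoly.natDegree_pos hintg
  -- Up to the factor τ x, q(v) is the derivative of p(v) = 0. As p is monic, q has smaller degree
  -- than the minimal polynomial and must be zero.
  set q := coeffDerivation RatX.deriv p + Polynomial.C r * Polynomial.derivative p with hq
  have hqv : Polynomial.aeval v q = 0 := by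
    have := derivation_aeval_eq RatX.deriv τ _ (RatX.derivation_eq τ) v p
    rw [minpoly.aeval, map_zero, h] at this
    have h2 : (Polynomial.aeval v q) * τ (algebraMap RatX E RatX.X) = 0 := by
      rw [hq, map_add, map_mul, Polynomial.aeval_C]
      linear_combination -this
    exact (mul_eq_zero.1 h2).resolve_right hz
  have hq0 : q = 0 := by
    by_contra hne
    have h1 := Polynomial.natDegree_le_natDegree (minpoly.degree_le_of_ne_zero RatX v hne hqv)
    rw [← hp] at h1
    have h2 : q.natDegree < p.natDegree := by
      rw [Polynomial.natDegree_lt_iff_degree_lt hne, Polynomial.degree_lt_iff_coeff_zero]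
      intro m hm
      rw [hq, Polynomial.coeff_add, coeff_coeffDerivation, Polynomial.coeff_C_mul,
        Polynomial.coeff_derivative, Polynomial.coeff_eq_zero_of_natDegree_lt (n := m + 1) (by omega)]
      rcases hm.eq_or_lt with rfl | hm
      · rw [hmonic.coeff_natDegree]; simp
      · rw [Polynomial.coeff_eq_zero_of_natDegree_lt hm]; simp
    omega
  obtain ⟨n, hn⟩ := Nat.exists_eq_succ_of_ne_zero hdeg.ne'
  -- The coefficient just below the leading one gives p_n' + (n+1) r = 0, so -p_n / (n+1) is a
  -- rational primitive of r.
  have hcoeff := congrArg (fun q => Polynomial.coeff q n) hq0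
  have hlead : p.coeff (n + 1) = 1 := by
    have := hmonic.coeff_natDegree
    rwa [hn] at this
  simp only [hq, Polynomial.coeff_add, coeff_coeffDerivation, Polynomial.coeff_C_mul,
    Polynomial.coeff_derivative, hlead, one_mul, Polynomial.coeff_zero] at hcoeff
  constructor
  · have hn1 : ((n : RatX) + 1) ≠ 0 := by exact_mod_cast Nat.succ_ne_zero n
    refine ⟨-(p.coeff n) / ((n + 1 : ℕ) : RatX), ?_⟩
    rw [Derivation.leibniz_div_const _ _ _ (Derivation.map_natCast _ _), map_neg, smul_eq_mul]
    push_cast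
    field_simp
    linear_combination hcoeff
  · rintro rfl
    -- For r = 0 all coefficients of the minimal polynomial are constants; so v is algebraic over
    -- the algebraically closed field ℂ.
    have hconst : ∀ m, ∃ c : ℂ, p.coeff m = algebraMap ℂ RatX c := by
      intro m
      refine RatX.exists_const_of_deriv_eq_zero ?_
      simpa [hq] using congrArg (fun q => Polynomial.coeff q m) hq0
    have hlift : p ∈ Polynomial.lifts (algebraMap ℂ RatX) := by
      rw [Polynomial.lifts_iff_coeff_lifts]
      intro m
      obtain ⟨c, hc⟩ := hconst m
      exact ⟨c, hc.symm⟩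
    obtain ⟨p₀, hp₀⟩ := (Polynomial.mem_lifts _).1 hlift
    have hp0 : p₀ ≠ 0 := by
      rintro rfl
      exact hmonic.ne_zero (by rw [← hp₀, Polynomial.map_zero])
    have halg : IsAlgebraic ℂ v := ⟨p₀, hp0, by
      rw [← Polynomial.aeval_map_algebraMap RatX, hp₀]
      exact minpoly.aeval _ _⟩
    obtain ⟨c, hc⟩ := minpoly.mem_range_of_degree_eq_one ℂ v
      (IsAlgClosed.degree_eq_one_of_irreducible ℂ (minpoly.irreducible halg.isIntegral))
    exact ⟨c, hc.symm⟩

end Classification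

/-! ### Linear operators with constant coefficients. -/

section ConstantCoefficients

/-- Induction along the linear factors of an operator with constant coefficients. -/
lemma induction_of_aeval_eq_zero {V : Type*} [AddCommGroup V] [Module ℂ V] (τ : V →ₗ[ℂ] V)
    (p : V → Prop) (h0 : p 0) (hstep : ∀ (v : V) (l : ℂ), p (τ v - l • v) → p v)
    {L : Polynomial ℂ} (hL : L ≠ 0) {v : V} (h : Polynomial.aeval (R := ℂ) (A := Module.End ℂ V) τ L v = 0) :
    p v := by
  obtain ⟨n, hn⟩ : ∃ n, L.natDegree = n := ⟨_, rfl⟩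
  induction n generalizing L v with
  | zero =>
    rw [Polynomial.eq_C_of_natDegree_eq_zero hn] at h hL
    rw [Polynomial.aeval_C, Module.algebraMap_end_apply] at h
    rwa [(smul_eq_zero.1 h).resolve_left (by simpa using hL)]
  | succ n ih =>
    obtain ⟨l, hl⟩ := IsAlgClosed.exists_root L (by
      rw [Polynomial.degree_eq_natDegree hL, hn]
      exact_mod_cast Nat.succ_ne_zero n)
    obtain ⟨M, rfl⟩ := Polynomial.dvd_iff_isRoot.2 hl
    have hM : M ≠ 0 := right_ne_zero_of_mul hL
    -- If L = (X - l) M, the cofactor M annihilates (τ - l) v, which is covered by induction on the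
    -- degree.
    refine hstep v l (ih hM ?_ ?_)
    · rw [mul_comm, map_mul] at h
      simpa using h
    · rw [Polynomial.natDegree_mul (left_ne_zero_of_mul hL) hM, Polynomial.natDegree_X_sub_C] at hn
      omega

end ConstantCoefficients

/-! ### Exchanging the roles of x and y in a function field. -/

section FunctionField

open Polynomial

variable {E : Type*} [Field E] [Algebra ℂ E]

/-- If `y` is algebraic over `ℂ[x]` and transcendental over `ℂ` then `x` is algebraic over
`ℂ[y]`. -/
lemma exists_swapped_relation {x y : E} (Q : Polynomial (Polynomial ℂ)) (hQ : Q ≠ 0)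
    (h : aevalAeval x y Q = 0) (hy : Transcendental ℂ y) :
    ∃ Q' : Polynomial (Polynomial ℂ), Q'.map (aeval (R := ℂ) y).toRingHom ≠ 0 ∧
      aevalAeval y x Q' = 0 := by
  refine ⟨Bivariate.swap Q, ?_, ?_⟩
  · have hinj : Function.Injective (aeval (R := ℂ) y).toRingHom :=
      transcendental_iff_injective.1 hy
    rw [Ne, Polynomial.map_eq_zero_iff hinj]
    simpa using hQ
  · rw [Bivariate.aevalAeval_swap]
    exact h

/-- The embedding of `ℂ(z)` given by a transcendental element. -/
lemma exists_embedding {y : E} (hy : Transcendental ℂ y) : ∃ φ : RatX →ₐ[ℂ] E, φ RatX.X = y := by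
  have hinj : Function.Injective (aeval (R := ℂ) y) := transcendental_iff_injective.1 hy
  refine ⟨IsFractionRing.liftAlgHom hinj, ?_⟩
  rw [RatX.X, IsFractionRing.liftAlgHom_apply, IsFractionRing.lift_algebraMap]
  simp

lemma aevalAeval_eq_eval₂ (x y : E) (Q : Polynomial (Polynomial ℂ)) :
    aevalAeval x y Q = eval₂ (aeval (R := ℂ) x).toRingHom y Q := by
  induction Q using Polynomial.induction_on' with
  | add p q hp hq => rw [map_add, hp, hq, eval₂_add]
  | monomial n a =>
    rw [← C_mul_X_pow_eq_monomial, map_mul, map_pow, aevalAeval_C, aevalAeval_Y, eval₂_mul,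
      eval₂_C, eval₂_X_pow]
    rfl

/-- A field generated by `x` and `y` with `x` algebraic over `ℂ(y)` is finite over `ℂ(y)`. -/
lemma finite_of_relation {x y : E} (φ : RatX →ₐ[ℂ] E) (hφ : φ RatX.X = y)
    (hgen : ∀ S : IntermediateField ℂ E, x ∈ S → y ∈ S → S = ⊤)
    {Q : Polynomial (Polynomial ℂ)} (hQ : Q.map (aeval (R := ℂ) y).toRingHom ≠ 0)
    (h : aevalAeval y x Q = 0) : φ.toRingHom.Finite := by
  let _ : Algebra RatX E := φ.toRingHom.toAlgebra
  have : IsScalarTower ℂ RatX E := IsScalarTower.of_algebraMap_eq fun c => (φ.commutes c).symm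
  have hx : IsIntegral RatX x := by
    refine IsAlgebraic.isIntegral ⟨Q.map (algebraMap (Polynomial ℂ) RatX), fun h0 => ?_, ?_⟩
    · rw [Polynomial.map_eq_zero_iff (IsFractionRing.injective _ _)] at h0
      exact hQ (by rw [h0, Polynomial.map_zero])
    · rw [← h, aevalAeval_eq_eval₂, aeval_def, eval₂_map]
      congr 1
      ext
      · change φ (algebraMap ℂ RatX _) = _
        simp
      · change φ RatX.X = _
        simp [hφ]
  have hfin : FiniteDimensional RatX (IntermediateField.adjoin RatX {x}) :=
    IntermediateField.adjoin.finiteDimensional hx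
  have htop : IntermediateField.adjoin RatX {x} = ⊤ := by
    have := hgen ((IntermediateField.adjoin RatX {x}).restrictScalars ℂ)
      (IntermediateField.mem_adjoin_simple_self RatX x)
      (hφ ▸ (IntermediateField.adjoin RatX {x}).algebraMap_mem RatX.X)
    rw [eq_top_iff]
    intro z _
    have hz : z ∈ (IntermediateField.adjoin RatX {x}).restrictScalars ℂ := this ▸ trivial
    exact hz
  rw [htop] at hfin
  have : FiniteDimensional RatX E :=
    Module.Finite.equiv (IntermediateField.topEquiv (F := RatX) (E := E)).toLinearEquiv
  exact this

/-- The embedding is an argument and not an instance, because in the application the field is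
already an algebra over ℂ(x) through x, while the trace has to be taken over ℂ(y). -/
lemma eigenvalue_eq_zero_of_finite (φ : RatX →ₐ[ℂ] E) (hfin : φ.toRingHom.Finite)
    (τ : Derivation ℂ E E) (hz : τ (φ RatX.X) ≠ 0) {u w : E} (hu : u ≠ 0) (hw : w ≠ 0)
    (h : τ (φ RatX.X) - τ w / w = 1) {l : ℂ} (hl : τ u = algebraMap ℂ E l * u) : l = 0 := by
  let _ : Algebra RatX E := φ.toRingHom.toAlgebra
  have : IsScalarTower ℂ RatX E := IsScalarTower.of_algebraMap_eq fun c => (φ.commutes c).symm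
  have : FiniteDimensional RatX E := hfin
  exact eigenvalue_eq_zero τ hz hu hw h hl

end FunctionField

/-! ### Constant-coefficient equations in an algebraic function field. -/

section Classification

variable {E : Type*} [Field E] [Algebra ℂ E] [Algebra RatX E] [IsScalarTower ℂ RatX E]

open Polynomial IntermediateField

/-- In an algebraic extension of `ℂ(x)` generated by a nonconstant `y`, with a derivation `τ`
such that `τ y - τ x / x = 1`, only constants satisfy linear differential equations with constant
coefficients. -/
lemma exists_const_of_aeval_derivation_eq_zero [Algebra.IsAlgebraic RatX E]
    (τ : Derivation ℂ E E) {y : E} (hgen : IntermediateField.adjoin RatX {y} = ⊤)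
    (hx : τ (algebraMap RatX E RatX.X) ≠ 0)
    (h : τ y - τ (algebraMap RatX E RatX.X) / algebraMap RatX E RatX.X = 1)
    (hy : ∀ c : ℂ, y ≠ algebraMap ℂ E c) {L : Polynomial ℂ} (hL : L ≠ 0) {v : E}
    (hv : aeval (R := ℂ) (A := Module.End ℂ E) τ.toLinearMap L v = 0) :
    ∃ c : ℂ, v = algebraMap ℂ E c := by
  set x := algebraMap RatX E RatX.X with hxdef
  have hx0 : x ≠ 0 := by simpa [hxdef] using RatX.X_ne_zero
  have hτy : τ y ≠ 0 := by
    intro h0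
    obtain ⟨c, hc⟩ := (exists_rational_primitive τ hx (v := y) (r := 0) (by simp [h0])).2 rfl
    exact hy c hc
  have htr : Transcendental ℂ y := by
    intro halg
    obtain ⟨c, hc⟩ := minpoly.mem_range_of_degree_eq_one ℂ y
      (IsAlgClosed.degree_eq_one_of_irreducible ℂ (minpoly.irreducible halg.isIntegral))
    exact hy c hc.symm
  -- Here `eigenvalue_eq_zero` is used with z = y and w = x, so the field must first be seen to be
  -- finite over ℂ(y).
  have heig : ∀ (u : E) (l : ℂ), u ≠ 0 → τ u = algebraMap ℂ E l * u → l = 0 := by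
    intro u l hu hl
    obtain ⟨φ, hφ⟩ := exists_embedding htr
    have hrel : ∃ Q : Polynomial (Polynomial ℂ), Q ≠ 0 ∧ aevalAeval x y Q = 0 := by
      let _ : Algebra (Polynomial ℂ) E := ((algebraMap RatX E).comp
        (algebraMap (Polynomial ℂ) RatX)).toAlgebra
      have : IsScalarTower (Polynomial ℂ) RatX E := IsScalarTower.of_algebraMap_eq fun _ => rfl
      obtain ⟨Q, hQ, hQy⟩ := (IsFractionRing.isAlgebraic_iff (Polynomial ℂ) RatX E).2
        (Algebra.IsAlgebraic.isAlgebraic (R := RatX) y)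
      refine ⟨Q, hQ, ?_⟩
      rw [← hQy]
      have hcoe : algebraMap (Polynomial ℂ) E = (aeval (R := ℂ) x).toRingHom := by
        ext
        · change algebraMap RatX E (algebraMap ℂ RatX _) = _
          rw [← IsScalarTower.algebraMap_apply]
          simp
        · change algebraMap RatX E RatX.X = _
          simp [hxdef]
      rw [aeval_def, hcoe, aevalAeval_eq_eval₂]
    obtain ⟨Q, hQ, hQxy⟩ := hrel
    obtain ⟨Q', hQ', hQ'xy⟩ := exists_swapped_relation Q hQ hQxy htr
    have hfin : φ.toRingHom.Finite := by
      refine finite_of_relation φ hφ (fun S hxS hyS => ?_) hQ' hQ'xy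
      have hS : ∀ a, algebraMap RatX E a ∈ S.toSubfield := by
        have hp : ∀ p : Polynomial ℂ, algebraMap RatX E (algebraMap _ RatX p) ∈ S := by
          intro p
          have : algebraMap RatX E (algebraMap _ RatX p) = aeval x p := by
            induction p using Polynomial.induction_on' with
            | add p q hp hq => rw [map_add, map_add, hp, hq, map_add]
            | monomial n a =>
              rw [aeval_monomial, ← C_mul_X_pow_eq_monomial, map_mul, map_mul, map_pow, map_pow,
                IsScalarTower.algebraMap_apply ℂ RatX E]
              rfl
          rw [this]
          exact Subalgebra.aeval_coe S.toSubalgebra ⟨x, hxS⟩ p ▸ (aeval (⟨x, hxS⟩ : S.toSubalgebra) p).2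
        intro a
        obtain ⟨p, q, _, rfl⟩ := RatX.exists_eq_div a
        rw [map_div₀]
        exact div_mem (hp p) (hp q)
      have h1 : adjoin RatX {y} ≤ S.toSubfield.toIntermediateField hS :=
        adjoin_simple_le_iff.2 hyS
      rw [hgen] at h1
      exact eq_top_iff.2 fun z _ => h1 (Set.mem_univ z)
    exact eigenvalue_eq_zero_of_finite φ hfin τ (hφ ▸ hτy) hu hx0 (hφ ▸ h) hl
  refine induction_of_aeval_eq_zero τ.toLinearMap (fun v => ∃ c : ℂ, v = algebraMap ℂ E c)
    ⟨0, by simp⟩ ?_ hL hv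
  rintro v l ⟨c, hc⟩
  have hc' : τ v = algebraMap ℂ E l * v + algebraMap ℂ E c := by
    rw [← hc, ← Algebra.smul_def]
    simp
  by_cases hl : l = 0
  · subst hl
    rw [map_zero, zero_mul, zero_add] at hc'
    by_cases hc0 : c = 0
    · subst hc0
      exact (exists_rational_primitive τ hx (v := v) (r := 0) (by simp [hc'])).2 rfl
    · exfalso
      -- The combination v - c y has derivative -c τ(x) / x, so -c / x would have a rational
      -- primitive; its residue at 0 gives c = 0.
      obtain ⟨s, hs⟩ := (exists_rational_primitive τ hx (v := v - algebraMap ℂ E c * y)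
        (r := -algebraMap ℂ RatX c / RatX.X) (by
          rw [map_sub, τ.leibniz, τ.map_algebraMap, hc', map_div₀, map_neg,
            ← IsScalarTower.algebraMap_apply, ← hxdef]
          simp only [smul_eq_mul]
          field_simp
          field_simp at h
          linear_combination (-algebraMap ℂ E c) * h)).1
      have := RatX.residue_eq_zero_of_eq_deriv {0} (fun _ => -c) s (by simp [← hs])
        (Finset.mem_singleton_self 0)
      exact hc0 (neg_eq_zero.1 this)
  -- The element v + c / l satisfies the eigenvalue equation with l ≠ 0, and so it is zero.
  · refine ⟨-c / l, ?_⟩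
    by_contra hne
    have hl' : algebraMap ℂ E l ≠ 0 := by simpa using hl
    refine hl (heig (v - algebraMap ℂ E (-c / l)) l (sub_ne_zero.2 hne) ?_)
    rw [map_sub, τ.map_algebraMap, hc', map_div₀, map_neg]
    field_simp
    ring

end Classification

/-! ### The total derivation on ℂ(x)[y]. -/

section TotalDerivation

open Polynomial

/-- The derivation `∂ₓ + (1/x) ∂_y` of `ℂ(x)[y]`. -/
noncomputable def totalDeriv : Derivation ℂ (Polynomial RatX) (Polynomial RatX) :=
  coeffDerivation RatX.deriv +
    (C RatX.X⁻¹ : Polynomial RatX) • (derivative' (R := RatX)).restrictScalars ℂ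

/-- The derivation `∂_y` of `ℂ(x)[y]`. -/
noncomputable def partialDeriv : Derivation ℂ (Polynomial RatX) (Polynomial RatX) :=
  (derivative' (R := RatX)).restrictScalars ℂ

lemma totalDeriv_apply (p : Polynomial RatX) :
    totalDeriv p = coeffDerivation RatX.deriv p + C RatX.X⁻¹ * derivative p := rfl

lemma coeff_totalDeriv (p : Polynomial RatX) (n : ℕ) : (totalDeriv p).coeff n =
    RatX.deriv (p.coeff n) + RatX.X⁻¹ * (p.coeff (n + 1) * (n + 1)) := by
  rw [totalDeriv_apply, coeff_add, coeff_coeffDerivation, coeff_C_mul, coeff_derivative]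

lemma totalDeriv_C (a : RatX) : totalDeriv (C a) = C (RatX.deriv a) := by
  simp [totalDeriv_apply]

lemma totalDeriv_X : totalDeriv X = C RatX.X⁻¹ := by
  simp [totalDeriv_apply]

lemma totalDeriv_derivative (p : Polynomial RatX) :
    totalDeriv (derivative p) = derivative (totalDeriv p) := by
  simp [totalDeriv_apply, coeffDerivation_derivative]

lemma not_dvd_derivative {P : Polynomial RatX} (hP : Irreducible P) : ¬ P ∣ derivative P :=
  fun h => hP.natDegree_pos.ne' (derivative_eq_zero.1 (eq_zero_of_dvd_of_natDegree_lt h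
    (natDegree_derivative_lt hP.natDegree_pos.ne')))

/-- For monic P of degree n+1 the derivative has smaller degree, so divisibility would make it zero.
Its coefficient of y^n is p_n' + (n+1) / x, which is nonzero because 1/x has no rational primitive.
Analytically: ln x is not an algebraic function. -/
lemma not_dvd_totalDeriv {P : Polynomial RatX} (hP : Irreducible P) (hm : P.Monic) :
    ¬ P ∣ totalDeriv P := by
  intro h
  have hpos := hP.natDegree_pos
  obtain ⟨n, hn⟩ := Nat.exists_eq_succ_of_ne_zero hpos.ne'
  have h0 : totalDeriv P = 0 := by
    refine eq_zero_of_dvd_of_degree_lt h ?_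
    rw [degree_eq_natDegree hP.ne_zero, degree_lt_iff_coeff_zero]
    intro m hm'
    rw [coeff_totalDeriv, coeff_eq_zero_of_natDegree_lt (n := m + 1) (by omega)]
    rcases hm'.eq_or_lt with rfl | hm'
    · rw [hm.coeff_natDegree]; simp
    · rw [coeff_eq_zero_of_natDegree_lt hm']; simp
  have h1 := congrArg (fun q => coeff q n) h0
  have hlead : P.coeff (n + 1) = 1 := by
    have := hm.coeff_natDegree
    rwa [hn] at this
  simp only [coeff_totalDeriv, hlead, one_mul, coeff_zero] at h1
  have := RatX.residue_eq_zero_of_eq_deriv {0} (fun _ => -(n + 1 : ℂ)) (P.coeff n) (by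
    simp only [Finset.sum_singleton, map_neg, map_add, map_natCast, map_one, map_zero, sub_zero]
    rw [div_eq_mul_inv]
    linear_combination h1) (Finset.mem_singleton_self 0)
  rw [neg_eq_zero] at this
  exact Nat.cast_add_one_ne_zero n this

end TotalDerivation

/-! ### The induced derivation on the residue field ℂ(x)[y]/(P). -/

section ResidueField

open Polynomial

variable {P : Polynomial RatX}

/-- The derivation `∂_y P' - P_y D` of `ℂ(x)[y]`, which maps `P` to zero. -/
noncomputable def tangentDeriv (P : Polynomial RatX) :
    Derivation ℂ (Polynomial RatX) (Polynomial RatX) :=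
  totalDeriv P • partialDeriv - derivative P • totalDeriv

lemma tangentDeriv_apply (P q : Polynomial RatX) :
    tangentDeriv P q = totalDeriv P * derivative q - derivative P * totalDeriv q := rfl

variable [hP : Fact (Irreducible P)]

/-- The derivation of the residue field `ℂ(x)[y]/(P)` induced by `tangentDeriv P`, normalised. -/
noncomputable def residueDeriv (P : Polynomial RatX) [Fact (Irreducible P)] :
    Derivation ℂ (AdjoinRoot P) (AdjoinRoot P) :=
  (AdjoinRoot.mk P (totalDeriv P))⁻¹ •
    Derivation.liftOfSurjective (f := (AdjoinRoot.mkₐ P).restrictScalars ℂ)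
      (d := tangentDeriv P) AdjoinRoot.mk_surjective (by
        intro q hq
        obtain ⟨r, rfl⟩ := AdjoinRoot.mk_eq_zero.1 hq
        refine AdjoinRoot.mk_eq_zero.2 ?_
        have : tangentDeriv P P = 0 := by
          rw [tangentDeriv_apply]; ring
        rw [Derivation.leibniz, this, smul_zero, add_zero]
        exact Dvd.intro _ rfl)

lemma residueDeriv_mk (q : Polynomial RatX) :
    residueDeriv P (AdjoinRoot.mk P q) = (AdjoinRoot.mk P (totalDeriv P))⁻¹ *
      AdjoinRoot.mk P (tangentDeriv P q) := by
  rw [residueDeriv, Derivation.smul_apply, smul_eq_mul]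
  exact congrArg _ (Derivation.liftOfSurjective_apply
    (f := (AdjoinRoot.mkₐ P).restrictScalars ℂ) _ _ q)

lemma mk_totalDeriv_ne_zero (hm : P.Monic) : AdjoinRoot.mk P (totalDeriv P) ≠ 0 := by
  rw [Ne, AdjoinRoot.mk_eq_zero]
  exact not_dvd_totalDeriv hP.out hm

lemma residueDeriv_X : residueDeriv P (algebraMap RatX (AdjoinRoot P) RatX.X) =
    -((AdjoinRoot.mk P (totalDeriv P))⁻¹ * AdjoinRoot.mk P (derivative P)) := by
  have : algebraMap RatX (AdjoinRoot P) RatX.X = AdjoinRoot.mk P (C RatX.X) := rfl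
  rw [this, residueDeriv_mk, tangentDeriv_apply, totalDeriv_C]
  simp

/-- The division by D P in `residueDeriv` is chosen for this normalisation. With h = y - ln x the
identity reads τ h = 1: on the curve P = 0 the derivation τ is differentiation with respect to h. -/
lemma residueDeriv_root (hm : P.Monic) :
    residueDeriv P (AdjoinRoot.root P) - residueDeriv P (algebraMap RatX (AdjoinRoot P) RatX.X) /
      algebraMap RatX (AdjoinRoot P) RatX.X = 1 := by
  have h0 := mk_totalDeriv_ne_zero (P := P) hm
  have e : AdjoinRoot.root P = AdjoinRoot.mk P X := rfl
  have e' : AdjoinRoot.mk P (C RatX.X⁻¹) = (algebraMap RatX (AdjoinRoot P) RatX.X)⁻¹ := by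
    rw [← map_inv₀]; rfl
  have hx : algebraMap RatX (AdjoinRoot P) RatX.X ≠ 0 := by simpa using RatX.X_ne_zero
  rw [residueDeriv_X, e, residueDeriv_mk, tangentDeriv_apply, totalDeriv_X]
  simp only [derivative_X, mul_one, map_sub, map_mul, e']
  field_simp
  ring

lemma residueDeriv_X_ne_zero (hm : P.Monic) :
    residueDeriv P (algebraMap RatX (AdjoinRoot P) RatX.X) ≠ 0 := by
  rw [residueDeriv_X, neg_ne_zero]
  refine mul_ne_zero (inv_ne_zero (mk_totalDeriv_ne_zero hm)) ?_
  rw [Ne, AdjoinRoot.mk_eq_zero]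
  exact not_dvd_derivative hP.out

/-- Solutions of linear differential equations with constant coefficients in the residue field
are constant, or the residue field belongs to a line `y = c` and the solutions are Laurent
polynomials in `x`. -/
lemma residue_classification (hm : P.Monic) {L : Polynomial ℂ} (hL : L ≠ 0) {v : AdjoinRoot P}
    (hv : aeval (R := ℂ) (A := Module.End ℂ (AdjoinRoot P)) (residueDeriv P).toLinearMap L v = 0) :
    (∃ c : ℂ, v = AdjoinRoot.mk P (C (algebraMap ℂ RatX c))) ∨
    ∃ (c : ℂ) (q : Polynomial ℂ) (n : ℕ), P = X - C (algebraMap ℂ RatX c) ∧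
      v = AdjoinRoot.mk P (C (algebraMap _ RatX q / RatX.X ^ n)) := by
  have hfin : FiniteDimensional RatX (AdjoinRoot P) := (AdjoinRoot.powerBasis hP.out.ne_zero).finite
  by_cases hc : ∃ c : ℂ, AdjoinRoot.root P = algebraMap ℂ (AdjoinRoot P) c
  · right
    obtain ⟨c, hc⟩ := hc
    have hPc : P = X - C (algebraMap ℂ RatX c) := by
      have hdvd : P ∣ X - C (algebraMap ℂ RatX c) := by
        rw [← AdjoinRoot.mk_eq_zero, map_sub, sub_eq_zero]
        exact hc
      exact eq_of_monic_of_associated hm (monic_X_sub_C _)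
        (hP.out.associated_of_dvd (irreducible_X_sub_C _) hdvd)
    have hsurj : ∀ w : AdjoinRoot P, ∃ a, w = algebraMap RatX (AdjoinRoot P) a := by
      intro w
      obtain ⟨q, rfl⟩ := AdjoinRoot.mk_surjective w
      refine ⟨q.eval (algebraMap ℂ RatX c), ?_⟩
      have : AdjoinRoot.mk P q = AdjoinRoot.mk P (C (q.eval (algebraMap ℂ RatX c))) := by
        rw [AdjoinRoot.mk_eq_mk]
        nth_rw 1 [hPc]
        exact X_sub_C_dvd_sub_C_eval
      exact this
    -- On the line y = c the residue field is ℂ(x) and τ is -x d/dx, for which every power of x is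
    -- an eigenvector.
    have hτ : ∀ a, residueDeriv P (algebraMap RatX (AdjoinRoot P) a) =
        algebraMap RatX (AdjoinRoot P) (-RatX.X * RatX.deriv a) := by
      intro a
      have e1 : totalDeriv P = C RatX.X⁻¹ := by
        rw [hPc, map_sub, totalDeriv_X, totalDeriv_C, Derivation.map_algebraMap]
        simp
      have e2 : derivative P = 1 := by rw [hPc]; simp
      refine (RatX.derivation_eq (E := AdjoinRoot P) (residueDeriv P) a).trans ?_
      rw [residueDeriv_X, e1, e2, map_one, mul_one]
      have e3 : AdjoinRoot.mk P (C RatX.X⁻¹) = algebraMap RatX (AdjoinRoot P) RatX.X⁻¹ := rfl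
      rw [e3, ← map_inv₀, inv_inv, ← map_neg, ← map_mul, mul_comm]
    obtain ⟨a, ha, hreg⟩ := induction_of_aeval_eq_zero (residueDeriv P).toLinearMap
      (fun w => ∃ a, w = algebraMap RatX (AdjoinRoot P) a ∧
        ∀ (Q : Polynomial ℂ) (hQ : Prime Q), ¬ Q ∣ X → a ∈ regularAlong RatX hQ)
      ⟨0, by simp, fun _ _ _ => zero_mem _⟩ (by
        rintro w l ⟨b, hb, hreg⟩
        obtain ⟨a, rfl⟩ := hsurj w
        refine ⟨a, rfl, fun Q hQ hQX => ?_⟩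
        have hb' : -RatX.X * RatX.deriv a - algebraMap ℂ RatX l * a = b := by
          apply (algebraMap RatX (AdjoinRoot P)).injective
          rw [← hb, map_sub, ← hτ, map_mul, ← IsScalarTower.algebraMap_apply, ← Algebra.smul_def]
          rfl
        have hinv : RatX.X⁻¹ ∈ regularAlong RatX hQ := inv_mem_regularAlong hQ hQX
        -- The equation -x a' - l a = b becomes a' + (l/x) a = -b/x with regular coefficients at Q,
        -- so a cannot acquire a pole except at x = 0.
        refine RatX.mem_regularAlong_of_simple_pole hQ (c := algebraMap ℂ RatX l * RatX.X⁻¹)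
          (mul_mem (constant_mem_regularAlong hQ l) hinv) ?_
        refine mul_mem (algebraMap_mem_regularAlong hQ Q) ?_
        convert neg_mem (mul_mem hinv (hreg Q hQ hQX)) using 1
        rw [← hb']
        have := RatX.X_ne_zero
        field_simp
        ring) hL hv
    obtain ⟨n, hn⟩ := exists_pow_mul_mem_regularAlong (K := RatX)
      (prime_X : Prime (X : Polynomial ℂ)) a
    obtain ⟨q, hq⟩ := RatX.exists_polynomial_of_forall_regular (g := RatX.X ^ n * a) (by
      intro Q hQ
      by_cases hQX : Q ∣ X
      · obtain ⟨u, hu⟩ := hQ.associated_of_dvd prime_X hQX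
        obtain ⟨a', b', hb', e⟩ := hn
        exact ⟨a', b', fun h => hb' (hu ▸ (Units.mul_right_dvd.2 h)), e⟩
      · exact mul_mem (pow_mem (algebraMap_mem_regularAlong hQ _) n) (hreg Q hQ hQX))
    refine ⟨c, q, n, hPc, ?_⟩
    rw [ha, ← hq, mul_div_cancel_left₀ _ (pow_ne_zero n RatX.X_ne_zero)]
    rfl
  · left
    push Not at hc
    have hgen : IntermediateField.adjoin RatX {AdjoinRoot.root P} = ⊤ := by
      rw [eq_top_iff]
      intro z _
      have h := AdjoinRoot.adjoinRoot_eq_top (f := P)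
      have hz : z ∈ Algebra.adjoin RatX {AdjoinRoot.root P} := by rw [h]; trivial
      exact IntermediateField.algebra_adjoin_le_adjoin _ _ hz
    obtain ⟨c, hcv⟩ := exists_const_of_aeval_derivation_eq_zero (residueDeriv P) hgen
      (residueDeriv_X_ne_zero hm) (residueDeriv_root hm) hc hL hv
    refine ⟨c, ?_⟩
    rw [hcv, IsScalarTower.algebraMap_apply ℂ RatX (AdjoinRoot P)]
    rfl

end ResidueField

/-! ### Residues of a telescoping equation. -/

section Residue

open Polynomial

variable {K : Type*} [Field K] [Algebra (Polynomial RatX) K] [IsFractionRing (Polynomial RatX) K]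
  [Algebra ℂ K] [IsScalarTower ℂ (Polynomial RatX) K]

/-- `g` agrees with `s D(P)/P` up to derivatives and elements regular along `P`. -/
def HasResidue (D : Derivation ℂ K K) (P : Polynomial RatX) (hP : Prime P) (g : K)
    (v : AdjoinRoot P) : Prop :=
  ∃ (G m : K) (s : Polynomial RatX), m ∈ regularAlong K hP ∧ AdjoinRoot.mk P s = v ∧
    g = D G + algebraMap _ K (s * totalDeriv P) / algebraMap _ K P + m

/-- `D` and `dy` extend the derivations `∂ₓ + (1/x) ∂_y` and `∂_y` of `ℂ(x)[y]`. -/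
structure ExtendsTotalDeriv (D dy : Derivation ℂ K K) : Prop where
  total : ∀ q, D (algebraMap (Polynomial RatX) K q) = algebraMap _ K (totalDeriv q)
  partialY : ∀ q, dy (algebraMap (Polynomial RatX) K q) = algebraMap _ K (derivative q)
  comm : ∀ g, dy (D g) = D (dy g)

variable {D dy : Derivation ℂ K K} {P : Polynomial RatX} (hP : Prime P)

lemma totalDeriv_regular (h : ExtendsTotalDeriv D dy) (q : Polynomial RatX) : D (algebraMap _ K q) ∈ regularAlong K hP := by
  rw [h.total]; exact algebraMap_mem_regularAlong hP _

lemma partialDeriv_regular (h : ExtendsTotalDeriv D dy) (q : Polynomial RatX) : dy (algebraMap _ K q) ∈ regularAlong K hP := by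
  rw [h.partialY]; exact algebraMap_mem_regularAlong hP _

lemma HasResidue.add {g h : K} {v w : AdjoinRoot P} (hg : HasResidue D P hP g v)
    (hh : HasResidue D P hP h w) : HasResidue D P hP (g + h) (v + w) := by
  obtain ⟨G, m, s, hm, rfl, rfl⟩ := hg
  obtain ⟨G', m', s', hm', rfl, rfl⟩ := hh
  refine ⟨G + G', m + m', s + s', add_mem hm hm', map_add _ _ _, ?_⟩
  rw [map_add, add_mul, map_add, add_div]
  ring

lemma HasResidue.smul {g : K} {v : AdjoinRoot P} (hg : HasResidue D P hP g v) (c : ℂ) :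
    HasResidue D P hP (c • g) (c • v) := by
  obtain ⟨G, m, s, hm, rfl, rfl⟩ := hg
  have e : ∀ p : Polynomial RatX, algebraMap (Polynomial RatX) K (c • p) =
      c • algebraMap (Polynomial RatX) K p := by
    intro p
    rw [Algebra.smul_def, map_mul, ← IsScalarTower.algebraMap_apply, ← Algebra.smul_def]
  refine ⟨c • G, c • m, c • s, ?_, ?_, ?_⟩
  · rw [Algebra.smul_def]
    exact mul_mem (constant_mem_regularAlong hP c) hm
  · exact map_smul ((AdjoinRoot.mkₐ P).restrictScalars ℂ) c s
  · rw [smul_mul_assoc, e, smul_add, smul_add, D.map_smul, smul_div_assoc]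

/-- The identity behind this is ∂_y(s D(P) / P) = D(s P_y / P) + t / P with t = D(P) s_y - P_y D(s),
and modulo P the element t is D(P) times the derivation of the residue field applied to s. -/
lemma HasResidue.deriv (h : ExtendsTotalDeriv D dy) (hm : P.Monic) {g : K} {v : AdjoinRoot P} [Fact (Irreducible P)]
    (hg : HasResidue D P hP g v) : HasResidue D P hP (dy g) (residueDeriv P v) := by
  obtain ⟨G, m, s, hm', rfl, rfl⟩ := hg
  have hP0 : algebraMap _ K P ≠ 0 := by
    rw [Ne, IsFractionRing.to_map_eq_zero_iff]; exact hP.ne_zero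
  obtain ⟨t, ht⟩ := AdjoinRoot.mk_surjective (residueDeriv P (AdjoinRoot.mk P s))
  have hdvd : P ∣ tangentDeriv P s - t * totalDeriv P := by
    rw [← AdjoinRoot.mk_eq_zero, map_sub, map_mul, ht, residueDeriv_mk, mul_comm (_⁻¹),
      inv_mul_cancel_right₀ (mk_totalDeriv_ne_zero hm), sub_self]
  obtain ⟨r, hr⟩ := hdvd
  have hr' : tangentDeriv P s = t * totalDeriv P + P * r := by linear_combination hr
  refine ⟨dy G + algebraMap _ K (s * derivative P) / algebraMap _ K P,
    algebraMap _ K r + dy m, t, ?_, ht, ?_⟩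
  · exact add_mem (algebraMap_mem_regularAlong hP r)
      (derivation_mem_regularAlong hP dy (partialDeriv_regular hP h) hm')
  · have e1 : dy (algebraMap _ K (s * totalDeriv P) / algebraMap _ K P) =
        D (algebraMap _ K (s * derivative P) / algebraMap _ K P) +
        algebraMap _ K (tangentDeriv P s) / algebraMap _ K P := by
      rw [Derivation.leibniz_div, Derivation.leibniz_div, h.partialY, h.partialY, h.total, h.total, tangentDeriv_apply]
      simp only [Derivation.leibniz, derivative_mul, smul_eq_mul, map_mul, map_add, map_sub,
        totalDeriv_derivative]
      field_simp
      ring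
    rw [map_add, map_add, h.comm, e1, hr', map_add, map_mul _ P r, add_div, map_add,
      mul_div_cancel_left₀ _ hP0]
    ring

lemma HasResidue.aeval (h : ExtendsTotalDeriv D dy) (hm : P.Monic) {g : K} {v : AdjoinRoot P} [Fact (Irreducible P)]
    (hg : HasResidue D P hP g v) (L : Polynomial ℂ) :
    HasResidue D P hP (aeval (R := ℂ) (A := Module.End ℂ K) dy.toLinearMap L g)
      (aeval (R := ℂ) (A := Module.End ℂ (AdjoinRoot P)) (residueDeriv P).toLinearMap L v) := by
  have hpow : ∀ n : ℕ, HasResidue D P hP (((dy.toLinearMap : Module.End ℂ K) ^ n) g)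
      (((residueDeriv P).toLinearMap ^ n : Module.End ℂ (AdjoinRoot P)) v) := by
    intro n
    induction n with
    | zero => simpa using hg
    | succ n ih =>
      rw [pow_succ', pow_succ', Module.End.mul_apply, Module.End.mul_apply]
      exact ih.deriv hP h hm
  induction L using Polynomial.induction_on' with
  | add p q hp hq =>
    rw [map_add, map_add]
    exact hp.add hP hq
  | monomial n a =>
    rw [aeval_monomial, aeval_monomial]
    exact (hpow n).smul hP a

/-- Since D(R - G) has at most a simple pole along P, R - G is regular there. Hence P divides s
D(P), and so it divides s. -/
lemma HasResidue.eq_zero_of_derivative (hD : ExtendsTotalDeriv D dy) (hm : P.Monic) [Fact (Irreducible P)] {R : K}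
    {v : AdjoinRoot P} (h : HasResidue D P hP (D R) v) : v = 0 := by
  obtain ⟨G, m, s, hm', rfl, e⟩ := h
  have hP0 : algebraMap _ K P ≠ 0 := by
    rw [Ne, IsFractionRing.to_map_eq_zero_iff]; exact hP.ne_zero
  have hnd := not_dvd_totalDeriv hP.irreducible hm
  have e' : D (R - G) = algebraMap _ K (s * totalDeriv P) / algebraMap _ K P + m := by
    rw [map_sub, e]; ring
  have hreg : R - G ∈ regularAlong K hP := by
    refine mem_regularAlong_of_simple_pole hP D (totalDeriv_regular hP hD) (hD.total P) hnd
      (zero_mem _) ?_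
    rw [zero_mul, add_zero, e', mul_add, mul_div_cancel₀ _ hP0]
    exact add_mem (algebraMap_mem_regularAlong hP _)
      (mul_mem (algebraMap_mem_regularAlong hP _) hm')
  have := sub_mem (derivation_mem_regularAlong hP D (totalDeriv_regular hP hD) hreg) hm'
  rw [e', add_sub_cancel_right] at this
  rw [AdjoinRoot.mk_eq_zero]
  exact (hP.dvd_or_dvd (dvd_of_div_mem_regularAlong hP this)).resolve_right hnd

/-- The possible simple poles of an element that satisfies a telescoping equation. -/
lemma simple_pole_of_telescoper (h : ExtendsTotalDeriv D dy) (hm : P.Monic) {L : Polynomial ℂ} (hL : L ≠ 0) {f R G m : K}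
    (hf : aeval (R := ℂ) (A := Module.End ℂ K) dy.toLinearMap L f = D R) {c : Polynomial RatX}
    (hm' : m ∈ regularAlong K hP) (e : f = D G + algebraMap _ K c / algebraMap _ K P + m) :
    (∃ (μ : ℂ) (r : Polynomial RatX), c = C (algebraMap ℂ RatX μ) * totalDeriv P + P * r) ∨
    ∃ (c₀ : ℂ) (q : Polynomial ℂ) (n : ℕ) (r : Polynomial RatX),
      P = X - C (algebraMap ℂ RatX c₀) ∧
      c = C (algebraMap _ RatX q / RatX.X ^ n) * totalDeriv P + P * r := by
  have : Fact (Irreducible P) := ⟨hP.irreducible⟩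
  have h0 := mk_totalDeriv_ne_zero (P := P) hm
  have hP0 : algebraMap _ K P ≠ 0 := by
    rw [Ne, IsFractionRing.to_map_eq_zero_iff]; exact hP.ne_zero
  -- The class of D P is invertible in the residue field, so c agrees modulo P with a multiple s
  -- D(P); the class of s is the residue to be classified.
  obtain ⟨s, hs⟩ := AdjoinRoot.mk_surjective (AdjoinRoot.mk P c / AdjoinRoot.mk P (totalDeriv P))
  have hdvd : P ∣ c - s * totalDeriv P := by
    rw [← AdjoinRoot.mk_eq_zero, map_sub, map_mul, hs, div_mul_cancel₀ _ h0, sub_self]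
  obtain ⟨r, hr⟩ := hdvd
  have hr' : c = s * totalDeriv P + P * r := by linear_combination hr
  have hres : HasResidue D P hP f (AdjoinRoot.mk P s) := by
    refine ⟨G, algebraMap _ K r + m, s, add_mem (algebraMap_mem_regularAlong hP r) hm', rfl, ?_⟩
    rw [e, hr', map_add, map_mul _ P r, add_div, mul_div_cancel_left₀ _ hP0]
    ring
  have hzero := (hf ▸ hres.aeval hP h hm L).eq_zero_of_derivative hP h hm
  rcases residue_classification hm hL hzero with ⟨μ, hμ⟩ | ⟨c₀, q, n, hPc, hq⟩
  · rw [AdjoinRoot.mk_eq_mk] at hμ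
    obtain ⟨t, ht⟩ := hμ
    exact Or.inl ⟨μ, t * totalDeriv P + r, by
      rw [hr']; linear_combination totalDeriv P * ht⟩
  · rw [AdjoinRoot.mk_eq_mk] at hq
    obtain ⟨t, ht⟩ := hq
    exact Or.inr ⟨c₀, q, n, t * totalDeriv P + r, hPc, by
      rw [hr']; linear_combination totalDeriv P * ht⟩

end Residue

/-! ### The field ℂ(x,y), its derivations and its subring ℂ(x)[y]. -/

namespace RatXY

open Polynomial

lemma const_eq (c : ℂ) : const c = algebraMap ℂ RatXY c := rfl

lemma algebraMap_ne_zero {p : Polynomial (Polynomial ℂ)} (hp : p ≠ 0) :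
    algebraMap (Polynomial (Polynomial ℂ)) RatXY p ≠ 0 := by
  rwa [Ne, IsFractionRing.to_map_eq_zero_iff]

lemma polyX_ne_zero : polyX ≠ 0 := by
  simp [polyX]

lemma x_ne_zero : x ≠ 0 := algebraMap_ne_zero polyX_ne_zero

/-- The derivation `∂/∂x` of `ℂ(x,y)`. -/
noncomputable def dX : Derivation ℂ RatXY RatXY :=
  Derivation.toFractionField ((Algebra.linearMap (Polynomial (Polynomial ℂ)) RatXY).compDer
    (coeffDerivation Polynomial.derivative'))

/-- The derivation `∂/∂y` of `ℂ(x,y)`. -/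
noncomputable def dY : Derivation ℂ RatXY RatXY :=
  Derivation.toFractionField ((Algebra.linearMap (Polynomial (Polynomial ℂ)) RatXY).compDer
    ((derivative' (R := Polynomial ℂ)).restrictScalars ℂ))

/-- The derivation of `ℂ(x,y)` with `x ↦ 1` and `y ↦ 1/x`. -/
noncomputable def D : Derivation ℂ RatXY RatXY := dX + x⁻¹ • dY

lemma dX_algebraMap (p : Polynomial (Polynomial ℂ)) : dX (algebraMap _ RatXY p) =
    algebraMap _ RatXY (coeffDerivation (Polynomial.derivative' (R := ℂ)) p) := by
  rw [dX, Derivation.toFractionField_algebraMap]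
  rfl

lemma dY_algebraMap (p : Polynomial (Polynomial ℂ)) : dY (algebraMap _ RatXY p) =
    algebraMap _ RatXY (derivative p) := by
  rw [dY, Derivation.toFractionField_algebraMap]
  rfl

lemma D_apply (g : RatXY) : D g = dX g + x⁻¹ * dY g := rfl

@[simp] lemma dX_x : dX x = 1 := by
  rw [x, dX_algebraMap, polyX, coeffDerivation_C]
  simp

@[simp] lemma dX_y : dX y = 0 := by
  rw [y, dX_algebraMap, coeffDerivation_X, map_zero]

@[simp] lemma dY_x : dY x = 0 := by
  rw [x, dY_algebraMap, polyX, derivative_C, map_zero]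

@[simp] lemma dY_y : dY y = 1 := by
  rw [y, dY_algebraMap, derivative_X, map_one]

@[simp] lemma D_x : D x = 1 := by simp [D_apply]

@[simp] lemma D_y : D y = x⁻¹ := by simp [D_apply]

@[simp] lemma D_const (c : ℂ) : D (const c) = 0 := D.map_algebraMap c

/-- The inclusion `ℂ(x) ⊆ ℂ(x,y)`. -/
noncomputable def ofRatX : RatX →+* RatXY :=
  IsFractionRing.lift (A := Polynomial ℂ) (K := RatX)
    (g := (algebraMap (Polynomial (Polynomial ℂ)) RatXY).comp C)
    ((IsFractionRing.injective (Polynomial (Polynomial ℂ)) RatXY).comp C_injective)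

lemma ofRatX_algebraMap (p : Polynomial ℂ) :
    ofRatX (algebraMap _ RatX p) = algebraMap _ RatXY (C p) := by
  rw [ofRatX, IsFractionRing.lift_algebraMap]
  rfl

@[simp] lemma ofRatX_X : ofRatX RatX.X = x := ofRatX_algebraMap _

@[simp] lemma ofRatX_const (c : ℂ) : ofRatX (algebraMap ℂ RatX c) = const c := ofRatX_algebraMap _

/-- The inclusion `ℂ(x)[y] ⊆ ℂ(x,y)`. -/
noncomputable instance : Algebra (Polynomial RatX) RatXY := (eval₂RingHom ofRatX y).toAlgebra

lemma algebraMap_eval₂ (p : Polynomial RatX) :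
    algebraMap (Polynomial RatX) RatXY p = eval₂ ofRatX y p := rfl

@[simp] lemma algebraMap_C (a : RatX) : algebraMap (Polynomial RatX) RatXY (C a) = ofRatX a := by
  rw [algebraMap_eval₂, eval₂_C]

@[simp] lemma algebraMap_X : algebraMap (Polynomial RatX) RatXY X = y := by
  rw [algebraMap_eval₂, eval₂_X]

instance : IsScalarTower ℂ (Polynomial RatX) RatXY := IsScalarTower.of_algebraMap_eq fun c => by
  rw [IsScalarTower.algebraMap_apply ℂ RatX (Polynomial RatX), Polynomial.algebraMap_eq,
    algebraMap_C, ofRatX_const, const_eq]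

lemma algebraMap_map (p : Polynomial (Polynomial ℂ)) :
    algebraMap (Polynomial RatX) RatXY (p.map (algebraMap _ RatX)) = algebraMap _ RatXY p := by
  induction p using Polynomial.induction_on' with
  | add p q hp hq => rw [Polynomial.map_add, map_add, hp, hq, map_add]
  | monomial n a =>
    rw [← C_mul_X_pow_eq_monomial, Polynomial.map_mul, Polynomial.map_pow, map_C, map_X, map_mul,
      map_mul, map_pow, map_pow, algebraMap_C, ofRatX_algebraMap, algebraMap_X]
    rfl

-- Inverting the nonzero polynomials in x turns ℂ[x][y] into ℂ(x)[y], and a localization inside the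
-- fraction field has the same fraction field.
attribute [local instance] Polynomial.algebra in
instance : IsFractionRing (Polynomial RatX) RatXY := by
  have h1 := Polynomial.isLocalization (nonZeroDivisors (Polynomial ℂ)) RatX
  have h2 : IsScalarTower (Polynomial (Polynomial ℂ)) (Polynomial RatX) RatXY :=
    IsScalarTower.of_algebraMap_eq fun p => (algebraMap_map p).symm
  exact IsFractionRing.isFractionRing_of_isDomain_of_isLocalization
    ((nonZeroDivisors (Polynomial ℂ)).map C) (Polynomial RatX) RatXY

lemma D_ofRatX (a : RatX) : D (ofRatX a) = ofRatX (RatX.deriv a) := by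
  refine eq_of_leibniz_of_fractionRing (R := Polynomial ℂ) ofRatX
    (fun a => D (ofRatX a)) (fun a => ofRatX (RatX.deriv a)) ?_ ?_ ?_ a
  · intro a b; simp
  · intro a b; simp
  · intro p
    simp only [RatX.deriv_algebraMap, ofRatX_algebraMap, D_apply, dX_algebraMap, dY_algebraMap,
      coeffDerivation_C, derivative_C, map_zero, mul_zero, add_zero]
    rfl

lemma dY_ofRatX (a : RatX) : dY (ofRatX a) = 0 := by
  refine eq_of_leibniz_of_fractionRing (R := Polynomial ℂ) ofRatX
    (fun a => dY (ofRatX a)) (fun a => 0) ?_ ?_ ?_ a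
  · intro a b; simp
  · intro a b; simp
  · intro p
    simp only [ofRatX_algebraMap, dY_algebraMap, derivative_C, map_zero]

/-- The commutator obeys the product rule, so polynomials suffice; there it vanishes because 1/x
does not depend on y. -/
lemma dY_D (g : RatXY) : dY (D g) = D (dY g) := by
  refine eq_of_leibniz_of_fractionRing (R := Polynomial (Polynomial ℂ)) (RingHom.id RatXY)
    (fun g => dY (D g) - D (dY g)) (fun _ => 0) ?_ ?_ ?_ g |> sub_eq_zero.1
  · intro a b
    simp only [Derivation.leibniz, smul_eq_mul, map_add, RingHom.id_apply]
    ring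
  · intro a b; simp
  · intro p
    have hx : dY x⁻¹ = 0 := by rw [Derivation.leibniz_inv, dY_x, smul_zero]
    simp only [D_apply, dX_algebraMap, dY_algebraMap, map_add, Derivation.leibniz, smul_eq_mul,
      hx, mul_zero, add_zero, coeffDerivation_derivative]
    ring

lemma extendsTotalDeriv : ExtendsTotalDeriv D dY where
  total q := by
    induction q using Polynomial.induction_on' with
    | add p q hp hq => simp only [map_add, hp, hq]
    | monomial n a =>
      rw [← C_mul_X_pow_eq_monomial]
      simp only [map_mul, map_pow, algebraMap_C, algebraMap_X, Derivation.leibniz,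
        Derivation.leibniz_pow, D_y, D_ofRatX, totalDeriv_C, totalDeriv_X, map_add, smul_eq_mul,
        nsmul_eq_mul, map_natCast, map_inv₀, ofRatX_X]
  partialY q := by
    induction q using Polynomial.induction_on' with
    | add p q hp hq => simp only [map_add, hp, hq]
    | monomial n a =>
      rw [← C_mul_X_pow_eq_monomial, derivative_C_mul_X_pow]
      simp only [map_mul, map_pow, algebraMap_C, algebraMap_X, Derivation.leibniz,
        Derivation.leibniz_pow, dY_y, dY_ofRatX, smul_eq_mul, nsmul_eq_mul, map_natCast, mul_zero,
        mul_one, add_zero]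
      ring
  comm := dY_D

/-! ### Formal integrals. -/

/-- The derivative of `Ei(p ln x + μ)`. -/
noncomputable def eiTerm (p : ℤ) (μ : ℂ) : RatXY :=
  p * const (exp μ) * x ^ (p - 1) / (p * y + const μ)

/-- The product of `y ^ r` and the derivative of `Li_1(μ x)`. -/
noncomputable def liTerm (r : ℕ) (μ : ℂ) : RatXY := y ^ r * (const μ / (1 - const μ * x))

end RatXY

namespace LogExpr

open RatXY

/-- The expression is an integral of `f` by the rules of differential algebra, where the
polylogarithms cancel in the derivative. -/
def Formal (E : LogExpr) (f : RatXY) : Prop :=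
  f = D E.H + ∑ μ ∈ E.S, const μ * (D (E.K μ) / E.K μ) +
      (E.a.sum fun i c => const c * eiTerm i.1 i.2) +
      (E.b.sum fun i c => if i.1 = 1 then const c * liTerm i.2.1 i.2.2 else 0) ∧
    ∀ (p r : ℕ) (μ : ℂ), 1 ≤ p → (r + 1) * E.b (p, r + 1, μ) + E.b (p + 1, r, μ) = 0

end LogExpr

namespace RatXY

/-- `f` has a formal integral. -/
def FormallyIntegrable (f : RatXY) : Prop := ∃ E : LogExpr, E.Formal f

/-- Each coefficient μ carries only one logarithm, so arguments with the same μ are multiplied;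
where one sum has no term for μ, the argument 1 is used. -/
lemma FormallyIntegrable.add {f g : RatXY} (hf : FormallyIntegrable f)
    (hg : FormallyIntegrable g) : FormallyIntegrable (f + g) := by
  classical
  obtain ⟨E, hE, hEb⟩ := hf
  obtain ⟨F, hF, hFb⟩ := hg
  have hK : ∀ (A : LogExpr) μ, (if μ ∈ A.S then A.K μ else 1) ≠ 0 := by
    intro A μ
    split_ifs with h
    exacts [A.K_ne_zero μ h, one_ne_zero]
  have hlog : ∀ (A : LogExpr) (T : Finset ℂ), A.S ⊆ T →
      ∑ μ ∈ A.S, const μ * (D (A.K μ) / A.K μ) = ∑ μ ∈ T, const μ *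
        (D (if μ ∈ A.S then A.K μ else 1) / (if μ ∈ A.S then A.K μ else 1)) := by
    intro A T hT
    rw [← Finset.sum_subset hT]
    · exact Finset.sum_congr rfl fun μ hμ => by simp [hμ]
    · intro μ _ hμ
      simp [hμ]
  refine ⟨⟨E.a + F.a, E.b + F.b, E.S ∪ F.S,
    fun μ => (if μ ∈ E.S then E.K μ else 1) * (if μ ∈ F.S then F.K μ else 1), E.H + F.H,
    fun i hi => ?_, fun i hi => ?_, fun μ _ => mul_ne_zero (hK E μ) (hK F μ)⟩, ?_, ?_⟩
  · rcases Finset.mem_union.1 (Finsupp.support_add hi) with h | h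
    exacts [E.a_index i h, F.a_index i h]
  · rcases Finset.mem_union.1 (Finsupp.support_add hi) with h | h
    exacts [E.b_index i h, F.b_index i h]
  · have hadd : ∀ c d : ℂ, const (c + d) = const c + const d := fun c d => by
      simp only [const_eq, map_add]
    have h0 : const 0 = 0 := by simp only [const_eq, map_zero]
    dsimp only
    rw [Finsupp.sum_add_index' (by simp [h0]) (by intros; rw [hadd, add_mul]),
      Finsupp.sum_add_index' (by simp [h0]) (by
        intro i c d; split_ifs <;> simp [hadd, add_mul]), map_add, hE, hF,
      hlog E (E.S ∪ F.S) Finset.subset_union_left, hlog F (E.S ∪ F.S) Finset.subset_union_right]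
    have : ∀ μ, const μ * (D ((if μ ∈ E.S then E.K μ else 1) * (if μ ∈ F.S then F.K μ else 1)) /
        ((if μ ∈ E.S then E.K μ else 1) * (if μ ∈ F.S then F.K μ else 1))) =
        const μ * (D (if μ ∈ E.S then E.K μ else 1) / (if μ ∈ E.S then E.K μ else 1)) +
        const μ * (D (if μ ∈ F.S then F.K μ else 1) / (if μ ∈ F.S then F.K μ else 1)) := by
      intro μ
      have h1 := hK E μ
      have h2 := hK F μ
      rw [Derivation.leibniz, smul_eq_mul, smul_eq_mul]
      field_simp
      ring
    simp_rw [this]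
    rw [Finset.sum_add_distrib]
    ring
  · intro p r μ hp
    have h1 := hEb p r μ hp
    have h2 := hFb p r μ hp
    simp only [Finsupp.add_apply]
    linear_combination h1 + h2

lemma formallyIntegrable_D (G : RatXY) : FormallyIntegrable (D G) :=
  ⟨⟨0, 0, ∅, fun _ => 1, G, by simp, by simp, by simp⟩, by simp, by simp⟩

lemma formallyIntegrable_zero : FormallyIntegrable 0 := by
  simpa using formallyIntegrable_D 0

lemma FormallyIntegrable.sum {ι : Type*} (s : Finset ι) (f : ι → RatXY)
    (h : ∀ i ∈ s, FormallyIntegrable (f i)) : FormallyIntegrable (∑ i ∈ s, f i) := by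
  classical
  induction s using Finset.induction_on with
  | empty => simpa using formallyIntegrable_zero
  | insert a s ha ih =>
    rw [Finset.sum_insert ha]
    exact (h a (Finset.mem_insert_self a s)).add
      (ih fun i hi => h i (Finset.mem_insert_of_mem hi))

lemma formallyIntegrable_logDeriv (μ : ℂ) {P : RatXY} (hP : P ≠ 0) :
    FormallyIntegrable (const μ * (D P / P)) :=
  ⟨⟨0, 0, {μ}, fun _ => P, 0, by simp, by simp, by simp [hP]⟩, by simp, by simp⟩

lemma formallyIntegrable_eiTerm (c : ℂ) {p : ℤ} (hp : p ≠ 0) (μ : ℂ) :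
    FormallyIntegrable (const c * eiTerm p μ) := by
  refine ⟨⟨Finsupp.single (p, μ) c, 0, ∅, fun _ => 1, 0, fun i hi => ?_, by simp, by simp⟩, ?_, by simp⟩
  · rw [Finset.mem_singleton.1 (Finsupp.support_single_subset hi)]
    exact hp
  · simp [Finsupp.sum_single_index, const_eq]

/-- Repeated integration by parts gives the integral Σ c (-1)^(p+1) (r! / s!) y^s Li_p(μx) over p ≥
1 with p + s = r + 1. These coefficients solve the cancellation recursion in `LogExpr.Formal`. -/
lemma formallyIntegrable_liTerm (c : ℂ) (r : ℕ) {μ : ℂ} (hμ : μ ≠ 0) :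
    FormallyIntegrable (const c * liTerm r μ) := by
  classical
  set b₀ : ℕ × ℕ × ℂ → ℂ := fun i => if 1 ≤ i.1 ∧ i.1 + i.2.1 = r + 1 ∧ i.2.2 = μ then
    c * (-1) ^ (i.1 + 1) * r.factorial / i.2.1.factorial else 0 with hb₀
  set b : ℕ × ℕ × ℂ →₀ ℂ := Finsupp.onFinset
    (Finset.range (r + 2) ×ˢ Finset.range (r + 2) ×ˢ {μ}) b₀ (by
      rintro ⟨p, s, ν⟩ h
      simp only [hb₀, ne_eq, ite_eq_right_iff, not_forall] at h
      obtain ⟨⟨_, h2, h3⟩, _⟩ := h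
      simp only [Finset.mem_product, Finset.mem_range, Finset.mem_singleton]
      exact ⟨by omega, by omega, h3⟩) with hb
  have hbapply : ∀ i, b i = b₀ i := fun i => rfl
  refine ⟨⟨0, b, ∅, fun _ => 1, 0, by simp, fun i hi => ?_, by simp⟩, ?_, ?_⟩
  · rw [Finsupp.mem_support_iff, hbapply] at hi
    simp only [hb₀, ne_eq, ite_eq_right_iff, not_forall] at hi
    obtain ⟨⟨h1, h2, h3⟩, _⟩ := hi
    exact ⟨h1, h3 ▸ hμ⟩
  · simp only [map_zero, Finset.sum_empty, Finsupp.sum_zero_index, add_zero, zero_add]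
    rw [Finsupp.sum, Finset.sum_eq_single (1, r, μ)]
    · have hr : (r.factorial : ℂ) ≠ 0 := by exact_mod_cast r.factorial_ne_zero
      rw [if_pos rfl, hbapply]
      simp only [hb₀]
      rw [if_pos (by simp; omega)]
      congr 2
      field_simp
      norm_num
    · rintro ⟨p, s, ν⟩ h hne
      split_ifs with hp
      · simp only at hp
        subst hp
        rw [Finsupp.mem_support_iff, hbapply] at h
        simp only [hb₀, ne_eq, ite_eq_right_iff, not_forall] at h
        obtain ⟨⟨h1, h2, h3⟩, _⟩ := h
        exact absurd (by simp only [h3, Prod.mk.injEq, true_and, and_true]; omega) hne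
      · rfl
    · intro h
      rw [Finsupp.notMem_support_iff] at h
      rw [if_pos rfl, h, const_eq, map_zero, zero_mul]
  · intro p s ν hp
    simp only [hbapply, hb₀]
    by_cases h : p + (s + 1) = r + 1 ∧ ν = μ
    · rw [if_pos ⟨hp, h⟩, if_pos ⟨by omega, by omega, h.2⟩]
      have hs : (s.factorial : ℂ) ≠ 0 := by exact_mod_cast s.factorial_ne_zero
      have hs' : (s : ℂ) + 1 ≠ 0 := by exact_mod_cast Nat.succ_ne_zero s
      rw [Nat.factorial_succ]
      push_cast
      field_simp
      ring
    · rw [if_neg fun h' => h h'.2, if_neg fun h' => h ⟨by omega, h'.2.2⟩]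
      simp

end RatXY

/-! ### Formal integration of the pieces of the Hermite reduction. -/

open Polynomial in
/-- Every rational function in `x` is a derivative plus a sum of simple fractions. -/
lemma RatX.exists_residue_form (a : RatX) : ∃ (G : RatX) (r : ℂ →₀ ℂ), a = RatX.deriv G +
    r.sum fun c t => algebraMap ℂ RatX t / (RatX.X - algebraMap ℂ RatX c) := by
  set M : RatX → Prop := fun a => ∃ (G : RatX) (r : ℂ →₀ ℂ), a = RatX.deriv G +
    r.sum fun c t => algebraMap ℂ RatX t / (RatX.X - algebraMap ℂ RatX c) with hM
  have hadd : ∀ a b, M a → M b → M (a + b) := by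
    rintro a b ⟨G, r, rfl⟩ ⟨G', r', rfl⟩
    refine ⟨G + G', r + r', ?_⟩
    rw [map_add, Finsupp.sum_add_index' (by simp) (by intros; rw [map_add, add_div])]
    ring
  have hzero : M 0 := ⟨0, 0, by simp⟩
  have hpoly : ∀ q : Polynomial ℂ, M (algebraMap _ RatX q) := by
    intro q
    induction q using Polynomial.induction_on' with
    | add p q hp hq => rw [map_add]; exact hadd _ _ hp hq
    | monomial n a =>
      refine ⟨algebraMap _ RatX (monomial (n + 1) (a / (n + 1))), 0, ?_⟩
      rw [RatX.deriv_algebraMap, derivative_monomial]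
      have : (n : ℂ) + 1 ≠ 0 := Nat.cast_add_one_ne_zero n
      simp [div_mul_cancel₀ _ this]
  obtain ⟨G, q, c, hc, rfl⟩ := exists_hermite_reduction (R := Polynomial ℂ) RatX.deriv
    {P : Polynomial ℂ | P.Monic} (fun P hP => ⟨normalize P, by
      simpa using monic_normalize hP.ne_zero, (normalize_associated P).symm⟩)
    (fun r => ⟨_, RatX.deriv_algebraMap r⟩)
    (fun P _ hP => ⟨_, RatX.deriv_algebraMap P, RatX.not_dvd_derivative hP.irreducible⟩) a
  refine hadd _ _ (hadd _ _ ⟨G, 0, by simp⟩ (hpoly q)) ?_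
  refine Finset.sum_induction _ M hadd hzero fun P hPc => ?_
  obtain ⟨hm, hP⟩ := hc P hPc
  have hdeg := IsAlgClosed.degree_eq_one_of_irreducible ℂ hP.irreducible
  obtain ⟨z, hz⟩ : ∃ z, P = Polynomial.X - C z := ⟨-P.coeff 0, by
    rw [C_neg, sub_neg_eq_add]
    exact hm.eq_X_add_C (natDegree_eq_of_degree_eq_some hdeg)⟩
  obtain ⟨w, hw⟩ : Polynomial.X - C z ∣ c P - C ((c P).eval z) := X_sub_C_dvd_sub_C_eval
  have hP0 : algebraMap _ RatX (Polynomial.X - C z) ≠ 0 := RatX.algebraMap_ne_zero (X_sub_C_ne_zero z)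
  have e : algebraMap _ RatX (c P) / algebraMap _ RatX P = algebraMap _ RatX w +
      algebraMap ℂ RatX ((c P).eval z) / (RatX.X - algebraMap ℂ RatX z) := by
    have h1 : c P = (Polynomial.X - C z) * w + C ((c P).eval z) := by linear_combination hw
    have h2 : RatX.X - algebraMap ℂ RatX z = algebraMap _ RatX (Polynomial.X - C z) := by
      rw [map_sub]; rfl
    rw [h2]
    nth_rw 2 [hz]
    nth_rw 1 [h1]
    rw [map_add, add_div, map_mul, mul_div_cancel_left₀ _ hP0]
    rfl
  change M (algebraMap _ RatX (c P) / algebraMap _ RatX P)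
  rw [e]
  refine hadd _ _ (hpoly w) ⟨0, Finsupp.single z ((c P).eval z), ?_⟩
  rw [Finsupp.sum_single_index (by simp)]
  simp

lemma isPrincipalIdealRing_polynomial (F : Type*) [Field F] :
    IsPrincipalIdealRing (Polynomial F) := inferInstance

namespace RatXY

open Polynomial

lemma const_mul (c d : ℂ) : const (c * d) = const c * const d := by
  simp only [const_eq, map_mul]

lemma const_inv (c : ℂ) : const c⁻¹ = (const c)⁻¹ := by
  simp only [const_eq, map_inv₀]

lemma const_neg (c : ℂ) : const (-c) = -const c := by
  simp only [const_eq, map_neg]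

lemma const_zero : const 0 = 0 := by
  simp only [const_eq, map_zero]

lemma const_one : const 1 = 1 := by
  simp only [const_eq, map_one]

lemma const_natCast (n : ℕ) : const n = n := by
  simp only [const_eq, map_natCast]

lemma const_intCast (n : ℤ) : const n = n := by
  simp only [const_eq, map_intCast]

lemma const_ne_zero {c : ℂ} (hc : c ≠ 0) : const c ≠ 0 := by
  rw [const_eq]; simpa using hc

/-- The reduction step for `a(x) yᵏ`. -/
lemma formallyIntegrable_mul_pow_of_pred (k : ℕ)
    (h : ∀ b, FormallyIntegrable (ofRatX b * (k * y ^ (k - 1)))) (a : RatX) :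
    FormallyIntegrable (ofRatX a * y ^ k) := by
  obtain ⟨G, r, rfl⟩ := RatX.exists_residue_form a
  rw [map_add, add_mul, Finsupp.sum, map_sum, Finset.sum_mul]
  refine FormallyIntegrable.add ?_ (FormallyIntegrable.sum _ _ fun c _ => ?_)
  -- Integration by parts: G' y^k = D(G y^k) - (G / x) k y^(k-1).
  · convert (formallyIntegrable_D (ofRatX G * y ^ k)).add (h (-(G / RatX.X))) using 1
    rw [Derivation.leibniz, Derivation.leibniz_pow, D_ofRatX, D_y, map_neg, map_div₀, ofRatX_X]
    simp only [smul_eq_mul, nsmul_eq_mul]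
    ring
  · rw [map_div₀, map_sub, ofRatX_X, ofRatX_const, ofRatX_const]
    have hx := x_ne_zero
    -- The pole at 0 yields y^k / x, a derivative of a power of y. A pole at c ≠ 0 yields
    -- polylogarithms with argument x / c.
    rcases eq_or_ne c 0 with rfl | hc
    · convert formallyIntegrable_D (const (r 0 * ((k + 1 : ℕ) : ℂ)⁻¹) * y ^ (k + 1)) using 1
      have hk : ((k + 1 : ℕ) : RatXY) ≠ 0 := Nat.cast_ne_zero.2 (Nat.succ_ne_zero k)
      rw [Derivation.leibniz, Derivation.leibniz_pow, D_const, D_y, const_zero, const_mul, const_inv, const_natCast]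
      simp only [smul_eq_mul, nsmul_eq_mul, Nat.add_sub_cancel, sub_zero]
      field_simp
      ring
    · convert formallyIntegrable_liTerm (-r c) k (inv_ne_zero hc) using 1
      have hc' := const_ne_zero hc
      have h1 : x - const c ≠ 0 := by
        have : x - const c = algebraMap _ RatXY (C (X - C c)) := by
          rw [C_sub, map_sub]; rfl
        rw [this]
        exact algebraMap_ne_zero (C_ne_zero.2 (X_sub_C_ne_zero _))
      have h2 : 1 - (const c)⁻¹ * x = -((const c)⁻¹ * (x - const c)) := by
        field_simp
        ring
      rw [liTerm, const_inv, const_neg, h2]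
      field_simp

/-- Products of a power of `ln x` and a rational function of `x` have a formal integral. -/
lemma formallyIntegrable_mul_pow (k : ℕ) (a : RatX) :
    FormallyIntegrable (ofRatX a * y ^ k) := by
  induction k generalizing a with
  | zero =>
    exact formallyIntegrable_mul_pow_of_pred 0 (fun b => by
      simpa using formallyIntegrable_zero) a
  | succ k ih =>
    refine formallyIntegrable_mul_pow_of_pred (k + 1) (fun b => ?_) a
    convert ih (b * (k + 1 : ℕ)) using 1
    rw [map_mul, map_natCast, Nat.add_sub_cancel]
    ring

/-- Polynomials in `y` have a formal integral. -/
lemma formallyIntegrable_polynomial (q : Polynomial RatX) :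
    FormallyIntegrable (algebraMap _ RatXY q) := by
  induction q using Polynomial.induction_on' with
  | add p q hp hq => rw [map_add]; exact hp.add hq
  | monomial n a =>
    rw [← C_mul_X_pow_eq_monomial, map_mul, map_pow, algebraMap_C, algebraMap_X]
    exact formallyIntegrable_mul_pow n a

/-- Terms `c xᵏ / (y - c₀)` have a formal integral. -/
lemma formallyIntegrable_zpow_div (c c₀ : ℂ) (k : ℤ) :
    FormallyIntegrable (const c * (x ^ (k - 1) / (y - const c₀))) := by
  have hy : y - const c₀ ≠ 0 := by
    have : y - const c₀ = algebraMap _ RatXY (X - C (C c₀)) := by rw [map_sub]; rfl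
    rw [this]
    exact algebraMap_ne_zero (X_sub_C_ne_zero _)
  rcases eq_or_ne k 0 with rfl | hk
  · convert formallyIntegrable_logDeriv c hy using 3
    rw [map_sub, D_y, D_const, sub_zero, zero_sub, zpow_neg_one]
  -- With μ = -k c₀ the denominator k y + μ is k (y - c₀), and the factor exp(k c₀) cancels exp(μ).
  · convert formallyIntegrable_eiTerm (c * exp (k * c₀)) hk (-(k * c₀)) using 1
    have hk' : (k : RatXY) ≠ 0 := by exact_mod_cast hk
    have he : const (exp (k * c₀)) ≠ 0 := const_ne_zero (exp_ne_zero _)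
    have e : (k : RatXY) * y + const (-(k * c₀)) = k * (y - const c₀) := by
      rw [const_neg, const_mul, const_intCast]; ring
    rw [eiTerm, e, const_mul, Complex.exp_neg, const_inv]
    field_simp

/-- A rational function satisfying a telescoping equation has a formal integral. -/
theorem formallyIntegrable_of_telescoper {f R : RatXY} {L : Polynomial ℂ} (hL : L ≠ 0)
    (h : aeval (R := ℂ) (A := Module.End ℂ RatXY) dY.toLinearMap L f = D R) :
    FormallyIntegrable f := by
  classical
  have hT := extendsTotalDeriv
  have : IsPrincipalIdealRing (Polynomial RatX) := isPrincipalIdealRing_polynomial RatX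
  obtain ⟨G, q, c, hc, hf⟩ := exists_hermite_reduction (R := Polynomial RatX) D
    {P : Polynomial RatX | P.Monic} (fun P hP => ⟨normalize P, by
      simpa using monic_normalize hP.ne_zero, (normalize_associated P).symm⟩)
    (fun r => ⟨_, hT.total r⟩)
    (fun P hm hP => ⟨_, hT.total P, not_dvd_totalDeriv hP.irreducible hm⟩) f
  rw [hf]
  refine ((formallyIntegrable_D G).add (formallyIntegrable_polynomial q)).add ?_
  refine FormallyIntegrable.sum _ _ fun P hPc => ?_
  change FormallyIntegrable (algebraMap _ RatXY (c P) / algebraMap _ RatXY P)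
  obtain ⟨hm, hP⟩ := hc P hPc
  replace hm : P.Monic := hm
  have hP0 : algebraMap _ RatXY P ≠ 0 := by
    rw [Ne, IsFractionRing.to_map_eq_zero_iff]; exact hP.ne_zero
  have hreg : algebraMap _ RatXY q + ∑ Q ∈ c.support.erase P,
      algebraMap _ RatXY (c Q) / algebraMap _ RatXY Q ∈ regularAlong RatXY hP := by
    refine add_mem (algebraMap_mem_regularAlong hP q) (sum_mem fun Q hQ => ?_)
    obtain ⟨hQm, hQ'⟩ := hc Q (Finset.mem_of_mem_erase hQ)
    rw [div_eq_mul_inv]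
    refine mul_mem (algebraMap_mem_regularAlong hP _) (inv_mem_regularAlong hP fun hdvd => ?_)
    exact Finset.ne_of_mem_erase hQ (eq_of_monic_of_associated hQm hm
      (hP.associated_of_dvd hQ' hdvd).symm)
  have e : f = D G + algebraMap _ RatXY (c P) / algebraMap _ RatXY P +
      (algebraMap _ RatXY q + ∑ Q ∈ c.support.erase P,
      algebraMap _ RatXY (c Q) / algebraMap _ RatXY Q) := by
    rw [hf, Finsupp.sum, ← Finset.add_sum_erase _ _ hPc]
    ring
  -- A constant residue gives a logarithm of P; a Laurent polynomial on a line y = c₀ gives terms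
  -- x^(k-1) / (y - c₀). The multiple P r of P contributes only the polynomial r.
  rcases simple_pole_of_telescoper hP hT hm hL h hreg e with
    ⟨μ, r, hr⟩ | ⟨c₀, p, n, r, hPc₀, hr⟩
  · rw [hr, map_add, add_div, map_mul _ P r, mul_div_cancel_left₀ _ hP0, map_mul, ← hT.total,
      algebraMap_C, ofRatX_const, mul_div_assoc]
    exact (formallyIntegrable_logDeriv μ hP0).add (formallyIntegrable_polynomial r)
  · rw [hr, map_add, add_div, map_mul _ P r, mul_div_cancel_left₀ _ hP0, map_mul, ← hT.total,
      algebraMap_C]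
    refine FormallyIntegrable.add ?_ (formallyIntegrable_polynomial r)
    have e1 : algebraMap _ RatXY P = y - const c₀ := by
      rw [hPc₀, map_sub, algebraMap_X, algebraMap_C, ofRatX_const]
    have e2 : ofRatX (algebraMap _ RatX p / RatX.X ^ n) * D (algebraMap _ RatXY P) /
        algebraMap _ RatXY P = ∑ i ∈ p.support, const (p.coeff i) *
          (x ^ ((i - n : ℤ) - 1) / (y - const c₀)) := by
      have e3 : algebraMap _ RatX p = ∑ i ∈ p.support, algebraMap ℂ RatX (p.coeff i) *
          RatX.X ^ i := by
        conv_lhs => rw [p.as_sum_support_C_mul_X_pow]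
        simp only [map_sum, map_mul, map_pow]
        rfl
      have hx := x_ne_zero
      rw [e1, map_sub, D_y, D_const, e3, map_div₀, map_sum, map_pow, ofRatX_X]
      simp only [map_mul, map_pow, ofRatX_const, ofRatX_X]
      rw [Finset.sum_div, Finset.sum_mul, Finset.sum_div]
      refine Finset.sum_congr rfl fun i _ => ?_
      rw [zpow_sub_one₀ hx, zpow_sub₀ hx, zpow_natCast, zpow_natCast]
      field_simp
      ring
    rw [e2]
    exact FormallyIntegrable.sum _ _ fun i _ => formallyIntegrable_zpow_div _ _ _

end RatXY

/-! ### Values of rational functions along the curves y = ln x + h. -/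

namespace RatXY

open Polynomial

variable {a b : ℂ} {f g : RatXY}

lemma mul_den (f : RatXY) : f * algebraMap _ RatXY (den f) = algebraMap _ RatXY (num f) := by
  have hd : algebraMap (Polynomial (Polynomial ℂ)) RatXY (den f) ≠ 0 :=
    algebraMap_ne_zero (nonZeroDivisors.ne_zero
      (IsFractionRing.den (Polynomial (Polynomial ℂ)) f).2)
  have := IsFractionRing.mk'_num_den (Polynomial (Polynomial ℂ)) f
  rw [IsFractionRing.mk'_eq_div] at this
  exact ((div_eq_iff hd).1 this).symm

lemma den_ne_zero (f : RatXY) : den f ≠ 0 :=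
  nonZeroDivisors.ne_zero (IsFractionRing.den (Polynomial (Polynomial ℂ)) f).2

lemma isRelPrime_num_den (f : RatXY) : IsRelPrime (num f) (den f) :=
  IsFractionRing.num_den_reduced (Polynomial (Polynomial ℂ)) f

lemma den_dvd {p q : Polynomial (Polynomial ℂ)}
    (h : f * algebraMap _ RatXY q = algebraMap _ RatXY p) : den f ∣ q := by
  have e : num f * q = p * den f := by
    apply IsFractionRing.injective (Polynomial (Polynomial ℂ)) RatXY
    rw [map_mul, map_mul, ← mul_den, ← h]
    ring
  have h1 : den f ∣ num f * q := ⟨p, by rw [e, mul_comm]⟩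
  exact (isRelPrime_num_den f).symm.dvd_of_dvd_mul_left h1

/-- Values may be read off from any fraction with nonvanishing denominator, reduced or not. The
rules for sums, products and inverses all rest on this. -/
lemma regularAt_of_mul_eq {p q : Polynomial (Polynomial ℂ)} (hq : q.evalEval a b ≠ 0)
    (h : f * algebraMap _ RatXY q = algebraMap _ RatXY p) :
    RegularAt f a b ∧ eval f a b = p.evalEval a b / q.evalEval a b := by
  obtain ⟨r, hr⟩ := den_dvd h
  have hreg : (den f).evalEval a b ≠ 0 := by
    intro h0
    rw [hr, evalEval_mul, h0, zero_mul] at hq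
    exact hq rfl
  refine ⟨hreg, ?_⟩
  have e : num f * q = p * den f := by
    apply IsFractionRing.injective (Polynomial (Polynomial ℂ)) RatXY
    rw [map_mul, map_mul, ← mul_den, ← h]
    ring
  rw [eval, div_eq_div_iff hreg hq, ← evalEval_mul, ← evalEval_mul, e]

lemma regularAt_algebraMap (p : Polynomial (Polynomial ℂ)) (a b : ℂ) :
    RegularAt (algebraMap _ RatXY p) a b ∧ eval (algebraMap _ RatXY p) a b = p.evalEval a b := by
  simpa using regularAt_of_mul_eq (f := algebraMap _ RatXY p) (p := p) (q := 1) (a := a) (b := b)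
    (by simp) (by simp)

lemma RegularAt.add (hf : RegularAt f a b) (hg : RegularAt g a b) :
    RegularAt (f + g) a b ∧ eval (f + g) a b = eval f a b + eval g a b := by
  have h := regularAt_of_mul_eq (f := f + g) (p := num f * den g + num g * den f)
    (q := den f * den g) (a := a) (b := b) (by rw [evalEval_mul]; exact mul_ne_zero hf hg) (by
      rw [map_mul, map_add, map_mul, map_mul, ← mul_den, ← mul_den]; ring)
  refine ⟨h.1, h.2.trans ?_⟩
  have h1 : (den f).evalEval a b ≠ 0 := hf
  have h2 : (den g).evalEval a b ≠ 0 := hg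
  simp only [eval, evalEval_add, evalEval_mul]
  field_simp

lemma RegularAt.mul (hf : RegularAt f a b) (hg : RegularAt g a b) :
    RegularAt (f * g) a b ∧ eval (f * g) a b = eval f a b * eval g a b := by
  have h := regularAt_of_mul_eq (f := f * g) (p := num f * num g)
    (q := den f * den g) (a := a) (b := b) (by rw [evalEval_mul]; exact mul_ne_zero hf hg) (by
      rw [map_mul, map_mul, ← mul_den, ← mul_den]; ring)
  refine ⟨h.1, h.2.trans ?_⟩
  simp only [eval, evalEval_mul]
  rw [div_mul_div_comm]

lemma regularAt_const (c a b : ℂ) : RegularAt (const c) a b ∧ eval (const c) a b = c := by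
  have h := regularAt_algebraMap (C (C c)) a b
  rw [evalEval_C, Polynomial.eval_C] at h
  exact h

lemma regularAt_x (a b : ℂ) : RegularAt x a b ∧ eval x a b = a := by
  have h := regularAt_algebraMap polyX a b
  rw [polyX, evalEval_C, Polynomial.eval_X] at h
  exact h

lemma regularAt_y (a b : ℂ) : RegularAt y a b ∧ eval y a b = b := by
  have h := regularAt_algebraMap X a b
  rw [evalEval_X] at h
  exact h

lemma RegularAt.inv (hf : RegularAt f a b) (h0 : eval f a b ≠ 0) :
    RegularAt f⁻¹ a b ∧ eval f⁻¹ a b = (eval f a b)⁻¹ := by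
  have hn : (num f).evalEval a b ≠ 0 := by
    intro h; rw [eval, h, zero_div] at h0; exact h0 rfl
  have hf0 : f ≠ 0 := by
    rintro rfl
    have : num (0 : RatXY) = 0 := by
      apply IsFractionRing.injective (Polynomial (Polynomial ℂ)) RatXY
      rw [← mul_den, zero_mul, map_zero]
    rw [this] at hn
    simp at hn
  have h := regularAt_of_mul_eq (f := f⁻¹) (p := den f) (q := num f) hn (by
    rw [← mul_den, inv_mul_cancel_left₀ hf0])
  refine ⟨h.1, h.2.trans ?_⟩
  rw [eval, inv_div]

lemma RegularAt.pow (hf : RegularAt f a b) (n : ℕ) :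
    RegularAt (f ^ n) a b ∧ eval (f ^ n) a b = eval f a b ^ n := by
  induction n with
  | zero => simpa [const_one] using regularAt_const 1 a b
  | succ n ih =>
    rw [pow_succ, pow_succ, ← ih.2]
    exact ih.1.mul hf

lemma RegularAt.neg (hf : RegularAt f a b) :
    RegularAt (-f) a b ∧ eval (-f) a b = -eval f a b := by
  have h := (regularAt_const (-1) a b).1.mul hf
  rw [(regularAt_const (-1) a b).2, const_neg, const_one, neg_one_mul, neg_one_mul] at h
  exact h

lemma RegularAt.sub (hf : RegularAt f a b) (hg : RegularAt g a b) :
    RegularAt (f - g) a b ∧ eval (f - g) a b = eval f a b - eval g a b := by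
  have h := hf.add hg.neg.1
  rw [hg.neg.2, ← sub_eq_add_neg, ← sub_eq_add_neg] at h
  exact h

lemma RegularAt.div (hf : RegularAt f a b) (hg : RegularAt g a b) (h0 : eval g a b ≠ 0) :
    RegularAt (f / g) a b ∧ eval (f / g) a b = eval f a b / eval g a b := by
  have h := hf.mul (hg.inv h0).1
  rw [(hg.inv h0).2, ← div_eq_mul_inv, ← div_eq_mul_inv] at h
  exact h

lemma RegularAt.zpow (hf : RegularAt f a b) (h0 : eval f a b ≠ 0) (n : ℤ) :
    RegularAt (f ^ n) a b ∧ eval (f ^ n) a b = eval f a b ^ n := by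
  obtain ⟨m, rfl | rfl⟩ := n.eq_nat_or_neg
  · simpa using hf.pow m
  · have h := hf.pow m
    have h' := h.1.inv (by rw [h.2]; exact pow_ne_zero m h0)
    rw [h.2] at h'
    simpa using h'

lemma RegularAt.finset_sum {ι : Type*} (s : Finset ι) {F : ι → RatXY}
    (h : ∀ i ∈ s, RegularAt (F i) a b) :
    RegularAt (∑ i ∈ s, F i) a b ∧ eval (∑ i ∈ s, F i) a b = ∑ i ∈ s, eval (F i) a b := by
  classical
  induction s using Finset.induction_on with
  | empty => simpa [const_zero] using regularAt_const 0 a b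
  | insert i s hi ih =>
    rw [Finset.sum_insert hi, Finset.sum_insert hi,
      ← (ih fun j hj => h j (Finset.mem_insert_of_mem hj)).2]
    exact (h i (Finset.mem_insert_self i s)).add
      (ih fun j hj => h j (Finset.mem_insert_of_mem hj)).1

lemma hasDerivAt_evalEval (p : Polynomial (Polynomial ℂ)) {γ₁ γ₂ : ℂ → ℂ} {γ₁' γ₂' s : ℂ}
    (h₁ : HasDerivAt γ₁ γ₁' s) (h₂ : HasDerivAt γ₂ γ₂' s) :
    HasDerivAt (fun s => p.evalEval (γ₁ s) (γ₂ s))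
      ((coeffDerivation derivative' p).evalEval (γ₁ s) (γ₂ s) * γ₁' +
        (derivative p).evalEval (γ₁ s) (γ₂ s) * γ₂') s := by
  induction p using Polynomial.induction_on' with
  | add p q hp hq =>
    simp only [map_add, evalEval_add]
    exact (hp.add hq).congr_deriv (by ring)
  | monomial n q =>
    have h3 : HasDerivAt (fun s => q.eval (γ₁ s)) ((derivative q).eval (γ₁ s) * γ₁') s :=
      (q.hasDerivAt (γ₁ s)).comp s h₁
    have h4 := h3.mul (h₂.pow n)
    have e : coeffDerivation (k := ℂ) derivative' (monomial n q) = monomial n (derivative q) := by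
      ext m
      simp [coeff_monomial, apply_ite (derivative' (R := ℂ))]
    rw [e]
    have e2 : ∀ (m : ℕ) (q : Polynomial ℂ) (u v : ℂ), (monomial m q).evalEval u v =
        q.eval u * v ^ m := by
      intro m q u v
      rw [← C_mul_X_pow_eq_monomial, evalEval_mul, evalEval_C, evalEval_pow, evalEval_X]
    simp only [e2, derivative_monomial]
    refine h4.congr_deriv ?_
    simp only [Polynomial.eval_mul, Polynomial.eval_natCast, Pi.pow_apply]
    ring

/-- The chain rule for rational functions. -/
lemma hasDerivAt_eval {γ₁ γ₂ : ℂ → ℂ} {γ₁' γ₂' s : ℂ}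
    (h₁ : HasDerivAt γ₁ γ₁' s) (h₂ : HasDerivAt γ₂ γ₂' s)
    (hf : RegularAt f (γ₁ s) (γ₂ s)) :
    RegularAt (dX f) (γ₁ s) (γ₂ s) ∧ RegularAt (dY f) (γ₁ s) (γ₂ s) ∧
    HasDerivAt (fun s => eval f (γ₁ s) (γ₂ s))
      (eval (dX f) (γ₁ s) (γ₂ s) * γ₁' + eval (dY f) (γ₁ s) (γ₂ s) * γ₂') s := by
  have hd : (den f).evalEval (γ₁ s) (γ₂ s) ≠ 0 := hf
  have hd2 : (den f * den f).evalEval (γ₁ s) (γ₂ s) ≠ 0 := by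
    rw [evalEval_mul]; exact mul_ne_zero hd hd
  have hX := regularAt_of_mul_eq (f := dX f)
    (p := coeffDerivation derivative' (num f) * den f - num f * coeffDerivation derivative' (den f))
    (q := den f * den f) hd2 (by
      have e := congrArg dX (mul_den f)
      rw [Derivation.leibniz, dX_algebraMap, dX_algebraMap, smul_eq_mul, smul_eq_mul] at e
      rw [map_mul, map_sub, map_mul, map_mul, ← mul_den, ← e]
      ring)
  have hY := regularAt_of_mul_eq (f := dY f)
    (p := derivative (num f) * den f - num f * derivative (den f))
    (q := den f * den f) hd2 (by
      have e := congrArg dY (mul_den f)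
      rw [Derivation.leibniz, dY_algebraMap, dY_algebraMap, smul_eq_mul, smul_eq_mul] at e
      rw [map_mul, map_sub, map_mul, map_mul, ← mul_den, ← e]
      ring)
  refine ⟨hX.1, hY.1, ?_⟩
  refine ((hasDerivAt_evalEval (num f) h₁ h₂).div
    (hasDerivAt_evalEval (den f) h₁ h₂) hd).congr_deriv ?_
  rw [hX.2, hY.2]
  simp only [evalEval_mul, evalEval_sub]
  field_simp
  ring

/-- The derivation `D` is the derivative along the curves `y = ln x + h`. -/
lemma hasDerivAt_eval_log {t h : ℂ} (ht : t ∈ slitPlane) (hf : RegularAt f t (log t + h)) :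
    RegularAt (D f) t (log t + h) ∧
      HasDerivAt (fun t => eval f t (log t + h)) (eval (D f) t (log t + h)) t := by
  obtain ⟨hX, hY, hder⟩ := hasDerivAt_eval (γ₁ := fun t => t) (γ₂ := fun t => log t + h)
    (hasDerivAt_id' t) ((Complex.hasDerivAt_log ht).add_const h) hf
  have hx := (regularAt_x t (log t + h)).1.inv (by
    rw [(regularAt_x t (log t + h)).2]; exact slitPlane_ne_zero ht)
  have hm := hx.1.mul hY
  have hD := hX.add hm.1
  rw [hm.2, hx.2, (regularAt_x t (log t + h)).2] at hD
  rw [D_apply, hD.2]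
  refine ⟨hD.1, ?_⟩
  exact hder.congr_deriv (by ring)

/-- The derivation `∂_y` is the derivative in the second variable. -/
lemma hasDerivAt_eval_snd (hf : RegularAt f a b) :
    RegularAt (dY f) a b ∧ HasDerivAt (fun s => eval f a s) (eval (dY f) a b) b := by
  obtain ⟨hX, hY, hder⟩ := hasDerivAt_eval (γ₁ := fun _ => a) (γ₂ := fun s => s)
    (hasDerivAt_const b a) (hasDerivAt_id' b) hf
  refine ⟨hY, ?_⟩
  exact hder.congr_deriv (by ring)

/-! ### Algebraic independence of x and ln x. -/

/-- The operator `x ∂_x + ∂_y - n` on polynomials. -/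
noncomputable def eulerSub (n : ℕ) (p : Polynomial (Polynomial ℂ)) : Polynomial (Polynomial ℂ) :=
  C X * coeffDerivation (k := ℂ) derivative' p + derivative p - C (C (n : ℂ)) * p

lemma coeff_eulerSub (n : ℕ) (p : Polynomial (Polynomial ℂ)) (j : ℕ) :
    (eulerSub n p).coeff j = X * derivative (p.coeff j) +
      p.coeff (j + 1) * C ((j : ℂ) + 1) - C (n : ℂ) * p.coeff j := by
  rw [eulerSub, coeff_sub, coeff_add, coeff_C_mul, coeff_C_mul, coeff_coeffDerivation,
    coeff_derivative, show (C ((j : ℂ) + 1) : Polynomial ℂ) = (j : Polynomial ℂ) + 1 by simp]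
  rfl

/-- Applying t d/dt to p(t, ln t) = 0 gives the relation for x ∂_x + ∂_y; subtracting a multiple of
p does not change it. -/
lemma evalEval_eulerSub {p : Polynomial (Polynomial ℂ)} {U : Set ℂ} (hU : IsOpen U)
    (hs : U ⊆ slitPlane) (h : ∀ t ∈ U, p.evalEval t (log t) = 0) (n : ℕ) :
    ∀ t ∈ U, (eulerSub n p).evalEval t (log t) = 0 := by
  intro t ht
  have h1 := hasDerivAt_evalEval p (hasDerivAt_id' t) (Complex.hasDerivAt_log (hs ht))
  have h2 : HasDerivAt (fun s => p.evalEval s (log s)) 0 t :=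
    (hasDerivAt_const t (0 : ℂ)).congr_of_eventuallyEq
      (Filter.eventuallyEq_of_mem (hU.mem_nhds ht) h)
  have h3 := h1.unique h2
  have ht0 := slitPlane_ne_zero (hs ht)
  rw [eulerSub, evalEval_sub, evalEval_add, evalEval_mul, evalEval_mul, h t ht, mul_zero, sub_zero,
    evalEval_C, Polynomial.eval_X]
  linear_combination t * h3 - (derivative p).evalEval t (log t) * mul_inv_cancel₀ ht0

lemma natDegree_eulerSub_le (n : ℕ) (p : Polynomial (Polynomial ℂ)) :
    (eulerSub n p).natDegree ≤ p.natDegree := by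
  refine natDegree_le_iff_coeff_eq_zero.2 fun j hj => ?_
  rw [coeff_eulerSub, coeff_eq_zero_of_natDegree_lt hj,
    coeff_eq_zero_of_natDegree_lt (n := j + 1) (by omega)]
  simp

/-- The leading coefficient l becomes x l' - n l, in which the term of degree n cancels. -/
lemma natDegree_leadingCoeff_eulerSub_lt {n : ℕ} {p : Polynomial (Polynomial ℂ)}
    (hn : p.leadingCoeff.natDegree = n) (h0 : eulerSub n p ≠ 0)
    (hd : (eulerSub n p).natDegree = p.natDegree) :
    (eulerSub n p).leadingCoeff.natDegree < n := by
  have hlq : (eulerSub n p).leadingCoeff =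
      X * derivative p.leadingCoeff - C (n : ℂ) * p.leadingCoeff := by
    rw [leadingCoeff, hd, coeff_eulerSub,
      coeff_eq_zero_of_natDegree_lt (n := p.natDegree + 1) (by omega), leadingCoeff]
    simp
  have hlq0 := leadingCoeff_ne_zero.2 h0
  rw [natDegree_lt_iff_degree_lt hlq0, degree_lt_iff_coeff_zero]
  intro m hm
  rw [hlq, coeff_sub, coeff_C_mul]
  rcases m with _ | m
  · rw [Nat.le_zero.1 hm]
    simp
  · rw [coeff_X_mul, coeff_derivative]
    rcases hm.eq_or_lt with rfl | hm
    · push_cast; ring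
    · rw [coeff_eq_zero_of_natDegree_lt (hn ▸ hm)]; simp

/-- If the degree in y is d+1, then in the coefficient of x^n y^d the contributions of x ∂_x and of
-n cancel, which leaves d+1 times the top coefficient. -/
lemma natDegree_eq_zero_of_eulerSub_eq_zero {n : ℕ} {p : Polynomial (Polynomial ℂ)}
    (hp : p ≠ 0) (hn : p.leadingCoeff.natDegree = n) (hqz : eulerSub n p = 0) :
    p.natDegree = 0 := by
  have hcn : p.leadingCoeff.coeff n ≠ 0 := by
    rw [← hn]; exact leadingCoeff_ne_zero.2 (leadingCoeff_ne_zero.2 hp)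
  by_contra hd0
  obtain ⟨d, hd⟩ := Nat.exists_eq_succ_of_ne_zero hd0
  have h1 := congrArg (fun r => coeff r n) (coeff_eulerSub n p d)
  have h2 : p.coeff (d + 1) = p.leadingCoeff := by rw [leadingCoeff, hd]
  simp only [hqz, coeff_zero, coeff_sub, coeff_add, coeff_C_mul, coeff_mul_C, h2] at h1
  have h4 : (X * derivative (p.coeff d)).coeff n = n * (p.coeff d).coeff n := by
    rcases n with _ | n
    · simp
    · rw [coeff_X_mul, coeff_derivative]; push_cast; ring
  rw [h4] at h1
  have h5 : p.leadingCoeff.coeff n * ((d : ℂ) + 1) = 0 := by linear_combination -h1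
  exact (mul_ne_zero hcn (Nat.cast_add_one_ne_zero d)) h5

/-- `x` and `ln x` are algebraically independent. -/
lemma eq_zero_of_evalEval_log {p : Polynomial (Polynomial ℂ)} {U : Set ℂ} (hU : IsOpen U)
    (hne : U.Nonempty) (hs : U ⊆ slitPlane) (h : ∀ t ∈ U, p.evalEval t (log t) = 0) : p = 0 := by
  obtain ⟨d, hd⟩ : ∃ d, p.natDegree = d := ⟨_, rfl⟩
  obtain ⟨n, hn⟩ : ∃ n, p.leadingCoeff.natDegree = n := ⟨_, rfl⟩
  -- Lexicographic induction on the degree in y and the degree of the leading coefficient: the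
  -- operator lowers this pair, so its result is zero and p does not involve y.
  induction d using Nat.strong_induction_on generalizing n p with
  | _ d ihd =>
  induction n using Nat.strong_induction_on generalizing p with
  | _ n ihn =>
  by_contra hp
  have hq0 := evalEval_eulerSub hU hs h n
  have hqz : eulerSub n p = 0 := by
    rcases (natDegree_eulerSub_le n p).lt_or_eq with hlt | heq
    · exact ihd _ (hd ▸ hlt) hq0 rfl _ rfl
    · by_contra hne
      exact hne (ihn _ (natDegree_leadingCoeff_eulerSub_lt hn hne heq) hq0 (heq.trans hd) rfl)
  have hd := natDegree_eq_zero_of_eulerSub_eq_zero hp hn hqz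
  rw [eq_C_of_natDegree_eq_zero hd] at h hp
  simp only [evalEval_C] at h
  refine hp ?_
  rw [eq_zero_of_infinite_isRoot (p.coeff 0)
    ((infinite_of_mem_nhds _ (hU.mem_nhds hne.some_mem)).mono h), C_0]

/-- A rational function that vanishes along the graph of the logarithm is zero. -/
lemma eq_zero_of_eval_log {U : Set ℂ} (hU : IsOpen U)
    (hne : U.Nonempty) (hs : U ⊆ slitPlane)
    (h : ∀ t ∈ U, RegularAt f t (log t) ∧ eval f t (log t) = 0) : f = 0 := by
  have : num f = 0 := eq_zero_of_evalEval_log hU hne hs fun t ht => by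
    have h2 := (h t ht).2
    rw [eval, div_eq_zero_iff] at h2
    exact h2.resolve_right (h t ht).1
  have e := mul_den f
  rw [this, map_zero, mul_eq_zero] at e
  exact e.resolve_right (algebraMap_ne_zero (den_ne_zero f))

/-- A nonzero polynomial is nonzero somewhere on every open piece of the graph of `ln`. -/
lemma exists_evalEval_log_ne_zero {p : Polynomial (Polynomial ℂ)} (hp : p ≠ 0) {U : Set ℂ}
    (hU : IsOpen U) (hne : U.Nonempty) (hs : U ⊆ slitPlane) :
    ∃ t ∈ U, p.evalEval t (log t) ≠ 0 := by
  by_contra h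
  push Not at h
  exact hp (eq_zero_of_evalEval_log hU hne hs h)

/-- A rational function that vanishes on an open set of curves `y = ln x + h` is zero. -/
lemma eq_zero_of_eval_log_add {x₀ h₀ : ℂ} {ρ : ℝ} (hρ : 0 < ρ)
    (h : ∀ a ∈ Metric.ball x₀ ρ, ∀ s ∈ Metric.ball h₀ ρ,
      RegularAt f a (log a + s) ∧ eval f a (log a + s) = 0) : f = 0 := by
  have hnum : num f = 0 := by
    have h1 : ∀ a ∈ Metric.ball x₀ ρ, (num f).map (evalRingHom a) = 0 := by
      intro a ha
      refine eq_zero_of_infinite_isRoot _ (((infinite_of_mem_nhds h₀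
        (Metric.ball_mem_nhds h₀ hρ)).image
        (add_right_injective (log a)).injOn).mono ?_)
      rintro _ ⟨s, hs, rfl⟩
      have h2 := (h a ha s hs).2
      rw [eval, div_eq_zero_iff] at h2
      have h3 := h2.resolve_right (h a ha s hs).1
      change Polynomial.eval _ _ = 0
      rwa [map_evalRingHom_eval]
    ext1 j
    refine eq_zero_of_infinite_isRoot _ ((infinite_of_mem_nhds x₀
      (Metric.ball_mem_nhds x₀ hρ)).mono fun a ha => ?_)
    have := congrArg (fun q => coeff q j) (h1 a ha)
    simpa using this
  have e := mul_den f
  rw [hnum, map_zero, mul_eq_zero] at e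
  exact e.resolve_right (algebraMap_ne_zero (den_ne_zero f))

end RatXY

/-! ### From an analytic to an algebraic telescoper. -/

/-- Interchanging partial derivatives of a function of two complex variables. -/
lemma hasDerivAt_fderiv_snd {G φ : ℂ × ℂ → ℂ} {U : Set (ℂ × ℂ)} (hU : IsOpen U)
    (hG : AnalyticOnNhd ℂ G U)
    (hφ : ∀ z ∈ U, HasDerivAt (fun t => G (t, z.2)) (φ z) z.1) {z : ℂ × ℂ} (hz : z ∈ U) {c : ℂ}
    (hc : HasDerivAt (fun s => φ (z.1, s)) c z.2) :
    HasDerivAt (fun t => fderiv ℂ G (t, z.2) (0, 1)) c z.1 := by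
  have h2 : HasFDerivAt (fderiv ℂ G) (fderiv ℂ (fderiv ℂ G) z) z :=
    (hG z hz).fderiv.differentiableAt.hasFDerivAt
  have hsymm := second_derivative_symmetric_of_eventually
    (Filter.eventually_of_mem (hU.mem_nhds hz) fun w hw =>
      (hG w hw).differentiableAt.hasFDerivAt) h2 (1, 0) (0, 1)
  have hfst : HasDerivAt (fun t : ℂ => (t, z.2)) ((1 : ℂ), (0 : ℂ)) z.1 :=
    (hasDerivAt_id' z.1).prodMk (hasDerivAt_const z.1 z.2)
  have hsnd : HasDerivAt (fun s : ℂ => (z.1, s)) ((0 : ℂ), (1 : ℂ)) z.2 :=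
    (hasDerivAt_const z.2 z.1).prodMk (hasDerivAt_id' z.2)
  have hev : ∀ w ∈ U, fderiv ℂ G w (1, 0) = φ w := fun w hw =>
    (((hG w hw).differentiableAt.hasFDerivAt (x := (w.1, w.2))).comp_hasDerivAt w.1
      ((hasDerivAt_id' w.1).prodMk (hasDerivAt_const w.1 w.2))).unique (hφ w hw)
  have h3 : HasDerivAt (fun s => fderiv ℂ G (z.1, s) (1, 0))
      (fderiv ℂ (fderiv ℂ G) z (0, 1) (1, 0)) z.2 :=
    (HasFDerivAt.comp_hasDerivAt (f := fun s => (z.1, s)) z.2 h2 hsnd).clm_apply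
      (hasDerivAt_const z.2 ((1 : ℂ), (0 : ℂ))) |>.congr_deriv (by simp)
  have h4 : HasDerivAt (fun t => fderiv ℂ G (t, z.2) (0, 1))
      (fderiv ℂ (fderiv ℂ G) z (1, 0) (0, 1)) z.1 :=
    (HasFDerivAt.comp_hasDerivAt (f := fun t => (t, z.2)) z.1 h2 hfst).clm_apply
      (hasDerivAt_const z.1 ((0 : ℂ), (1 : ℂ))) |>.congr_deriv (by simp)
  have h5 : HasDerivAt (fun s => fderiv ℂ G (z.1, s) (1, 0)) c z.2 := by
    refine hc.congr_of_eventuallyEq ?_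
    have : ∀ᶠ s in nhds z.2, (z.1, s) ∈ U :=
      (Continuous.prodMk_right z.1).continuousAt.eventually_mem (hU.mem_nhds hz)
    filter_upwards [this] with s hs using hev _ hs
  rw [h5.unique h3, ← hsymm]
  exact h4

namespace RatXY

open Polynomial

/-- Parametric integration commutes with `∂_h`. -/
lemma iteratedDeriv_parametric {f : RatXY} {I : ℂ → ℂ → ℂ} {A B : Set ℂ} (hA : IsOpen A)
    (hB : IsOpen B) (hI : AnalyticOnNhd ℂ (fun z : ℂ × ℂ => I z.1 z.2) (A ×ˢ B))
    (hf : ∀ a ∈ A, ∀ h ∈ B, RegularAt f a (log a + h) ∧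
      HasDerivAt (fun t => I t h) (eval f a (log a + h)) a) (i : ℕ) :
    AnalyticOnNhd ℂ (fun z : ℂ × ℂ => iteratedDeriv i (fun s => I z.1 s) z.2) (A ×ˢ B) ∧
    ∀ a ∈ A, ∀ h ∈ B, RegularAt (dY^[i] f) a (log a + h) ∧
      HasDerivAt (fun t => iteratedDeriv i (fun s => I t s) h)
        (eval (dY^[i] f) a (log a + h)) a := by
  have hU := hA.prod hB
  induction i with
  | zero => simpa using ⟨hI, hf⟩
  | succ i ih =>
    obtain ⟨h1, h2⟩ := ih
    have e : ∀ z ∈ A ×ˢ B, iteratedDeriv (i + 1) (fun s => I z.1 s) z.2 =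
        fderiv ℂ (fun z : ℂ × ℂ => iteratedDeriv i (fun s => I z.1 s) z.2) z (0, 1) := by
      intro z hz
      rw [iteratedDeriv_succ]
      exact (((h1 z hz).differentiableAt.hasFDerivAt (x := (z.1, z.2))).comp_hasDerivAt z.2
        ((hasDerivAt_const z.2 z.1).prodMk (hasDerivAt_id' z.2))).deriv
    refine ⟨?_, fun a ha h hh => ?_⟩
    · refine AnalyticOnNhd.congr hU ?_ fun z hz => (e z hz).symm
      exact fun z hz => (ContinuousLinearMap.analyticAt
        (ContinuousLinearMap.apply ℂ ℂ ((0 : ℂ), (1 : ℂ))) _).comp (h1 z hz).fderiv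
    · have h3 := hasDerivAt_eval_snd (h2 a ha h hh).1
      rw [Function.iterate_succ_apply']
      refine ⟨h3.1, ?_⟩
      have hc : HasDerivAt (fun s => eval (dY^[i] f) a (log a + s))
          (eval (dY (dY^[i] f)) a (log a + h)) h := by
        have := h3.2.comp_const_add (log a) h
        exact this
      refine (hasDerivAt_fderiv_snd (φ := fun z => eval (dY^[i] f) z.1 (log z.1 + z.2)) hU h1
        (fun z hz => (h2 z.1 hz.1 z.2 hz.2).2) (z := (a, h)) ⟨ha, hh⟩ hc).congr_of_eventuallyEq ?_
      filter_upwards [hA.mem_nhds ha] with t ht using e (t, h) ⟨ht, hh⟩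

lemma aeval_dY_apply (L : Polynomial ℂ) (f : RatXY) :
    aeval (R := ℂ) (A := Module.End ℂ RatXY) dY.toLinearMap L f =
      ∑ i ∈ Finset.range (L.natDegree + 1), const (L.coeff i) * dY^[i] f := by
  rw [aeval_eq_sum_range, LinearMap.sum_apply]
  refine Finset.sum_congr rfl fun i _ => ?_
  rw [LinearMap.smul_apply, Module.End.pow_apply, Algebra.smul_def]
  rfl

/-- An analytic telescoper gives an algebraic one. -/
theorem AdmitsTelescoper.exists_aeval_eq {f : RatXY} (hf : AdmitsTelescoper f) :
    ∃ (L : Polynomial ℂ) (R : RatXY), L ≠ 0 ∧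
      aeval (R := ℂ) (A := Module.End ℂ RatXY) dY.toLinearMap L f = D R := by
  obtain ⟨L, R, I, x₀, h₀, ρ, hL, hρ, hI, h⟩ := hf
  refine ⟨L, R, hL, sub_eq_zero.1 (eq_zero_of_eval_log_add hρ (x₀ := x₀) (h₀ := h₀) ?_)⟩
  intro a ha s hs
  have hp := iteratedDeriv_parametric Metric.isOpen_ball Metric.isOpen_ball hI
    (fun a ha h' hh => ⟨(h a ha h' hh).2.1, (h a ha h' hh).2.2.2.1⟩)
  have hterm : ∀ i, RegularAt (const (L.coeff i) * dY^[i] f) a (log a + s) ∧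
      eval (const (L.coeff i) * dY^[i] f) a (log a + s) =
        L.coeff i * eval (dY^[i] f) a (log a + s) := fun i => by
    have := (regularAt_const (L.coeff i) a (log a + s)).1.mul ((hp i).2 a ha s hs).1
    rwa [(regularAt_const (L.coeff i) a (log a + s)).2] at this
  have hsum := RegularAt.finset_sum (Finset.range (L.natDegree + 1)) (fun i _ => (hterm i).1)
  have hD := hasDerivAt_eval_log (h a ha s hs).1 (h a ha s hs).2.2.1
  rw [aeval_dY_apply]
  have hsub := hsum.1.sub hD.1
  refine ⟨hsub.1, ?_⟩
  rw [hsub.2, hsum.2, sub_eq_zero]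
  -- The relation L I = R is differentiated in x at fixed h: the left side gives L(∂_y) f and the
  -- right side D R, at points that suffice to identify rational functions.
  have h1 : HasDerivAt (fun t => ∑ i ∈ Finset.range (L.natDegree + 1),
      L.coeff i * iteratedDeriv i (fun s => I t s) s)
      (∑ i ∈ Finset.range (L.natDegree + 1), L.coeff i * eval (dY^[i] f) a (log a + s)) a :=
    HasDerivAt.fun_sum fun i _ => ((hp i).2 a ha s hs).2.const_mul _
  rw [Finset.sum_congr rfl fun i _ => (hterm i).2]
  refine h1.unique (hD.2.congr_of_eventuallyEq ?_)
  filter_upwards [Metric.isOpen_ball.mem_nhds ha] with t ht using (h t ht s hs).2.2.2.2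

end RatXY

/-! ### Derivatives of polylogarithms and of the exponential integral. -/

open MeasureTheory Filter Topology in
/-- The radial primitive of a holomorphic function on a star-shaped open set. -/
lemma hasDerivAt_radial_integral {Ω : Set ℂ} (hΩ : IsOpen Ω) (hstar : StarConvex ℝ 0 Ω)
    {q : ℂ → ℂ} (hq : DifferentiableOn ℂ q Ω) {z : ℂ} (hz : z ∈ Ω) :
    HasDerivAt (fun w => ∫ t in (0 : ℝ)..1, w * q ((t : ℂ) * w)) (q z) z := by
  obtain ⟨r, hr, hball⟩ := Metric.nhds_basis_closedBall.mem_iff.1 (hΩ.mem_nhds hz)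
  have hmem : ∀ t ∈ Set.Icc (0 : ℝ) 1, ∀ w ∈ Ω, (t : ℂ) * w ∈ Ω := fun t ht w hw => by
    have := hstar.smul_mem hw ht.1 ht.2
    rwa [Complex.real_smul] at this
  have hsub : Set.uIoc (0 : ℝ) 1 ⊆ Set.Icc 0 1 := by
    rw [Set.uIoc_of_le zero_le_one]; exact Set.Ioc_subset_Icc_self
  have hq' : DifferentiableOn ℂ (deriv q) Ω := hq.deriv hΩ
  set F' : ℂ → ℝ → ℂ := fun w t => q (t * w) + w * (deriv q (t * w) * t) with hF'
  have hmaps : Set.MapsTo (fun p : ℝ × ℂ => (p.1 : ℂ) * p.2) (Set.Icc 0 1 ×ˢ Ω) Ω :=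
    fun p hp => hmem p.1 hp.1 p.2 hp.2
  have hcont : ContinuousOn (fun p : ℝ × ℂ => F' p.2 p.1) (Set.Icc 0 1 ×ˢ Ω) := by
    have hm : ContinuousOn (fun p : ℝ × ℂ => (p.1 : ℂ) * p.2) (Set.Icc 0 1 ×ˢ Ω) := by fun_prop
    have h1 := hq.continuousOn.comp hm hmaps
    have h2 := hq'.continuousOn.comp hm hmaps
    exact h1.add (continuousOn_snd.mul (h2.mul (by fun_prop)))
  have hcontF : ∀ w ∈ Ω, ContinuousOn (fun t : ℝ => w * q (t * w)) (Set.Icc 0 1) := fun w hw =>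
    continuousOn_const.mul (hq.continuousOn.comp (by fun_prop) fun t ht => hmem t ht w hw)
  have hcontF' : ContinuousOn (F' z) (Set.Icc 0 1) :=
    hcont.comp (f := fun t : ℝ => (t, z)) (by fun_prop) fun t ht => ⟨ht, hz⟩
  obtain ⟨C, hC⟩ := (isCompact_Icc.prod (isCompact_closedBall z r)).exists_bound_of_continuousOn
    (hcont.mono (Set.prod_mono subset_rfl hball))
  have hd : ∀ w ∈ Ω, DifferentiableAt ℂ q w := fun w hw => hq.differentiableAt (hΩ.mem_nhds hw)
  have key := intervalIntegral.hasDerivAt_integral_of_dominated_loc_of_deriv_le (μ := volume)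
    (F := fun w t => w * q (t * w)) (F' := F') (bound := fun _ => C)
    (a := 0) (b := 1) (Metric.closedBall_mem_nhds z hr)
    (by
      filter_upwards [Metric.closedBall_mem_nhds z hr] with w hw
      exact ((hcontF w (hball hw)).mono hsub).aestronglyMeasurable measurableSet_uIoc)
    (by
      refine ContinuousOn.intervalIntegrable ?_
      rw [Set.uIcc_of_le zero_le_one]
      exact hcontF z hz)
    ((hcontF'.mono hsub).aestronglyMeasurable measurableSet_uIoc)
    (ae_of_all _ fun t ht w hw => hC (t, w) ⟨hsub ht, hw⟩)
    intervalIntegrable_const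
    (ae_of_all _ fun t ht w hw => by
      have h1 := (hd _ (hmem t (hsub ht) w (hball hw))).hasDerivAt.comp w
        ((hasDerivAt_id' w).const_mul (t : ℂ))
      exact ((hasDerivAt_id' w).mul h1).congr_deriv (by simp [hF']))
  refine key.2.congr_deriv ?_
  have hintg : IntervalIntegrable (F' z) volume 0 1 := key.1
  -- The w-derivative of w q(t w) is also the t-derivative of t q(t w), so the differentiated
  -- integral telescopes to q(z).
  have h2 : ∀ t ∈ Set.uIcc (0 : ℝ) 1, HasDerivAt (fun t : ℝ => (t : ℂ) * q (t * z)) (F' z t) t := by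
    intro t ht
    rw [Set.uIcc_of_le zero_le_one] at ht
    have h0 : HasDerivAt (fun t : ℝ => (t : ℂ)) 1 t := Complex.ofRealCLM.hasDerivAt
    have h1 := (hd _ (hmem t ht z hz)).hasDerivAt.comp t (h0.mul_const z)
    exact (h0.mul h1).congr_deriv (by simp [hF']; ring)
  rw [intervalIntegral.integral_eq_sub_of_hasDerivAt h2 hintg]
  simp

/-- The domain of the principal branches of the polylogarithms. -/
def polyLogDomain : Set ℂ := {z | 1 - z ∈ slitPlane}

lemma isOpen_polyLogDomain : IsOpen polyLogDomain :=
  isOpen_slitPlane.preimage (continuous_const.sub continuous_id)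

lemma zero_mem_polyLogDomain : (0 : ℂ) ∈ polyLogDomain := by simp [polyLogDomain]

lemma starConvex_polyLogDomain : StarConvex ℝ 0 polyLogDomain := by
  rw [starConvex_iff_forall_pos zero_mem_polyLogDomain]
  intro z hz a b ha hb hab
  have h := starConvex_one_slitPlane hz ha.le hb.le hab
  have e : 1 - (a • (0 : ℂ) + b • z) = a • (1 : ℂ) + b • (1 - z) := by
    have : (a : ℂ) + b = 1 := by exact_mod_cast hab
    simp only [Complex.real_smul]
    linear_combination -this
  change 1 - (a • (0 : ℂ) + b • z) ∈ slitPlane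
  rwa [e]

lemma polyLog_zero_right (p : ℕ) : polyLog p 0 = 0 := by
  induction p with
  | zero => simp [polyLog]
  | succ p ih => simp [polyLog, ih]

/-- As Li_p vanishes at 0, the slope removes the singularity at t = 0, and the integral becomes the
radial primitive of a holomorphic function. -/
lemma polyLog_succ_eq (p : ℕ) (z : ℂ) :
    polyLog (p + 1) z = ∫ t in (0 : ℝ)..1, z * dslope (polyLog p) 0 ((t : ℂ) * z) := by
  rw [polyLog]
  refine intervalIntegral.integral_congr_ae (MeasureTheory.ae_of_all _ fun t ht => ?_)
  rw [Set.uIoc_of_le zero_le_one] at ht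
  have ht0 : (t : ℂ) ≠ 0 := by exact_mod_cast ht.1.ne'
  rcases eq_or_ne z 0 with rfl | hz
  · simp [polyLog_zero_right]
  · rw [dslope_of_ne _ (mul_ne_zero ht0 hz), slope_def_field, polyLog_zero_right]
    field_simp
    simp only [sub_zero]
    ring

lemma differentiableOn_polyLog (p : ℕ) : DifferentiableOn ℂ (polyLog p) polyLogDomain := by
  induction p with
  | zero =>
    have : DifferentiableOn ℂ (fun z : ℂ => z / (1 - z)) polyLogDomain :=
      differentiableOn_id.div (by fun_prop) fun z hz => slitPlane_ne_zero hz
    exact this.congr fun z _ => by simp [polyLog]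
  | succ p ih =>
    have h := (differentiableOn_dslope
      (isOpen_polyLogDomain.mem_nhds zero_mem_polyLogDomain)).2 ih
    intro z hz
    refine DifferentiableAt.differentiableWithinAt ?_
    rw [show polyLog (p + 1) = _ from funext (polyLog_succ_eq p)]
    exact (hasDerivAt_radial_integral isOpen_polyLogDomain
      starConvex_polyLogDomain h hz).differentiableAt

lemma hasDerivAt_polyLog_succ (p : ℕ) {z : ℂ} (hz : 1 - z ∈ slitPlane) (h0 : z ≠ 0) :
    HasDerivAt (polyLog (p + 1)) (polyLog p z / z) z := by
  have h := (differentiableOn_dslope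
    (isOpen_polyLogDomain.mem_nhds zero_mem_polyLogDomain)).2 (differentiableOn_polyLog p)
  rw [show polyLog (p + 1) = _ from funext (polyLog_succ_eq p)]
  refine (hasDerivAt_radial_integral isOpen_polyLogDomain starConvex_polyLogDomain h
    hz).congr_deriv ?_
  rw [dslope_of_ne _ h0, slope_def_field, polyLog_zero_right, sub_zero, sub_zero]

lemma hasDerivAt_expInt {z : ℂ} (hz : z ∈ slitPlane) : HasDerivAt expInt (exp z / z) z := by
  have hz0 := slitPlane_ne_zero hz
  set R : ℝ := ‖z‖ + 1
  have hexp : HasSum (fun n : ℕ => z ^ n / (n.factorial : ℂ)) (exp z) := by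
    rw [exp_eq_exp_ℂ]
    exact NormedSpace.expSeries_div_hasSum_exp z
  have h1 : HasDerivAt (fun z : ℂ => ∑' n : ℕ, z ^ (n + 1) / ((n + 1 : ℂ) * ((n + 1).factorial : ℂ)))
      (∑' n : ℕ, z ^ n / ((n + 1).factorial : ℂ)) z := by
    refine hasDerivAt_tsum_of_isPreconnected (u := fun n : ℕ => R ^ n / (n.factorial : ℝ))
      (t := Metric.ball 0 R) (y₀ := 0) (Real.summable_pow_div_factorial R) Metric.isOpen_ball
      (convex_ball 0 R).isPreconnected (g' := fun n y => y ^ n / ((n + 1).factorial : ℂ))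
      (fun n y _ => ?_) (fun n y hy => ?_) (by simp [R]; positivity) ?_ (by simp [R])
    · have := ((hasDerivAt_id' y).pow (n + 1)).div_const
        ((n + 1 : ℂ) * ((n + 1).factorial : ℂ))
      refine this.congr_deriv ?_
      have h2 : (n + 1 : ℂ) ≠ 0 := Nat.cast_add_one_ne_zero n
      have h3 : ((n + 1).factorial : ℂ) ≠ 0 := by exact_mod_cast (n + 1).factorial_ne_zero
      push_cast
      field_simp
    · rw [norm_div, norm_pow, Complex.norm_natCast]
      have hy' : ‖y‖ ≤ R := by simpa using (Metric.mem_ball.1 hy).le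
      have : (n.factorial : ℝ) ≤ ((n + 1).factorial : ℝ) := by
        exact_mod_cast Nat.factorial_le n.le_succ
      have hpos : (0 : ℝ) < n.factorial := by exact_mod_cast n.factorial_pos
      gcongr
    · simp [summable_zero]
  -- The missing constant term -1 is compensated by the derivative 1/z of the logarithm.
  have h2 : z * ∑' n : ℕ, z ^ n / ((n + 1).factorial : ℂ) = exp z - 1 := by
    have h3 := (hasSum_nat_add_iff' 1).2 hexp
    rw [← tsum_mul_left]
    simp only [Finset.range_one, Finset.sum_singleton, pow_zero, Nat.factorial_zero, Nat.cast_one,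
      div_one] at h3
    rw [← h3.tsum_eq]
    exact tsum_congr fun n => by rw [pow_succ]; ring
  refine (((hasDerivAt_const z _).add (Complex.hasDerivAt_log hz)).add h1).congr_deriv ?_
  field_simp
  linear_combination h2

/-! ### Linear independence of polylogarithms. -/

namespace RatXY

open Polynomial

/-- The rational part of the derivative of a polylogarithmic sum. -/
noncomputable def liSum (b : ℕ × ℕ × ℂ →₀ ℂ) : RatXY :=
  b.sum fun i c => if i.1 = 1 then const c * liTerm i.2.1 i.2.2 else 0

/-- The polynomial `1 - μ x`. -/
noncomputable def oneSubMulX (μ : ℂ) : Polynomial (Polynomial ℂ) := C (1 - C μ * X)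

lemma algebraMap_oneSubMulX (μ : ℂ) :
    algebraMap _ RatXY (oneSubMulX μ) = 1 - const μ * x := by
  simp only [oneSubMulX, const, x, polyX, map_sub, map_mul, map_one]

lemma prime_oneSubMulX {μ : ℂ} (hμ : μ ≠ 0) : Prime (oneSubMulX μ) := by
  refine Polynomial.prime_C_iff.2 (Irreducible.prime (irreducible_of_degree_eq_one ?_))
  rw [show (1 - C μ * X : Polynomial ℂ) = C (-μ) * X + C 1 by simp; ring]
  exact degree_linear (neg_ne_zero.2 hμ)

lemma oneSubMulX_dvd_C_iff {μ : ℂ} (p : Polynomial ℂ) :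
    oneSubMulX μ ∣ C p ↔ (1 - C μ * X) ∣ p := by
  rw [oneSubMulX]
  constructor
  · intro h
    have h1 := (C_dvd_iff_dvd_coeff (1 - C μ * X) (C p)).1 h 0
    rwa [coeff_C_zero] at h1
  · exact fun h => map_dvd (C : Polynomial ℂ →+* Polynomial (Polynomial ℂ)) h

lemma not_oneSubMulX_dvd_const {μ c : ℂ} (hμ : μ ≠ 0) (hc : c ≠ 0) :
    ¬ oneSubMulX μ ∣ C (C c) := by
  intro h
  refine (prime_oneSubMulX hμ).not_isUnit (isUnit_of_dvd_unit h ?_)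
  exact ((isUnit_iff_ne_zero.2 hc).map C).map C

lemma not_oneSubMulX_dvd_polyX {μ : ℂ} (hμ : μ ≠ 0) : ¬ oneSubMulX μ ∣ polyX := by
  intro h
  have h1 : oneSubMulX μ ∣ 1 - C (C μ) * polyX := ⟨1, by simp [oneSubMulX, polyX]⟩
  refine (prime_oneSubMulX hμ).not_isUnit (isUnit_of_dvd_one ?_)
  simpa using dvd_add h1 (h.mul_left (C (C μ)))

lemma not_oneSubMulX_dvd_oneSubMulX {μ ν : ℂ} (hμ : μ ≠ 0) (h : μ ≠ ν) :
    ¬ oneSubMulX μ ∣ oneSubMulX ν := by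
  intro hd
  refine not_oneSubMulX_dvd_const hμ (sub_ne_zero.2 h) ?_
  have := dvd_sub (hd.mul_left (C (C μ))) ((dvd_refl (oneSubMulX μ)).mul_left (C (C ν)))
  have e : C (C μ) * oneSubMulX ν - C (C ν) * oneSubMulX μ = C (C (μ - ν)) := by
    simp only [oneSubMulX, map_sub, map_mul, map_one]
    ring
  rwa [e] at this

lemma D_algebraMap_mem_regularAlong {P : Polynomial (Polynomial ℂ)} (hP : Prime P)
    (hx : ¬ P ∣ polyX) (r : Polynomial (Polynomial ℂ)) :
    D (algebraMap _ RatXY r) ∈ regularAlong RatXY hP := by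
  rw [D_apply, dX_algebraMap, dY_algebraMap]
  exact add_mem (algebraMap_mem_regularAlong hP _)
    (mul_mem (inv_mem_regularAlong hP hx) (algebraMap_mem_regularAlong hP _))

lemma liTerm_mem_regularAlong {P : Polynomial (Polynomial ℂ)} (hP : Prime P) (r : ℕ) {μ : ℂ}
    (h : ¬ P ∣ oneSubMulX μ) : liTerm r μ ∈ regularAlong RatXY hP := by
  rw [liTerm, div_eq_mul_inv, ← algebraMap_oneSubMulX]
  exact mul_mem (pow_mem (algebraMap_mem_regularAlong hP _) r)
    (mul_mem (algebraMap_mem_regularAlong hP _) (inv_mem_regularAlong hP h))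

/-- The functions `y ^ r / (1 - μ x)` are linearly independent modulo derivatives. -/
lemma eq_zero_of_D_eq_liSum {b : ℕ × ℕ × ℂ →₀ ℂ} (hb : ∀ i ∈ b.support, i.2.2 ≠ 0) {g : RatXY}
    (h : D g = liSum b) (r : ℕ) (μ : ℂ) : b (1, r, μ) = 0 := by
  classical
  by_contra hne
  have hμ : μ ≠ 0 := hb (1, r, μ) (Finsupp.mem_support_iff.2 hne)
  have hP := prime_oneSubMulX hμ
  have hx := not_oneSubMulX_dvd_polyX hμ
  have hD := D_algebraMap_mem_regularAlong hP hx
  have hP0 : algebraMap _ RatXY (oneSubMulX μ) ≠ 0 := algebraMap_ne_zero hP.ne_zero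
  -- T collects the terms with a pole along 1 - μx, and s below is their common numerator; all other
  -- terms are regular there.
  set T := b.support.filter fun i => i.1 = 1 ∧ i.2.2 = μ with hT
  set s : Polynomial (Polynomial ℂ) := ∑ i ∈ T, monomial i.2.1 (C (b i * μ)) with hs
  have hterm : ∀ (c : ℂ) (n : ℕ), const c * liTerm n μ =
      algebraMap _ RatXY (monomial n (C (c * μ))) / algebraMap _ RatXY (oneSubMulX μ) := by
    intro c n
    rw [liTerm, ← algebraMap_oneSubMulX, ← C_mul_X_pow_eq_monomial, map_mul, map_pow, C_mul,
      C_mul, map_mul]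
    simp only [const, y]
    ring
  have hsplit : liSum b - algebraMap _ RatXY s / algebraMap _ RatXY (oneSubMulX μ) ∈
      regularAlong RatXY hP := by
    have e : liSum b - algebraMap _ RatXY s / algebraMap _ RatXY (oneSubMulX μ) =
        ∑ i ∈ b.support.filter (fun i => ¬ (i.1 = 1 ∧ i.2.2 = μ)),
          if i.1 = 1 then const (b i) * liTerm i.2.1 i.2.2 else 0 := by
      rw [liSum, Finsupp.sum, ← Finset.sum_filter_add_sum_filter_not b.support
        (fun i => i.1 = 1 ∧ i.2.2 = μ), add_sub_assoc, add_comm, sub_add_eq_add_sub, sub_eq_iff_eq_add]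
      congr 1
      rw [hs, map_sum, Finset.sum_div]
      refine Finset.sum_congr rfl fun i hi => ?_
      obtain ⟨-, h1, h2⟩ := Finset.mem_filter.1 hi
      rw [if_pos h1, h2, hterm]
    rw [e]
    refine sum_mem fun i hi => ?_
    obtain ⟨-, h1⟩ := Finset.mem_filter.1 hi
    split_ifs with h2
    · exact mul_mem (algebraMap_mem_regularAlong hP _) (liTerm_mem_regularAlong hP _
        (not_oneSubMulX_dvd_oneSubMulX hμ fun h3 => h1 ⟨h2, h3.symm⟩))
    · exact zero_mem _
  have hDP : D (algebraMap _ RatXY (oneSubMulX μ)) = algebraMap _ RatXY (C (C (-μ))) := by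
    rw [algebraMap_oneSubMulX, map_sub, D.leibniz, D_x, D_const, D.map_one_eq_zero]
    simp [const]
  -- The right side has at most a simple pole, so g has none. Hence 1 - μx divides s and each of its
  -- coefficients, which are constants.
  have hg : g ∈ regularAlong RatXY hP := by
    refine mem_regularAlong_of_simple_pole hP D hD hDP
      (not_oneSubMulX_dvd_const hμ (neg_ne_zero.2 hμ)) (zero_mem _) ?_
    rw [zero_mul, add_zero, h]
    have h1 := add_mem (mul_mem (algebraMap_mem_regularAlong hP (oneSubMulX μ)) hsplit)
      (algebraMap_mem_regularAlong (K := RatXY) hP s)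
    rwa [mul_sub, mul_div_cancel₀ _ hP0, sub_add_cancel] at h1
  have hsd : oneSubMulX μ ∣ s := by
    refine dvd_of_div_mem_regularAlong (K := RatXY) hP ?_
    have h1 := sub_mem (derivation_mem_regularAlong hP D hD hg) hsplit
    rwa [h, sub_sub_cancel] at h1
  have hcoeff : s.coeff r = C (b (1, r, μ) * μ) := by
    rw [hs, finsetSum_coeff, Finset.sum_eq_single (1, r, μ)]
    · simp
    · rintro ⟨p, r', ν⟩ hi hne'
      obtain ⟨-, rfl, rfl⟩ := Finset.mem_filter.1 hi
      refine coeff_monomial_of_ne _ fun h1 => hne' ?_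
      simp only at h1
      rw [h1]
    · intro hi
      exact absurd (Finset.mem_filter.2 ⟨Finsupp.mem_support_iff.2 hne, rfl, rfl⟩) hi
  have h2 := Polynomial.C_dvd_iff_dvd_coeff _ _ |>.1 hsd r
  rw [hcoeff, ← oneSubMulX_dvd_C_iff] at h2
  exact not_oneSubMulX_dvd_const hμ (mul_ne_zero hne hμ) h2

/-- The polylogarithmic part of an expression. -/
noncomputable def polyLogSum (b : ℕ × ℕ × ℂ →₀ ℂ) (t : ℂ) : ℂ :=
  b.sum fun i c => c * (log t) ^ i.2.1 * polyLog i.1 (i.2.2 * t)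

/-- The terms `y ^ r Li_p(μ x)`, `p ≥ 1`, in the derivative of `c y ^ r Li_p(μ x)`. -/
noncomputable def lowerTerm (i : ℕ × ℕ × ℂ) (c : ℂ) : ℕ × ℕ × ℂ →₀ ℂ :=
  (if 1 ≤ i.1 then Finsupp.single (i.1, i.2.1 - 1, i.2.2) (i.2.1 * c) else 0) +
    if 2 ≤ i.1 then Finsupp.single (i.1 - 1, i.2.1, i.2.2) c else 0

lemma lowerTerm_zero (i : ℕ × ℕ × ℂ) : lowerTerm i 0 = 0 := by simp [lowerTerm]

lemma lowerTerm_add (i : ℕ × ℕ × ℂ) (c d : ℂ) :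
    lowerTerm i (c + d) = lowerTerm i c + lowerTerm i d := by
  unfold lowerTerm
  split_ifs <;> simp [mul_add, Finsupp.single_add]
  abel

/-- The coefficients of the terms `y ^ r Li_p(μ x)`, `p ≥ 1`, in `x` times the derivative. -/
noncomputable def lower (b : ℕ × ℕ × ℂ →₀ ℂ) : ℕ × ℕ × ℂ →₀ ℂ := b.sum lowerTerm

/-- The cancellation condition in `LogExpr.Formal` is therefore the vanishing of `lower`. -/
lemma lower_apply (b : ℕ × ℕ × ℂ →₀ ℂ) (p r : ℕ) (μ : ℂ) :
    lower b (p, r, μ) = if 1 ≤ p then (r + 1) * b (p, r + 1, μ) + b (p + 1, r, μ) else 0 := by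
  classical
  induction b using Finsupp.induction_linear with
  | zero => simp [lower]
  | add b c hb hc =>
    rw [lower, Finsupp.sum_add_index' lowerTerm_zero lowerTerm_add, Finsupp.add_apply]
    rw [lower] at hb hc
    rw [hb, hc]
    split_ifs <;> simp; ring
  | single i c =>
    obtain ⟨p', r', ν⟩ := i
    rw [lower, Finsupp.sum_single_index (lowerTerm_zero _), lowerTerm]
    have e1 : (if 1 ≤ p' then Finsupp.single (p', r' - 1, ν) ((r' : ℂ) * c) else 0) (p, r, μ) =
        if 1 ≤ p then (r + 1) * Finsupp.single (p', r', ν) c (p, r + 1, μ) else 0 := by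
      rcases r' with _ | r'
      · simp
      · by_cases h : p' = p ∧ r' = r ∧ ν = μ
        · obtain ⟨rfl, rfl, rfl⟩ := h
          split_ifs <;> simp
        · have h1 : ((p', r', ν) : ℕ × ℕ × ℂ) ≠ (p, r, μ) := by simpa using h
          have h2 : ((p', r' + 1, ν) : ℕ × ℕ × ℂ) ≠ (p, r + 1, μ) := by simpa using h
          split_ifs <;> simp [h1, h2]
    have e2 : (if 2 ≤ p' then Finsupp.single (p' - 1, r', ν) c else 0) (p, r, μ) =
        if 1 ≤ p then Finsupp.single (p', r', ν) c (p + 1, r, μ) else 0 := by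
      rcases p' with _ | p'
      · simp
      · by_cases h : p' = p ∧ r' = r ∧ ν = μ
        · obtain ⟨rfl, rfl, rfl⟩ := h
          simp [apply_ite (fun F : ℕ × ℕ × ℂ →₀ ℂ => F (p', r', ν))]
        · have h1 : ((p', r', ν) : ℕ × ℕ × ℂ) ≠ (p, r, μ) := by simpa using h
          have h2 : ((p' + 1, r', ν) : ℕ × ℕ × ℂ) ≠ (p + 1, r, μ) := by simpa using h
          split_ifs <;> simp [h1, h2]
    rw [Finsupp.add_apply, e1, e2]
    split_ifs <;> simp

lemma polyLogSum_lower (b : ℕ × ℕ × ℂ →₀ ℂ) (t : ℂ) :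
    polyLogSum (lower b) t = b.sum fun i c =>
      (if 1 ≤ i.1 then c * (i.2.1 * (log t) ^ (i.2.1 - 1)) * polyLog i.1 (i.2.2 * t) else 0) +
        if 2 ≤ i.1 then c * (log t) ^ i.2.1 * polyLog (i.1 - 1) (i.2.2 * t) else 0 := by
  have h0 : ∀ i : ℕ × ℕ × ℂ, (0 : ℂ) * (log t) ^ i.2.1 * polyLog i.1 (i.2.2 * t) = 0 := by simp
  have ha : ∀ (i : ℕ × ℕ × ℂ) (c d : ℂ), (c + d) * (log t) ^ i.2.1 * polyLog i.1 (i.2.2 * t) =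
      c * (log t) ^ i.2.1 * polyLog i.1 (i.2.2 * t) +
      d * (log t) ^ i.2.1 * polyLog i.1 (i.2.2 * t) := by intros; ring
  rw [polyLogSum, lower, Finsupp.sum_sum_index h0 ha]
  refine Finsupp.sum_congr fun i _ => ?_
  rw [lowerTerm, Finsupp.sum_add_index' h0 ha]
  congr 1
  · split_ifs
    · rw [Finsupp.sum_single_index (h0 _)]; ring
    · simp
  · split_ifs
    · rw [Finsupp.sum_single_index (h0 _)]
    · simp

lemma regularAt_liTerm {t s μ : ℂ} (r : ℕ) (h : 1 - μ * t ≠ 0) :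
    RegularAt (liTerm r μ) t s ∧ eval (liTerm r μ) t s = s ^ r * (μ / (1 - μ * t)) := by
  have h1 := (regularAt_const μ t s).1.mul (regularAt_x t s).1
  have h2 := (regularAt_const 1 t s).1.sub h1.1
  rw [h1.2, (regularAt_const 1 t s).2, (regularAt_const μ t s).2, (regularAt_x t s).2,
    const_one] at h2
  have h3 := (regularAt_const μ t s).1.div h2.1 (by rwa [h2.2])
  rw [h2.2, (regularAt_const μ t s).2] at h3
  have h4 := (regularAt_y t s).1.pow r
  have h5 := h4.1.mul h3.1
  rw [h4.2, h3.2, (regularAt_y t s).2] at h5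
  exact h5

lemma regularAt_const_mul {t s : ℂ} {g : RatXY} (c : ℂ) (h : RegularAt g t s) :
    RegularAt (const c * g) t s ∧ eval (const c * g) t s = c * eval g t s := by
  have h1 := (regularAt_const c t s).1.mul h
  rwa [(regularAt_const c t s).2] at h1

lemma regularAt_liSum {b : ℕ × ℕ × ℂ →₀ ℂ} {t s : ℂ}
    (h : ∀ i ∈ b.support, 1 - i.2.2 * t ≠ 0) :
    RegularAt (liSum b) t s ∧ eval (liSum b) t s =
      b.sum fun i c => if i.1 = 1 then c * (s ^ i.2.1 * (i.2.2 / (1 - i.2.2 * t))) else 0 := by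
  have h1 : ∀ i ∈ b.support,
      RegularAt (if i.1 = 1 then const (b i) * liTerm i.2.1 i.2.2 else 0) t s ∧
      eval (if i.1 = 1 then const (b i) * liTerm i.2.1 i.2.2 else 0) t s =
        if i.1 = 1 then b i * (s ^ i.2.1 * (i.2.2 / (1 - i.2.2 * t))) else 0 := by
    intro i hi
    split_ifs
    · have h2 := regularAt_liTerm (s := s) i.2.1 (h i hi)
      have h3 := regularAt_const_mul (b i) h2.1
      rwa [h2.2] at h3
    · simpa [const_zero] using regularAt_const 0 t s
  have h2 := RegularAt.finset_sum b.support fun i hi => (h1 i hi).1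
  refine ⟨h2.1, h2.2.trans (Finset.sum_congr rfl fun i hi => (h1 i hi).2)⟩

/-- Only Li_1 has a rational derivative; it supplies `liSum`. Everything else is again a
polylogarithmic sum, divided by t. -/
lemma hasDerivAt_polyLogSum {b : ℕ × ℕ × ℂ →₀ ℂ} {t : ℂ} (ht : t ∈ slitPlane)
    (hb : ∀ i ∈ b.support, 1 ≤ i.1 ∧ i.2.2 ≠ 0) (h : ∀ i ∈ b.support, 1 - i.2.2 * t ∈ slitPlane) :
    HasDerivAt (polyLogSum b) (polyLogSum (lower b) t / t + eval (liSum b) t (log t)) t := by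
  have ht0 := slitPlane_ne_zero ht
  rw [(regularAt_liSum fun i hi => slitPlane_ne_zero (h i hi)).2, polyLogSum_lower, Finsupp.sum,
    Finsupp.sum, Finset.sum_div, ← Finset.sum_add_distrib]
  refine HasDerivAt.fun_sum fun i hi => ?_
  obtain ⟨p, hp⟩ : ∃ p, i.1 = p + 1 := ⟨i.1 - 1, by have := (hb i hi).1; omega⟩
  have h1 := ((hasDerivAt_polyLog_succ p (h i hi)
    (mul_ne_zero (hb i hi).2 ht0)).comp t ((hasDerivAt_id' t).const_mul i.2.2))
  have h2 : HasDerivAt (fun y => b i * log y ^ i.2.1 * polyLog (p + 1) (i.2.2 * y)) _ t := (((Complex.hasDerivAt_log ht).pow i.2.1).const_mul (b i)).mul h1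
  simp only [hp]
  refine h2.congr_deriv ?_
  have hμ := (hb i hi).2
  have h1μ := slitPlane_ne_zero (h i hi)
  rcases p with _ | p
  · have h0 : polyLog 0 (i.2.2 * t) = i.2.2 * t / (1 - i.2.2 * t) := by rw [polyLog]
    rw [h0]
    generalize polyLog (0 + 1) (i.2.2 * t) = A
    simp
    field_simp
  · simp
    field_simp

/-- Polylogarithms, times powers of the logarithm, are linearly independent over the rational
functions of `x` and `ln x`. -/
lemma eq_zero_of_polyLogSum_eq {U : Set ℂ} (hU : IsOpen U) (hne : U.Nonempty)
    (hs : U ⊆ slitPlane) {M : Set ℂ} (hM : ∀ μ ∈ M, μ ≠ 0 ∧ ∀ t ∈ U, 1 - μ * t ∈ slitPlane)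
    (N : ℕ) {b : ℕ × ℕ × ℂ →₀ ℂ} (hb : ∀ i ∈ b.support, 1 ≤ i.1 ∧ i.2.2 ∈ M ∧ i.1 + i.2.1 ≤ N)
    {g : RatXY} (h : ∀ t ∈ U, RegularAt g t (log t) ∧ polyLogSum b t = eval g t (log t)) :
    b = 0 := by
  -- Differentiation lowers p + r, so the induction is on a bound N for it. The set M keeps U and
  -- the admissible arguments fixed.
  induction N generalizing b g with
  | zero =>
    ext i
    by_contra hi
    have := hb i (Finsupp.mem_support_iff.2 hi)
    omega
  | succ N ih =>
    have hlow : ∀ i ∈ (lower b).support, 1 ≤ i.1 ∧ i.2.2 ∈ M ∧ i.1 + i.2.1 ≤ N := by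
      rintro ⟨p, r, μ⟩ hi
      rw [Finsupp.mem_support_iff, lower_apply] at hi
      split_ifs at hi with hp
      · rcases eq_or_ne (b (p, r + 1, μ)) 0 with h0 | h0
        · rw [h0, mul_zero, zero_add] at hi
          obtain ⟨-, h2, h3⟩ := hb _ (Finsupp.mem_support_iff.2 hi)
          exact ⟨hp, h2, by simp only at h3 ⊢; omega⟩
        · obtain ⟨-, h2, h3⟩ := hb _ (Finsupp.mem_support_iff.2 h0)
          exact ⟨hp, h2, by simp only at h3 ⊢; omega⟩
      · exact absurd rfl hi
    have hreg : ∀ t ∈ U, RegularAt (D g - liSum b) t (log t) ∧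
        polyLogSum (lower b) t / t = eval (D g - liSum b) t (log t) := by
      intro t ht
      have h1 := hasDerivAt_polyLogSum (hs ht) (fun i hi => ⟨(hb i hi).1, (hM _ (hb i hi).2.1).1⟩)
        fun i hi => (hM _ (hb i hi).2.1).2 t ht
      have h2 := hasDerivAt_eval_log (h := 0) (hs ht) (by rw [add_zero]; exact (h t ht).1)
      simp only [add_zero] at h2
      have h3 := regularAt_liSum (b := b) (t := t) (s := log t)
        fun i hi => slitPlane_ne_zero ((hM _ (hb i hi).2.1).2 t ht)
      have h4 := h2.1.sub h3.1
      refine ⟨h4.1, ?_⟩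
      rw [h4.2, eq_sub_iff_add_eq]
      refine h1.unique (h2.2.congr_of_eventuallyEq ?_)
      filter_upwards [hU.mem_nhds ht] with w hw using (h w hw).2
    have hlow0 : lower b = 0 := by
      refine ih hlow (g := x * (D g - liSum b)) fun t ht => ?_
      have h1 := (regularAt_x t (log t)).1.mul (hreg t ht).1
      refine ⟨h1.1, ?_⟩
      rw [h1.2, (regularAt_x t (log t)).2, ← (hreg t ht).2,
        mul_div_cancel₀ _ (slitPlane_ne_zero (hs ht))]
    have hD : D g = liSum b := by
      refine sub_eq_zero.1 (eq_zero_of_eval_log hU hne hs fun t ht => ⟨(hreg t ht).1, ?_⟩)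
      rw [← (hreg t ht).2, hlow0]
      simp [polyLogSum]
    have h1 := eq_zero_of_D_eq_liSum (fun i hi => (hM _ (hb i hi).2.1).1) hD
    -- The coefficients of Li_1 vanish by residues; the recursion expressed by `lower b = 0` carries
    -- this to all higher p.
    have h2 : ∀ p r μ, b (p + 1, r, μ) = 0 := by
      intro p
      induction p with
      | zero => exact h1
      | succ p ihp =>
        intro r μ
        have h3 := lower_apply b (p + 1) r μ
        rw [hlow0, if_pos (by omega), ihp] at h3
        simpa using h3.symm
    ext ⟨p, r, μ⟩
    rcases p with _ | p
    · by_contra h0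
      have := (hb _ (Finsupp.mem_support_iff.2 h0)).1
      simp at this
    · exact h2 p r μ

end RatXY

/-! ### Analytic and formal integrals. -/

namespace RatXY

lemma hasDerivAt_eval_log' {f : RatXY} {t : ℂ} (ht : t ∈ slitPlane)
    (hf : RegularAt f t (log t)) : RegularAt (D f) t (log t) ∧
      HasDerivAt (fun t => eval f t (log t)) (eval (D f) t (log t)) t := by
  have := hasDerivAt_eval_log (h := 0) ht (by rwa [add_zero])
  simpa only [add_zero] using this

lemma regularAt_eiTerm {t s : ℂ} (ht : t ≠ 0) {p : ℤ} {μ : ℂ} (h : p * s + μ ≠ 0) :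
    RegularAt (eiTerm p μ) t s ∧
      eval (eiTerm p μ) t s = p * exp μ * t ^ (p - 1) / (p * s + μ) := by
  have hy := regularAt_const_mul (p : ℂ) (regularAt_y t s).1
  have h1 := hy.1.add (regularAt_const μ t s).1
  rw [hy.2, (regularAt_y t s).2, (regularAt_const μ t s).2] at h1
  have h2 := (regularAt_x t s).1.zpow (by rwa [(regularAt_x t s).2]) (p - 1)
  rw [(regularAt_x t s).2] at h2
  have h3 := regularAt_const_mul (p * exp μ) h2.1
  have h4 := h3.1.div h1.1 (by rwa [h1.2])
  rw [h1.2, h3.2, h2.2, const_mul, const_intCast] at h4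
  exact h4

lemma eventually_regularAt {f : RatXY} {t : ℂ} (ht : t ∈ slitPlane)
    (hf : RegularAt f t (log t)) : ∀ᶠ s in nhds t, RegularAt f s (log s) :=
  (hasDerivAt_evalEval (den f) (hasDerivAt_id' t)
    (Complex.hasDerivAt_log ht)).continuousAt.eventually_ne hf

lemma num_ne_zero {f : RatXY} (hf : f ≠ 0) : num f ≠ 0 := by
  intro h
  have e := mul_den f
  rw [h, map_zero, mul_eq_zero] at e
  exact e.elim hf (algebraMap_ne_zero (den_ne_zero f))

lemma eval_ne_zero {f : RatXY} {a b : ℂ} (hf : RegularAt f a b) (h : (num f).evalEval a b ≠ 0) :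
    eval f a b ≠ 0 := div_ne_zero h hf

end RatXY

namespace LogExpr

open RatXY Filter Topology

/-- The rational part of the derivative of an expression. -/
noncomputable def formalDeriv (E : LogExpr) : RatXY :=
  D E.H + ∑ μ ∈ E.S, const μ * (D (E.K μ) / E.K μ) +
    (E.a.sum fun i c => const c * eiTerm i.1 i.2) + liSum E.b

lemma formal_iff {E : LogExpr} {f : RatXY} : E.Formal f ↔ f = E.formalDeriv ∧ lower E.b = 0 := by
  refine and_congr Iff.rfl ⟨fun h => ?_, fun h p r μ hp => ?_⟩
  · ext ⟨p, r, μ⟩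
    rw [lower_apply]
    split_ifs with hp
    · exact h p r μ hp
    · rfl
  · have := lower_apply E.b p r μ
    rw [h, if_pos hp] at this
    exact this.symm

lemma hasDerivAt_toFun {E : LogExpr} {t : ℂ} (h : E.RegularAt t) :
    RatXY.RegularAt E.formalDeriv t (log t) ∧
    HasDerivAt E.toFun (eval E.formalDeriv t (log t) + polyLogSum (lower E.b) t / t) t := by
  obtain ⟨ht, ha, hb, hK, hH⟩ := h
  have ht0 := slitPlane_ne_zero ht
  have hH' := hasDerivAt_eval_log' ht hH
  have hb' := hasDerivAt_polyLogSum ht E.b_index hb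
  have hbr := (regularAt_liSum (s := log t) fun i hi => slitPlane_ne_zero (hb i hi)).1
  have hK1 : ∀ μ ∈ E.S, RatXY.RegularAt (const μ * (D (E.K μ) / E.K μ)) t (log t) ∧
      HasDerivAt (fun t => μ * log (eval (E.K μ) t (log t)))
        (eval (const μ * (D (E.K μ) / E.K μ)) t (log t)) t := by
    intro μ hμ
    have h1 := hasDerivAt_eval_log' ht (hK μ hμ).1
    have h2 := h1.1.div (hK μ hμ).1 (slitPlane_ne_zero (hK μ hμ).2)
    have h3 := regularAt_const_mul μ h2.1
    rw [h3.2, h2.2]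
    exact ⟨h3.1, (h1.2.clog (hK μ hμ).2).const_mul μ⟩
  have ha1 : ∀ i ∈ E.a.support, RatXY.RegularAt (const (E.a i) * eiTerm i.1 i.2) t (log t) ∧
      HasDerivAt (fun t => E.a i * expInt ((i.1 : ℂ) * log t + i.2))
        (eval (const (E.a i) * eiTerm i.1 i.2) t (log t)) t := by
    intro i hi
    have h1 := regularAt_eiTerm ht0 (slitPlane_ne_zero (ha i hi))
    have h2 := regularAt_const_mul (E.a i) h1.1
    rw [h2.2, h1.2]
    refine ⟨h2.1, HasDerivAt.const_mul _ ?_⟩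
    refine ((hasDerivAt_expInt (ha i hi)).comp t
      (((Complex.hasDerivAt_log ht).const_mul (i.1 : ℂ)).add_const i.2)).congr_deriv ?_
    rw [exp_add, exp_int_mul, exp_log ht0, zpow_sub_one₀ ht0]
    ring
  have r1 := RegularAt.finset_sum E.S fun μ hμ => (hK1 μ hμ).1
  have r2 := RegularAt.finset_sum E.a.support fun i hi => (ha1 i hi).1
  have r3 := hH'.1.add r1.1
  have r4 := r3.1.add r2.1
  have r5 := r4.1.add hbr
  refine ⟨r5.1, ?_⟩
  have e : eval E.formalDeriv t (log t) = _ := r5.2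
  rw [e, r4.2, r3.2, r2.2, r1.2]
  refine ((((HasDerivAt.fun_sum fun i hi => (ha1 i hi).2).add hb').add
    (HasDerivAt.fun_sum fun μ hμ => (hK1 μ hμ).2)).add hH'.2).congr_deriv ?_
  ring

/-- An analytic integral is a formal one. -/
theorem IsIntegralOf.formal {E : LogExpr} {f : RatXY} (h : E.IsIntegralOf f) : E.Formal f := by
  obtain ⟨U, hU, hne, h⟩ := h
  have hs : U ⊆ slitPlane := fun t ht => (h t ht).1.1
  have hd := fun t ht => hasDerivAt_toFun (h t ht).1
  have hreg := fun t ht => (h t ht).2.1.sub (hd t ht).1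
  have hval : ∀ t ∈ U, polyLogSum (lower E.b) t / t = eval (f - E.formalDeriv) t (log t) := by
    intro t ht
    rw [(hreg t ht).2, (h t ht).2.2.unique (hd t ht).2]
    ring
  have hE : ∀ p r μ, E.b (p, r, μ) ≠ 0 → 1 ≤ p ∧
      μ ∈ {μ | μ ≠ 0 ∧ ∀ t ∈ U, 1 - μ * t ∈ slitPlane} ∧
      (p, r, μ) ∈ E.b.support := fun p r μ h0 =>
    have hi := Finsupp.mem_support_iff.2 h0
    ⟨(E.b_index _ hi).1, ⟨(E.b_index _ hi).2, fun t ht => (h t ht).1.2.2.1 _ hi⟩, hi⟩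
  have hsup : ∀ i ∈ E.b.support, i.1 + i.2.1 ≤ E.b.support.sup fun i => i.1 + i.2.1 := fun i hi =>
    Finset.le_sup (f := fun i : ℕ × ℕ × ℂ => i.1 + i.2.1) hi
  -- The polylogarithms left over in the derivative, divided by t, equal a rational function of t
  -- and ln t, so independence applies.
  have hlow : lower E.b = 0 := by
    refine eq_zero_of_polyLogSum_eq hU hne hs
      (M := {μ | μ ≠ 0 ∧ ∀ t ∈ U, 1 - μ * t ∈ slitPlane}) (fun μ hμ => hμ)
      (E.b.support.sup fun i => i.1 + i.2.1) ?_ (g := x * (f - E.formalDeriv)) fun t ht => ?_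
    · rintro ⟨p, r, μ⟩ hi
      rw [Finsupp.mem_support_iff, lower_apply] at hi
      split_ifs at hi with hp
      · rcases eq_or_ne (E.b (p, r + 1, μ)) 0 with h0 | h0
        · rw [h0, mul_zero, zero_add] at hi
          obtain ⟨-, h1, h2⟩ := hE _ _ _ hi
          have := hsup _ h2
          exact ⟨hp, h1, by simp only at this ⊢; omega⟩
        · obtain ⟨-, h1, h2⟩ := hE _ _ _ h0
          have := hsup _ h2
          exact ⟨hp, h1, by simp only at this ⊢; omega⟩
      · exact absurd rfl hi
    · have h1 := (regularAt_x t (log t)).1.mul (hreg t ht).1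
      refine ⟨h1.1, ?_⟩
      rw [h1.2, (regularAt_x t (log t)).2, ← hval t ht,
        mul_div_cancel₀ _ (slitPlane_ne_zero (hs ht))]
  refine formal_iff.2 ⟨sub_eq_zero.1 (eq_zero_of_eval_log hU hne hs fun t ht =>
    ⟨(hreg t ht).1, ?_⟩), hlow⟩
  rw [← hval t ht, hlow]
  simp [polyLogSum]

lemma eventually_regularAt {E : LogExpr} {t : ℂ} (h : E.RegularAt t) :
    ∀ᶠ s in 𝓝 t, E.RegularAt s := by
  obtain ⟨ht, ha, hb, hK, hH⟩ := h
  refine Eventually.and (isOpen_slitPlane.eventually_mem ht) (Eventually.and ?_ (Eventually.and ?_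
    (Eventually.and ?_ (RatXY.eventually_regularAt ht hH))))
  · refine (eventually_all_finset _).2 fun i hi => ?_
    have : ContinuousAt (fun s => (i.1 : ℂ) * log s + i.2) t :=
      (continuousAt_const.mul (continuousAt_clog ht)).add continuousAt_const
    exact this.eventually_mem (isOpen_slitPlane.mem_nhds (ha i hi))
  · refine (eventually_all_finset _).2 fun i hi => ?_
    have : ContinuousAt (fun s => 1 - i.2.2 * s) t := by fun_prop
    exact this.eventually_mem (isOpen_slitPlane.mem_nhds (hb i hi))
  · refine (eventually_all_finset _).2 fun μ hμ => ?_
    exact (RatXY.eventually_regularAt ht (hK μ hμ).1).and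
      ((hasDerivAt_eval_log' ht (hK μ hμ).1).2.continuousAt.eventually_mem
        (isOpen_slitPlane.mem_nhds (hK μ hμ).2))

/-- Take t = exp(u + iφ). All but finitely many angles φ put the arguments of Ei off the real axis,
and a very negative u makes every |μ t| < 1, away from the cuts of the polylogarithms. -/
lemma exists_generic (a : ℤ × ℂ →₀ ℂ) (b : ℕ × ℕ × ℂ →₀ ℂ) (ha : ∀ i ∈ a.support, i.1 ≠ 0) :
    ∃ t ∈ slitPlane, (∀ i ∈ a.support, (i.1 : ℂ) * log t + i.2 ∈ slitPlane) ∧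
      ∀ i ∈ b.support, 1 - i.2.2 * t ∈ slitPlane := by
  obtain ⟨φ, hφ, hφa⟩ : ∃ φ ∈ Set.Ioo (-Real.pi) Real.pi,
      φ ∉ a.support.image fun i => -i.2.im / (i.1 : ℝ) := by
    have := (Set.Ioo_infinite (show -Real.pi < Real.pi by linarith [Real.pi_pos]))
    exact this.exists_notMem_finset _
  obtain ⟨u, hu⟩ : ∃ u : ℝ, ∀ i ∈ b.support, ‖i.2.2‖ * Real.exp u < 1 := by
    refine Eventually.exists (f := atBot) ((eventually_all_finset _).2 fun i _ => ?_)
    have : Tendsto (fun u => ‖i.2.2‖ * Real.exp u) atBot (𝓝 (‖i.2.2‖ * 0)) :=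
      Real.tendsto_exp_atBot.const_mul _
    rw [mul_zero] at this
    exact this.eventually_lt_const one_pos
  have hlog : log (exp (u + φ * I)) = u + φ * I :=
    log_exp (by simpa using hφ.1) (by simpa using hφ.2.le)
  refine ⟨exp (u + φ * I), ?_, fun i hi => ?_, fun i hi => ?_⟩
  · rw [mem_slitPlane_iff_arg]
    refine ⟨?_, exp_ne_zero _⟩
    rw [← log_im, hlog]
    simpa using hφ.2.ne
  · rw [hlog]
    refine Or.inr fun h0 => hφa (Finset.mem_image.2 ⟨i, hi, ?_⟩)
    have hi0 : (i.1 : ℝ) ≠ 0 := by exact_mod_cast ha i hi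
    have h1 : (i.1 : ℝ) * φ + i.2.im = 0 := by simpa using h0
    rw [div_eq_iff hi0]
    linarith
  · refine Or.inl ?_
    have h1 : ‖i.2.2 * exp (u + φ * I)‖ < 1 := by
      rw [norm_mul, norm_exp]
      simpa using hu i hi
    have h2 := (abs_lt.1 ((abs_re_le_norm _).trans_lt h1)).2
    rw [sub_re, one_re]
    linarith

/-- A formal integral becomes an analytic one after rescaling the arguments of the logarithms. -/
theorem Formal.exists_isIntegralOf {E : LogExpr} {f : RatXY} (h : E.Formal f) :
    ∃ E' : LogExpr, E'.H = E.H ∧ E'.IsIntegralOf f := by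
  classical
  obtain ⟨hf, hlow⟩ := formal_iff.1 h
  obtain ⟨t₁, ht₁, ha₁, hb₁⟩ := exists_generic E.a E.b E.a_index
  have h0 : RatXY.RegularAt 0 t₁ (log t₁) := by
    simpa [const_zero] using (regularAt_const 0 t₁ (log t₁)).1
  have hev := eventually_regularAt (E := ⟨E.a, E.b, ∅, fun _ => 1, 0, E.a_index, E.b_index, by simp⟩)
    (t := t₁) ⟨ht₁, ha₁, hb₁, by simp, h0⟩
  obtain ⟨V, hV, hVo, hV₁⟩ := eventually_nhds_iff.1 hev
  obtain ⟨t, htV, ht⟩ := exists_evalEval_log_ne_zero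
    (p := den E.H * ∏ μ ∈ E.S, num (E.K μ) * den (E.K μ))
    (mul_ne_zero (den_ne_zero _) (Finset.prod_ne_zero_iff.2 fun μ hμ =>
      mul_ne_zero (num_ne_zero (E.K_ne_zero μ hμ)) (den_ne_zero _)))
    hVo ⟨t₁, hV₁⟩ fun t ht => (hV t ht).1
  obtain ⟨hts, ha, hb, -, -⟩ := hV t htV
  rw [Polynomial.evalEval_mul] at ht
  have hH : RatXY.RegularAt E.H t (log t) := left_ne_zero_of_mul ht
  have hK : ∀ μ ∈ E.S, RatXY.RegularAt (E.K μ) t (log t) ∧ eval (E.K μ) t (log t) ≠ 0 := by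
    intro μ hμ
    have h1 := right_ne_zero_of_mul ht
    obtain ⟨q, hq⟩ := Finset.dvd_prod_of_mem (fun μ => num (E.K μ) * den (E.K μ)) hμ
    rw [hq, Polynomial.evalEval_mul, Polynomial.evalEval_mul] at h1
    have h2 := left_ne_zero_of_mul h1
    exact ⟨right_ne_zero_of_mul h2, eval_ne_zero (right_ne_zero_of_mul h2)
      (left_ne_zero_of_mul h2)⟩
  -- Scaling each K_μ to take the value 1 at t moves it off the cut of the logarithm and leaves its
  -- logarithmic derivative unchanged.
  set E' : LogExpr := ⟨E.a, E.b, E.S, fun μ => const (eval (E.K μ) t (log t))⁻¹ * E.K μ, E.H,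
    E.a_index, E.b_index, fun μ hμ => mul_ne_zero (const_ne_zero (inv_ne_zero (hK μ hμ).2))
      (E.K_ne_zero μ hμ)⟩ with hE'
  have hreg : E'.RegularAt t := by
    refine ⟨hts, ha, hb, fun μ hμ => ?_, hH⟩
    have h1 := regularAt_const_mul (eval (E.K μ) t (log t))⁻¹ (hK μ hμ).1
    refine ⟨h1.1, ?_⟩
    change eval (const (eval (E.K μ) t (log t))⁻¹ * E.K μ) t (log t) ∈ slitPlane
    rw [h1.2, inv_mul_cancel₀ (hK μ hμ).2]
    exact one_mem_slitPlane
  have hf' : E'.formalDeriv = f := by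
    rw [hf, formalDeriv, formalDeriv]
    congr 3
    refine Finset.sum_congr rfl fun μ hμ => ?_
    have h1 := const_ne_zero (inv_ne_zero (hK μ hμ).2)
    have h2 := E.K_ne_zero μ hμ
    simp only [hE', D.leibniz, D_const, smul_eq_mul, mul_zero, add_zero]
    rw [mul_div_mul_left _ _ h1]
  obtain ⟨U, hU, hUo, htU⟩ := eventually_nhds_iff.1 (eventually_regularAt hreg)
  refine ⟨E', rfl, U, hUo, ⟨t, htU⟩, fun s hs => ?_⟩
  have h1 := hasDerivAt_toFun (hU s hs)
  rw [hf'] at h1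
  refine ⟨hU s hs, h1.1, h1.2.congr_deriv ?_⟩
  rw [show lower E'.b = 0 from hlow]
  simp [polyLogSum]

end LogExpr

/-! ### Poles of the rational part away from x = 0. -/

section LocalRing

variable {R K k : Type*} [CommRing R] [IsDomain R] [Field K] [Algebra R K] [IsFractionRing R K]
  [Field k] [Algebra k K] {P : R} (hP : Prime P)

/-- For a = P^n c with c prime to P, the logarithmic derivative is n D(P) / P plus the regular
element D(c) / c. -/
lemma mul_logDeriv_mem_regularAlong [WfDvdMonoid R] (D : Derivation k K K)
    (hD : ∀ r : R, D (algebraMap R K r) ∈ regularAlong K hP) {g : K} (hg : g ≠ 0) :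
    algebraMap R K P * (D g / g) ∈ regularAlong K hP := by
  have hP0 : algebraMap R K P ≠ 0 := by
    rw [Ne, IsFractionRing.to_map_eq_zero_iff]
    exact hP.ne_zero
  have key : ∀ a : R, algebraMap R K a ≠ 0 →
      algebraMap R K P * (D (algebraMap R K a) / algebraMap R K a) ∈ regularAlong K hP := by
    intro a ha
    have ha' : a ≠ 0 := by rintro rfl; simp at ha
    obtain ⟨n, c, hc, rfl⟩ := WfDvdMonoid.max_power_factor ha' hP.irreducible
    have hc0 : algebraMap R K c ≠ 0 := by rw [map_mul] at ha; exact right_ne_zero_of_mul ha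
    have e : algebraMap R K P * (D (algebraMap R K (P ^ n * c)) / algebraMap R K (P ^ n * c)) =
        n * D (algebraMap R K P) +
        algebraMap R K P * (D (algebraMap R K c) * (algebraMap R K c)⁻¹) := by
      rw [map_mul, map_pow, D.leibniz, D.leibniz_pow]
      simp only [smul_eq_mul, nsmul_eq_mul]
      rcases n with _ | n
      · simp [div_eq_mul_inv]
      · rw [Nat.add_sub_cancel, pow_succ]
        field_simp
        ring
    rw [e]
    exact add_mem (mul_mem (natCast_mem _ n) (hD P)) (mul_mem (algebraMap_mem_regularAlong hP P)
      (mul_mem (hD c) (inv_mem_regularAlong hP hc)))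
  obtain ⟨a, b, hb, rfl⟩ := IsFractionRing.div_surjective (A := R) g
  have hb0 : algebraMap R K b ≠ 0 := IsFractionRing.to_map_ne_zero_of_mem_nonZeroDivisors hb
  have ha0 : algebraMap R K a ≠ 0 := fun h => hg (by rw [h, zero_div])
  have e : algebraMap R K P * (D (algebraMap R K a / algebraMap R K b) /
      (algebraMap R K a / algebraMap R K b)) =
      algebraMap R K P * (D (algebraMap R K a) / algebraMap R K a) -
      algebraMap R K P * (D (algebraMap R K b) / algebraMap R K b) := by
    have h1 := D.leibniz (algebraMap R K a / algebraMap R K b) (algebraMap R K b)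
    rw [div_mul_cancel₀ _ hb0, smul_eq_mul, smul_eq_mul] at h1
    rw [h1]
    field_simp
    ring
  rw [e]
  exact sub_mem (key a ha0) (key b hb0)

lemma mul_inv_mem_regularAlong {q : R} (hq : Prime q) :
    algebraMap R K P * (algebraMap R K q)⁻¹ ∈ regularAlong K hP := by
  by_cases h : P ∣ q
  · obtain ⟨u, rfl⟩ := h
    have hu : IsUnit u := (hq.irreducible.isUnit_or_isUnit rfl).resolve_left hP.not_isUnit
    have hP0 : algebraMap R K P ≠ 0 := by
      rw [Ne, IsFractionRing.to_map_eq_zero_iff]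
      exact hP.ne_zero
    rw [map_mul, mul_inv_rev, mul_comm, mul_assoc, inv_mul_cancel₀ hP0, mul_one]
    exact inv_mem_regularAlong hP fun h => hP.not_isUnit (isUnit_of_dvd_unit h hu)
  · exact mul_mem (algebraMap_mem_regularAlong hP P) (inv_mem_regularAlong hP h)

end LocalRing

namespace RatXY

open Polynomial

lemma prime_polyX : Prime polyX := Polynomial.prime_C_iff.2 Polynomial.prime_X

/-- The dictionary between pole orders in the local ring and multiplicities in the reduced
denominator. -/
lemma pow_mul_mem_regularAlong_iff {P : Polynomial (Polynomial ℂ)} (hP : Prime P) (k : ℕ)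
    (g : RatXY) : algebraMap _ RatXY P ^ k * g ∈ regularAlong RatXY hP ↔ ¬ P ^ (k + 1) ∣ den g := by
  constructor
  · rintro ⟨a, b, hb, e⟩ hd
    have e1 : P ^ k * num g * b = a * den g := by
      apply IsFractionRing.injective (Polynomial (Polynomial ℂ)) RatXY
      rw [map_mul, map_mul, map_mul, map_pow, ← mul_den, ← e]
      ring
    have h1 : P ^ k * P ∣ P ^ k * (num g * b) := by
      rw [← pow_succ, ← mul_assoc, e1]
      exact hd.mul_left a
    have h2 := (hP.dvd_or_dvd ((mul_dvd_mul_iff_left (pow_ne_zero k hP.ne_zero)).1 h1)).resolve_right hb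
    exact hP.not_isUnit (isRelPrime_num_den g h2 ((dvd_pow_self P k.succ_ne_zero).trans hd))
  · intro h
    obtain ⟨n, c, hc, hn⟩ := WfDvdMonoid.max_power_factor (den_ne_zero g) hP.irreducible
    have hnk : n ≤ k := by
      by_contra hlt
      exact h (hn ▸ (pow_dvd_pow P (not_le.1 hlt)).mul_right c)
    have hP0 := algebraMap_ne_zero hP.ne_zero
    have hc0 : algebraMap _ RatXY c ≠ 0 := algebraMap_ne_zero (by rintro rfl; simp at hc)
    have e : algebraMap _ RatXY P ^ k * g =
        algebraMap _ RatXY P ^ (k - n) * algebraMap _ RatXY (num g) * (algebraMap _ RatXY c)⁻¹ := by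
      rw [← mul_den, hn, map_mul, map_pow]
      obtain ⟨j, rfl⟩ := Nat.exists_eq_add_of_le hnk
      rw [Nat.add_sub_cancel_left, pow_add]
      field_simp
    rw [e]
    exact mul_mem (mul_mem (pow_mem (algebraMap_mem_regularAlong hP P) _)
      (algebraMap_mem_regularAlong hP _)) (inv_mem_regularAlong hP hc)

/-- The derivation `x D = x ∂_x + ∂_y`. -/
noncomputable def xD : Derivation ℂ RatXY RatXY := x • D

lemma xD_apply (g : RatXY) : xD g = x * D g := rfl

/-- Multiplication by x makes the derivation preserve ℂ[x,y], as the pole-order lemmas require of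
the image of P. -/
lemma xD_algebraMap (p : Polynomial (Polynomial ℂ)) :
    xD (algebraMap _ RatXY p) = algebraMap _ RatXY (eulerSub 0 p) := by
  rw [xD_apply, D_apply, dX_algebraMap, dY_algebraMap, mul_add, mul_inv_cancel_left₀ x_ne_zero]
  simp [eulerSub, x, polyX]

lemma xD_algebraMap_mem_regularAlong {P : Polynomial (Polynomial ℂ)} (hP : Prime P)
    (p : Polynomial (Polynomial ℂ)) : xD (algebraMap _ RatXY p) ∈ regularAlong RatXY hP := by
  rw [xD_algebraMap]
  exact algebraMap_mem_regularAlong hP _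

lemma eulerSub_eq_sub (n : ℕ) (p : Polynomial (Polynomial ℂ)) :
    eulerSub n p = eulerSub 0 p - C (C (n : ℂ)) * p := by
  simp [eulerSub]

/-- The only irreducible eigenvector of `x ∂_x + ∂_y` is `x`. -/
lemma not_dvd_eulerSub {P : Polynomial (Polynomial ℂ)} (hP : Irreducible P)
    (hx : ¬ Associated P polyX) : ¬ P ∣ eulerSub 0 P := by
  rintro ⟨q, hq⟩
  have hP0 := hP.ne_zero
  have hl0 := leadingCoeff_ne_zero.2 hP0
  have hqC : q = C (q.coeff 0) := by
    refine eq_C_of_natDegree_eq_zero ?_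
    by_cases hq0 : q = 0
    · simp [hq0]
    · have := natDegree_eulerSub_le 0 P
      rw [hq, natDegree_mul hP0 hq0] at this
      omega
  -- Comparing leading coefficients in y; degrees in x then force the cofactor to be the constant n,
  -- the degree of the leading coefficient.
  have hl : X * derivative P.leadingCoeff = P.leadingCoeff * q.coeff 0 := by
    have h1 := coeff_eulerSub 0 P P.natDegree
    rw [hq, hqC, coeff_mul_C, coeff_eq_zero_of_natDegree_lt (n := P.natDegree + 1) (by omega)] at h1
    simp only [Nat.cast_zero, map_zero, zero_mul, add_zero, sub_zero] at h1
    exact h1.symm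
  obtain ⟨n, hn⟩ : ∃ n, P.leadingCoeff.natDegree = n := ⟨_, rfl⟩
  have hc : q.coeff 0 = C (n : ℂ) := by
    have hdeg : (q.coeff 0).natDegree = 0 := by
      by_cases hq0 : q.coeff 0 = 0
      · simp [hq0]
      · have h1 := congrArg natDegree hl
        rw [natDegree_mul hl0 hq0] at h1
        have h2 : (X * derivative P.leadingCoeff).natDegree ≤ P.leadingCoeff.natDegree := by
          refine natDegree_le_iff_coeff_eq_zero.2 fun m hm => ?_
          rcases m with _ | m
          · simp
          · rw [coeff_X_mul, coeff_derivative, coeff_eq_zero_of_natDegree_lt hm, zero_mul]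
        omega
    rw [eq_C_of_natDegree_eq_zero hdeg] at hl ⊢
    have h1 := congrArg (fun p => coeff p n) hl
    have h2 : (X * derivative P.leadingCoeff).coeff n = P.leadingCoeff.coeff n * n := by
      rcases n with _ | n
      · simp
      · rw [coeff_X_mul, coeff_derivative]; push_cast; ring
    simp only [h2, coeff_mul_C] at h1
    have h3 : P.leadingCoeff.coeff n ≠ 0 := by rw [← hn]; exact leadingCoeff_ne_zero.2 hl0
    rw [mul_left_cancel₀ h3 h1]
  -- With eigenvalue n the polynomial P lies in ℂ[x] and is a monomial c x^n, whose only prime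
  -- factor is x.
  have hz : eulerSub n P = 0 := by
    rw [eulerSub_eq_sub, hq, hqC, hc]; ring
  have hPC := eq_C_of_natDegree_eq_zero (natDegree_eq_zero_of_eulerSub_eq_zero hP0 hn hz)
  have hmon : P.coeff 0 = C ((P.coeff 0).coeff n) * X ^ n := by
    ext m
    have h1 := congrArg (fun p => coeff p m) (coeff_eulerSub n P 0)
    simp only [hz, coeff_zero] at h1
    rw [hPC] at h1
    have h2 : (X * derivative (P.coeff 0)).coeff m = (P.coeff 0).coeff m * m := by
      rcases m with _ | m
      · simp
      · rw [coeff_X_mul, coeff_derivative]; push_cast; ring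
    simp only [coeff_C_zero, coeff_sub, h2, coeff_C_mul, coeff_C_succ, zero_mul, add_zero] at h1
    rw [coeff_C_mul, coeff_X_pow]
    split_ifs with hmn
    · rw [hmn, mul_one]
    · rw [mul_zero]
      have h3 : (P.coeff 0).coeff m * ((m : ℂ) - n) = 0 := by linear_combination -h1
      refine (mul_eq_zero.1 h3).resolve_right (sub_ne_zero.2 ?_)
      exact_mod_cast hmn
  have hPe : P = C (C ((P.coeff 0).coeff n)) * polyX ^ n := by
    conv_lhs => rw [hPC, hmon]
    simp [polyX]
  have hc0 : (P.coeff 0).coeff n ≠ 0 := by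
    intro h0
    rw [h0] at hPe
    simp only [map_zero, zero_mul] at hPe
    exact hP0 hPe
  have hu : IsUnit (C (C ((P.coeff 0).coeff n)) : Polynomial (Polynomial ℂ)) :=
    ((isUnit_iff_ne_zero.2 hc0).map C).map C
  have hPp := hP.prime
  have hd : P ∣ C (C ((P.coeff 0).coeff n)) * polyX ^ n := hPe ▸ dvd_rfl
  rcases hPp.dvd_or_dvd hd with h | h
  · exact hP.not_isUnit (isUnit_of_dvd_unit h hu)
  · exact hx (hP.associated_of_dvd prime_polyX.irreducible (hPp.dvd_of_dvd_pow h))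

lemma prime_int_mul_X_add {p : ℤ} (hp : p ≠ 0) (μ : ℂ) :
    Prime (C (C (p : ℂ)) * X + C (C μ) : Polynomial (Polynomial ℂ)) := by
  have hp' : (p : ℂ) ≠ 0 := by exact_mod_cast hp
  have hu : IsUnit (C (C (p : ℂ)) : Polynomial (Polynomial ℂ)) :=
    ((isUnit_iff_ne_zero.2 hp').map C).map C
  have e : (C (C (p : ℂ)) * X + C (C μ) : Polynomial (Polynomial ℂ)) =
      C (C (p : ℂ)) * (X - C (C (-μ / p))) := by
    rw [mul_sub, ← C_mul, ← C_mul, mul_div_cancel₀ _ hp']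
    simp
  rw [e]
  exact (associated_unit_mul_left _ _ hu).symm.prime (prime_X_sub_C _)

lemma algebraMap_int_mul_X_add (p : ℤ) (μ : ℂ) :
    algebraMap _ RatXY (C (C (p : ℂ)) * X + C (C μ)) = p * y + const μ := by
  rw [map_add, map_mul, ← const_intCast]
  rfl

/-- Up to the derivative of the rational part, a formal derivative has only simple poles. -/
lemma mul_sub_mem_regularAlong {E : LogExpr} {f : RatXY} (h : E.Formal f)
    {P : Polynomial (Polynomial ℂ)} (hP : Prime P) (hx : ¬ P ∣ polyX) :
    algebraMap _ RatXY P * (f - D E.H) ∈ regularAlong RatXY hP := by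
  have hD := D_algebraMap_mem_regularAlong hP hx
  have hc : ∀ c, const c ∈ regularAlong RatXY hP := fun c => algebraMap_mem_regularAlong hP _
  have hxz : ∀ n : ℤ, x ^ n ∈ regularAlong RatXY hP := by
    intro n
    obtain ⟨m, rfl | rfl⟩ := n.eq_nat_or_neg
    · rw [zpow_natCast]
      exact pow_mem (algebraMap_mem_regularAlong hP _) m
    · rw [zpow_neg, zpow_natCast, ← inv_pow]
      exact pow_mem (inv_mem_regularAlong hP hx) m
  have e : f - D E.H = ∑ μ ∈ E.S, const μ * (D (E.K μ) / E.K μ) +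
      (E.a.sum fun i c => const c * eiTerm i.1 i.2) + liSum E.b := by
    rw [(LogExpr.formal_iff.1 h).1, LogExpr.formalDeriv]
    ring
  rw [e, mul_add, mul_add, liSum, Finsupp.sum, Finsupp.sum, Finset.mul_sum, Finset.mul_sum,
    Finset.mul_sum]
  refine add_mem (add_mem ?_ ?_) ?_
  · refine sum_mem fun μ hμ => ?_
    rw [mul_left_comm]
    exact mul_mem (hc μ) (mul_logDeriv_mem_regularAlong hP D hD (E.K_ne_zero μ hμ))
  · refine sum_mem fun i hi => ?_
    have h1 := mul_inv_mem_regularAlong (K := RatXY) hP (prime_int_mul_X_add (E.a_index i hi) i.2)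
    rw [algebraMap_int_mul_X_add] at h1
    have e1 : algebraMap _ RatXY P * (const (E.a i) * eiTerm i.1 i.2) =
        const (E.a i) * (const ((i.1 : ℂ) * exp i.2) * x ^ (i.1 - 1)) *
          (algebraMap _ RatXY P * (i.1 * y + const i.2)⁻¹) := by
      rw [eiTerm, const_mul, const_intCast]
      ring
    rw [e1]
    exact mul_mem (mul_mem (hc _) (mul_mem (hc _) (hxz _))) h1
  · refine sum_mem fun i hi => ?_
    split_ifs
    · have h1 := mul_inv_mem_regularAlong (K := RatXY) hP (prime_oneSubMulX (E.b_index i hi).2)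
      rw [algebraMap_oneSubMulX] at h1
      have e1 : algebraMap _ RatXY P * (const (E.b i) * liTerm i.2.1 i.2.2) =
          const (E.b i) * (y ^ i.2.1 * const i.2.2) *
            (algebraMap _ RatXY P * (1 - const i.2.2 * x)⁻¹) := by
        rw [liTerm]
        ring
      rw [e1]
      exact mul_mem (mul_mem (hc _) (mul_mem (pow_mem (algebraMap_mem_regularAlong hP _) _)
        (hc _))) h1
    · rw [mul_zero]; exact zero_mem _

lemma not_dvd_polyX {P : Polynomial (Polynomial ℂ)} (hP : Irreducible P)
    (hx : ¬ Associated P polyX) : ¬ P ∣ polyX := fun h =>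
  hx (hP.associated_of_dvd prime_polyX.irreducible h)

/-- A pole of `H` away from `x = 0` is a pole of larger order of `f`. -/
lemma pow_succ_dvd_den {E : LogExpr} {f : RatXY} (h : E.Formal f)
    {P : Polynomial (Polynomial ℂ)} (hP : Irreducible P) (hx : ¬ Associated P polyX) {n : ℕ}
    (hd : P ^ (n + 1) ∣ den E.H) : P ^ (n + 2) ∣ den f := by
  have hPp := hP.prime
  have hxP := not_dvd_polyX hP hx
  have hDx := xD_algebraMap_mem_regularAlong hPp
  by_contra hf
  obtain ⟨m, hm⟩ := exists_pow_mul_mem_regularAlong hPp E.H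
  -- Descent: if f has order at most n+1 along P, so has D H, because f - D H has at most a simple
  -- pole. Any bound m+1 > n on the order of H then improves to m.
  have key : ∀ m, n ≤ m → algebraMap _ RatXY P ^ m * E.H ∈ regularAlong RatXY hPp →
      algebraMap _ RatXY P ^ n * E.H ∈ regularAlong RatXY hPp := by
    intro m hnm
    induction m, hnm using Nat.le_induction with
    | base => exact id
    | succ m hnm ih =>
      intro hm
      refine ih (pow_pred_mul_mem_regularAlong hPp xD hDx (xD_algebraMap P)
        (not_dvd_eulerSub hP hx) hm ?_)
      have h1 : algebraMap _ RatXY P ^ (m + 1) * f ∈ regularAlong RatXY hPp :=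
        (pow_mul_mem_regularAlong_iff hPp _ _).2 fun h' =>
          hf ((pow_dvd_pow P (by omega)).trans h')
      have h2 := mul_mem (pow_mem (algebraMap_mem_regularAlong (K := RatXY) hPp P) m)
        (mul_sub_mem_regularAlong h hPp hxP)
      have h3 := mul_mem (algebraMap_mem_regularAlong (K := RatXY) hPp polyX) (sub_mem h1 h2)
      convert h3 using 1
      rw [xD_apply, x]
      ring
  rcases le_total n m with hnm | hnm
  · exact (pow_mul_mem_regularAlong_iff hPp _ _).1 (key m hnm hm) hd
  · have h1 := mul_mem (pow_mem (algebraMap_mem_regularAlong (K := RatXY) hPp P) (n - m)) hm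
    rw [← mul_assoc, ← pow_add, Nat.sub_add_cancel hnm] at h1
    exact (pow_mul_mem_regularAlong_iff hPp _ _).1 h1 hd

lemma simplePolesAwayFromZero_of_formal {E : LogExpr} {f : RatXY} (h : E.Formal f)
    (h0 : E.H = 0) : SimplePolesAwayFromZero f := by
  intro P hP hx
  have h1 := mul_sub_mem_regularAlong h hP.prime (not_dvd_polyX hP hx)
  rw [h0, map_zero, sub_zero] at h1
  refine (pow_mul_mem_regularAlong_iff hP.prime 1 f).1 ?_
  rwa [pow_one]

/-- After clearing powers of x, a prime left in the denominator would be a pole of H away from x =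
0, and its square would divide the denominator of f. -/
lemma isLaurent_of_formal {E : LogExpr} {f : RatXY} (h : E.Formal f)
    (hf : SimplePolesAwayFromZero f) : IsLaurent E.H := by
  obtain ⟨n, hn⟩ := exists_pow_mul_mem_regularAlong (K := RatXY) prime_polyX E.H
  have hu : IsUnit (den (x ^ n * E.H)) := by
    by_contra hu
    obtain ⟨P, hP, hd⟩ := WfDvdMonoid.exists_irreducible_factor hu (den_ne_zero _)
    rw [← pow_one P] at hd
    by_cases hx : Associated P polyX
    · refine (pow_mul_mem_regularAlong_iff prime_polyX 0 (x ^ n * E.H)).1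
        (by rwa [pow_zero, one_mul]) ?_
      rw [zero_add]
      exact (hx.symm.pow_pow (n := 1)).dvd.trans hd
    · refine (pow_mul_mem_regularAlong_iff hP.prime 0 (x ^ n * E.H)).1 ?_ hd
      rw [pow_zero, one_mul]
      refine mul_mem (pow_mem (algebraMap_mem_regularAlong hP.prime _) n) ?_
      rw [← one_mul E.H, ← pow_zero (algebraMap _ RatXY P)]
      refine (pow_mul_mem_regularAlong_iff hP.prime 0 _).2 fun h' => ?_
      exact hf P hP hx (pow_succ_dvd_den h hP hx (n := 0) h')
  obtain ⟨u, hu⟩ := hu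
  refine ⟨num (x ^ n * E.H) * ↑u⁻¹, n, ?_⟩
  have e := mul_den (x ^ n * E.H)
  have hu1 : algebraMap _ RatXY (u : Polynomial (Polynomial ℂ)) *
      algebraMap _ RatXY (↑u⁻¹ : Polynomial (Polynomial ℂ)) = 1 := by
    rw [← map_mul, Units.mul_inv, map_one]
  rw [eq_div_iff (pow_ne_zero n x_ne_zero), map_mul, ← e, ← hu, mul_assoc, hu1, mul_one, mul_comm]

end RatXY

/-! ### Laurent expansions at x = 0, x = ∞ and y = ∞. -/

namespace LaurentSeries

open HahnSeries

variable {k : Type*} [Field k] [Algebra ℂ k]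

/-- The derivation of `k((T))` given by `ε T d/dT` plus `δ` on coefficients. -/
noncomputable def eulerDeriv (ε : ℤ) (δ : Derivation ℂ k k) : LaurentSeries k →+ LaurentSeries k where
  toFun F :=
    { coeff := fun n => ((ε * n : ℤ) : k) * F.coeff n + δ (F.coeff n)
      isPWO_support' := F.isPWO_support.mono fun n hn => by
        rw [mem_support]
        intro h
        rw [Function.mem_support, h] at hn
        simp at hn }
  map_zero' := by ext; simp
  map_add' F G := by ext n; simp only [coeff_add, map_add]; ring

lemma coeff_eulerDeriv (ε : ℤ) (δ : Derivation ℂ k k) (F : LaurentSeries k) (n : ℤ) :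
    (eulerDeriv ε δ F).coeff n = ((ε * n : ℤ) : k) * F.coeff n + δ (F.coeff n) := rfl

lemma eulerDeriv_support_subset (ε : ℤ) (δ : Derivation ℂ k k) (F : LaurentSeries k) :
    (eulerDeriv ε δ F).support ⊆ F.support := by
  intro n hn h
  rw [mem_support, coeff_eulerDeriv, h] at hn
  simp at hn

lemma eulerDeriv_mul (ε : ℤ) (δ : Derivation ℂ k k) (F G : LaurentSeries k) :
    eulerDeriv ε δ (F * G) = F * eulerDeriv ε δ G + G * eulerDeriv ε δ F := by
  ext n
  rw [mul_comm G, coeff_eulerDeriv, coeff_add,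
    coeff_mul_right' G.isPWO_support (eulerDeriv_support_subset ε δ G),
    coeff_mul_left' F.isPWO_support (eulerDeriv_support_subset ε δ F), coeff_mul,
    ← Finset.sum_add_distrib, map_sum, Finset.mul_sum, ← Finset.sum_add_distrib]
  refine Finset.sum_congr rfl fun ij hij => ?_
  obtain ⟨-, -, hn⟩ := Finset.mem_antidiagonal.1 hij
  rw [δ.leibniz, coeff_eulerDeriv, coeff_eulerDeriv, ← hn, smul_eq_mul, smul_eq_mul]
  push_cast
  ring

lemma eulerDeriv_single (ε n : ℤ) (δ : Derivation ℂ k k) (c : k) :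
    eulerDeriv ε δ (single n c) = single n (((ε * n : ℤ) : k) * c + δ c) := by
  ext m
  rw [coeff_eulerDeriv, coeff_single, coeff_single]
  split_ifs with h
  · rw [h]
  · simp

/-- Applied with G the image of F under x D: logarithmic derivatives with respect to x D have no
pole at these places. -/
lemma coeff_div_eq_zero {F G : LaurentSeries k} (h : ∀ n, n < F.order → G.coeff n = 0) {n : ℤ}
    (hn : n < 0) : (G / F).coeff n = 0 := by
  by_cases hF : F = 0
  · simp [hF]
  by_cases hG : G / F = 0
  · rw [hG, coeff_zero]
  refine coeff_eq_zero_of_lt_order (hn.trans_le ?_)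
  have hG0 : G ≠ 0 := by rintro rfl; simp at hG
  have h1 : G.order = (G / F).order + F.order := by
    rw [← order_mul hG hF, div_mul_cancel₀ _ hF]
  have h2 : F.order ≤ G.order := by
    by_contra hlt
    exact hG0 (coeff_order_eq_zero.1 (h _ (not_le.1 hlt)))
  omega

lemma coeff_eulerDeriv_eq_zero (ε : ℤ) (δ : Derivation ℂ k k) {F : LaurentSeries k} {n : ℤ}
    (hn : n < F.order) : (eulerDeriv ε δ F).coeff n = 0 := by
  rw [coeff_eulerDeriv, coeff_eq_zero_of_lt_order hn]
  simp

end LaurentSeries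

namespace RatXY

open Polynomial
open HahnSeries hiding C coeff_zero coeff_add coeff_sub coeff leadingCoeff_eq_zero map

lemma eq_of_leibniz {L : Type*} [Field L] (φ : RatXY →+* L) (d₁ d₂ : RatXY → L)
    (ha₁ : ∀ a b, d₁ (a + b) = d₁ a + d₁ b) (ha₂ : ∀ a b, d₂ (a + b) = d₂ a + d₂ b)
    (h₁ : ∀ a b, d₁ (a * b) = φ a * d₁ b + φ b * d₁ a)
    (h₂ : ∀ a b, d₂ (a * b) = φ a * d₂ b + φ b * d₂ a)
    (hc : ∀ c, d₁ (const c) = d₂ (const c)) (hx : d₁ x = d₂ x) (hy : d₁ y = d₂ y) (g : RatXY) :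
    d₁ g = d₂ g := by
  refine eq_of_leibniz_of_fractionRing (R := Polynomial (Polynomial ℂ)) φ d₁ d₂ h₁ h₂
    (fun p => ?_) g
  have hmul : ∀ a b, d₁ a = d₂ a → d₁ b = d₂ b → d₁ (a * b) = d₂ (a * b) := by
    intro a b ha hb
    rw [h₁, h₂, ha, hb]
  induction p using Polynomial.induction_on with
  | C q =>
    induction q using Polynomial.induction_on with
    | C c => exact hc c
    | add p q hp hq => rw [map_add, map_add, ha₁, ha₂, hp, hq]
    | monomial n c ih =>
      rw [pow_succ, ← mul_assoc, map_mul C, map_mul]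
      exact hmul _ _ ih hx
  | add p q hp hq => rw [map_add, ha₁, ha₂, hp, hq]
  | monomial n c ih =>
    rw [pow_succ, ← mul_assoc, map_mul]
    exact hmul _ _ ih hy

/-- Substitution of `T ^ ε` for the outer variable. -/
noncomputable def laurentHom (ε : ℤ) : Polynomial (Polynomial ℂ) →+* LaurentSeries RatX :=
  eval₂RingHom (HahnSeries.C.comp (algebraMap (Polynomial ℂ) RatX)) (single ε 1)

lemma coeff_laurentHom_eq_sum (ε : ℤ) (q : Polynomial (Polynomial ℂ)) (m : ℤ) :
    (laurentHom ε q).coeff m =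
      ∑ i ∈ q.support, if m = ε * i then algebraMap _ RatX (q.coeff i) else 0 := by
  rw [laurentHom, coe_eval₂RingHom, eval₂_eq_sum, Polynomial.sum, HahnSeries.coeff_sum]
  refine Finset.sum_congr rfl fun i _ => ?_
  rw [RingHom.comp_apply, HahnSeries.C_apply, single_pow, single_mul_single, coeff_single,
    one_pow, mul_one, zero_add, nsmul_eq_mul, mul_comm (i : ℤ)]
  congr

lemma coeff_laurentHom {ε : ℤ} (hε : ε ≠ 0) (q : Polynomial (Polynomial ℂ)) (n : ℕ) :
    (laurentHom ε q).coeff (ε * n) = algebraMap _ RatX (q.coeff n) := by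
  rw [coeff_laurentHom_eq_sum]
  simp only [mul_right_inj' hε, Nat.cast_inj]
  rw [Finset.sum_ite_eq]
  split_ifs with h
  · rfl
  · rw [notMem_support_iff.1 h, map_zero]

lemma coeff_laurentHom_eq_zero {ε : ℤ} (q : Polynomial (Polynomial ℂ)) {m : ℤ}
    (hm : ∀ n : ℕ, m = ε * n → q.coeff n = 0) : (laurentHom ε q).coeff m = 0 := by
  rw [coeff_laurentHom_eq_sum]
  refine Finset.sum_eq_zero fun i hi => ?_
  rw [if_neg fun h => mem_support_iff.1 hi (hm i h)]

lemma laurentHom_injective {ε : ℤ} (hε : ε ≠ 0) : Function.Injective (laurentHom ε) := by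
  rw [injective_iff_map_eq_zero]
  intro q hq
  ext1 n
  apply IsFractionRing.injective (Polynomial ℂ) RatX
  rw [← coeff_laurentHom hε, hq, HahnSeries.coeff_zero, Polynomial.coeff_zero, map_zero]

@[simp] lemma laurentHom_X (ε : ℤ) : laurentHom ε X = single ε 1 := by simp [laurentHom]

@[simp] lemma laurentHom_C (ε : ℤ) (p : Polynomial ℂ) :
    laurentHom ε (C p) = HahnSeries.C (algebraMap _ RatX p) := by simp [laurentHom]

lemma order_laurentHom_neg_one {q : Polynomial (Polynomial ℂ)} (hq : q ≠ 0) :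
    (laurentHom (-1) q).order = -(q.natDegree : ℤ) := by
  refine le_antisymm (order_le_of_coeff_ne_zero ?_) ?_
  · rw [show -(q.natDegree : ℤ) = (-1) * q.natDegree by ring, coeff_laurentHom (by norm_num)]
    exact RatX.algebraMap_ne_zero (leadingCoeff_ne_zero.2 hq)
  · by_contra h
    have h0 : laurentHom (-1) q ≠ 0 := (map_ne_zero_iff _ (laurentHom_injective (by norm_num))).2 hq
    refine h0 (coeff_order_eq_zero.1 (coeff_laurentHom_eq_zero q fun n hn => ?_))
    exact coeff_eq_zero_of_natDegree_lt (by omega)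

lemma le_order_laurentHom_one_iff {q : Polynomial (Polynomial ℂ)} (hq : q ≠ 0) (n : ℕ) :
    (n : ℤ) ≤ (laurentHom 1 q).order ↔ X ^ n ∣ q := by
  have h0 : laurentHom 1 q ≠ 0 := (map_ne_zero_iff _ (laurentHom_injective one_ne_zero)).2 hq
  rw [X_pow_dvd_iff]
  constructor
  · intro h d hd
    apply IsFractionRing.injective (Polynomial ℂ) RatX
    rw [← coeff_laurentHom one_ne_zero, map_zero]
    exact coeff_eq_zero_of_lt_order (by omega)
  · intro h
    by_contra hlt
    refine h0 (coeff_order_eq_zero.1 (coeff_laurentHom_eq_zero q fun d hd => h d ?_))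
    omega

lemma coeff_coeff_swap (p : Polynomial (Polynomial ℂ)) (m n : ℕ) :
    ((Bivariate.swap p).coeff m).coeff n = (p.coeff n).coeff m := by
  induction p using Polynomial.induction_on' with
  | add p q hp hq => simp only [map_add, Polynomial.coeff_add, hp, hq]
  | monomial i q =>
    induction q using Polynomial.induction_on' with
    | add p q hp hq => simp only [map_add, Polynomial.coeff_add, hp, hq]
    | monomial j c =>
      rw [Bivariate.swap_monomial_monomial]
      simp only [coeff_monomial]
      by_cases h1 : i = n <;> by_cases h2 : j = m <;> simp [h1, h2, coeff_monomial]

lemma natDegree_swap (p : Polynomial (Polynomial ℂ)) :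
    (Bivariate.swap p).natDegree = polyDegX p := by
  refine le_antisymm ?_ ?_
  · refine natDegree_le_iff_coeff_eq_zero.2 fun m hm => ?_
    ext n
    rw [coeff_coeff_swap, Polynomial.coeff_zero]
    by_cases hn : n ∈ p.support
    · exact coeff_eq_zero_of_natDegree_lt ((Finset.le_sup
        (f := fun j => (p.coeff j).natDegree) hn).trans_lt hm)
    · rw [notMem_support_iff.1 hn, Polynomial.coeff_zero]
  · refine Finset.sup_le fun n hn => ?_
    refine le_natDegree_of_ne_zero fun h => ?_
    have h1 := congrArg (fun q => Polynomial.coeff q n) h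
    simp only [coeff_coeff_swap, Polynomial.coeff_zero] at h1
    exact mem_support_iff.1 hn (Polynomial.leadingCoeff_eq_zero.1 h1)

/-- The expansion in powers of `x ^ ε`. -/
noncomputable def expandX (ε : ℤ) (hε : ε ≠ 0) : RatXY →+* LaurentSeries RatX :=
  -- The swap makes x the outer variable, so the coefficient field `RatX` is ℂ(y) here and `RatX.X`
  -- stands for y. The place is x = 0 for ε = 1 and x = ∞ for ε = -1.
  IsLocalization.lift (M := nonZeroDivisors (Polynomial (Polynomial ℂ)))
    (g := (laurentHom ε).comp (Bivariate.swap (R := ℂ) : _ →+* _)) fun q =>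
    IsUnit.mk0 (G₀ := LaurentSeries RatX) _ (fun h => nonZeroDivisors.ne_zero q.2
      ((Bivariate.swap (R := ℂ)).injective
        ((laurentHom_injective hε (h.trans (map_zero _).symm)).trans (map_zero _).symm)))

/-- The expansion in decreasing powers of `y`. -/
noncomputable def expandY : RatXY →+* LaurentSeries RatX :=
  IsLocalization.lift (M := nonZeroDivisors (Polynomial (Polynomial ℂ)))
    (g := laurentHom (-1)) fun q => IsUnit.mk0 (G₀ := LaurentSeries RatX) _
      (fun h => nonZeroDivisors.ne_zero q.2
        (laurentHom_injective (ε := -1) (by norm_num) (h.trans (map_zero _).symm)))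

lemma expandX_algebraMap {ε : ℤ} (hε : ε ≠ 0) (p : Polynomial (Polynomial ℂ)) :
    expandX ε hε (algebraMap _ RatXY p) = laurentHom ε (Bivariate.swap p) :=
  IsLocalization.lift_eq _ _

lemma expandY_algebraMap (p : Polynomial (Polynomial ℂ)) :
    expandY (algebraMap _ RatXY p) = laurentHom (-1) p :=
  IsLocalization.lift_eq _ _

@[simp] lemma expandX_x {ε : ℤ} (hε : ε ≠ 0) : expandX ε hε x = single ε 1 := by
  rw [x, expandX_algebraMap, polyX, Bivariate.swap_X, laurentHom_X]

@[simp] lemma expandX_y {ε : ℤ} (hε : ε ≠ 0) : expandX ε hε y = HahnSeries.C RatX.X := by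
  rw [y, expandX_algebraMap, Bivariate.swap_Y, laurentHom_C]
  rfl

@[simp] lemma expandX_const {ε : ℤ} (hε : ε ≠ 0) (c : ℂ) :
    expandX ε hε (const c) = HahnSeries.C (algebraMap ℂ RatX c) := by
  rw [const, expandX_algebraMap, Bivariate.swap_C_C, laurentHom_C]
  rfl

@[simp] lemma expandY_x : expandY x = HahnSeries.C RatX.X := by
  rw [x, expandY_algebraMap, polyX, laurentHom_C]
  rfl

@[simp] lemma expandY_y : expandY y = single (-1) 1 := by
  rw [y, expandY_algebraMap, laurentHom_X]

@[simp] lemma expandY_const (c : ℂ) : expandY (const c) = HahnSeries.C (algebraMap ℂ RatX c) := by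
  rw [const, expandY_algebraMap, laurentHom_C]
  rfl

/-- For x = T^ε with ε = ±1 the operator x ∂_x is ε T d/dT, and ∂_y differentiates the coefficients;
agreement on constants, x and y suffices. -/
lemma expandX_xD {ε : ℤ} (hε : ε * ε = 1) (hε0 : ε ≠ 0) (g : RatXY) :
    expandX ε hε0 (xD g) = LaurentSeries.eulerDeriv ε RatX.deriv (expandX ε hε0 g) := by
  refine eq_of_leibniz (expandX ε hε0)
    (fun g => expandX ε hε0 (xD g))
    (fun g => LaurentSeries.eulerDeriv ε RatX.deriv (expandX ε hε0 g))
    (fun a b => by simp only [map_add]) (fun a b => by simp only [map_add]) ?_ ?_ ?_ ?_ ?_ g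
  · intro a b
    change expandX ε hε0 (xD (a * b)) = _ * expandX ε hε0 (xD b) + _ * expandX ε hε0 (xD a)
    simp
  · intro a b
    change LaurentSeries.eulerDeriv ε RatX.deriv (expandX ε hε0 (a * b)) = _
    rw [map_mul, LaurentSeries.eulerDeriv_mul]
  · intro c
    rw [expandX_const, HahnSeries.C_apply, LaurentSeries.eulerDeriv_single, xD_apply, D_const]
    simp
  · rw [xD_apply, D_x, mul_one, expandX_x, LaurentSeries.eulerDeriv_single, hε]
    simp
  · rw [xD_apply, D_y, mul_inv_cancel₀ x_ne_zero, expandX_y, HahnSeries.C_apply,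
      LaurentSeries.eulerDeriv_single, RatX.deriv_X]
    simp

/-- The derivation `x D` in terms of expansions in decreasing powers of `y`. -/
noncomputable def expandYDeriv : LaurentSeries RatX →+ LaurentSeries RatX :=
  (AddMonoidHom.mulLeft (HahnSeries.C RatX.X)).comp (LaurentSeries.eulerDeriv 0 RatX.deriv) +
    (AddMonoidHom.mulLeft (single 1 1)).comp (LaurentSeries.eulerDeriv (-1) 0)

lemma expandYDeriv_apply (F : LaurentSeries RatX) : expandYDeriv F =
    HahnSeries.C RatX.X * LaurentSeries.eulerDeriv 0 RatX.deriv F +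
      single 1 1 * LaurentSeries.eulerDeriv (-1) 0 F := rfl

/-- With T = 1/y one has ∂_y T^(n-1) = (1-n) T^n, which is why the preceding coefficient enters. -/
lemma coeff_expandYDeriv (F : LaurentSeries RatX) (n : ℤ) : (expandYDeriv F).coeff n =
    RatX.X * RatX.deriv (F.coeff n) + ((1 - n : ℤ) : RatX) * F.coeff (n - 1) := by
  rw [expandYDeriv_apply, HahnSeries.coeff_add, HahnSeries.C_apply, coeff_single_mul,
    coeff_single_mul, LaurentSeries.coeff_eulerDeriv, LaurentSeries.coeff_eulerDeriv]
  simp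

lemma expandY_xD (g : RatXY) : expandY (xD g) = expandYDeriv (expandY g) := by
  refine eq_of_leibniz expandY
    (fun g => expandY (xD g)) (fun g => expandYDeriv (expandY g))
    (fun a b => by simp only [map_add]) (fun a b => by simp only [map_add]) ?_ ?_ ?_ ?_ ?_ g
  · intro a b
    change expandY (xD (a * b)) = _ * expandY (xD b) + _ * expandY (xD a)
    simp
  · intro a b
    change expandYDeriv (expandY (a * b)) =
      expandY a * expandYDeriv (expandY b) + expandY b * expandYDeriv (expandY a)
    rw [map_mul, expandYDeriv_apply, expandYDeriv_apply, expandYDeriv_apply,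
      LaurentSeries.eulerDeriv_mul, LaurentSeries.eulerDeriv_mul]
    ring
  · intro c
    rw [expandYDeriv_apply, expandY_const, HahnSeries.C_apply,
      HahnSeries.C_apply, LaurentSeries.eulerDeriv_single,
      LaurentSeries.eulerDeriv_single, xD_apply, D_const]
    simp
  · rw [expandYDeriv_apply, xD_apply, D_x, mul_one, expandY_x, HahnSeries.C_apply,
      LaurentSeries.eulerDeriv_single, LaurentSeries.eulerDeriv_single, RatX.deriv_X]
    simp
  · rw [expandYDeriv_apply, xD_apply, D_y, mul_inv_cancel₀ x_ne_zero, expandY_y,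
      LaurentSeries.eulerDeriv_single, LaurentSeries.eulerDeriv_single]
    simp

end RatXY

/-! ### Equations for single Laurent coefficients. -/

lemma div_sub_inv_eq {F : Type*} [Field F] (c x : F) {a : F} (ha : a ≠ 0) :
    c / (x - a⁻¹) = -(c * (a / (1 - a * x))) := by
  have h : x - a⁻¹ = -((1 - a * x) * a⁻¹) := by
    field_simp
    ring
  rw [h, div_neg, ← div_div, div_inv_eq_mul]
  ring

namespace RatX

open Polynomial

/-- A homogeneous equation for the coefficients in an expansion in powers of `x`. -/
lemma eq_zero_of_deriv_add_sum {ι : Type*} (s : Finset ι) (c μ : ι → ℂ) {n : ℤ} (hn : n ≠ 0)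
    {h : RatX} (e : (n : RatX) * h + RatX.deriv h + ∑ i ∈ s, algebraMap ℂ RatX (c i) /
      (n * RatX.X + algebraMap ℂ RatX (μ i)) = 0) : h = 0 := by
  have hn' : (n : ℂ) ≠ 0 := by exact_mod_cast hn
  set q : ι → Polynomial ℂ := fun i => C (n : ℂ) * Polynomial.X + C (μ i) with hq
  have hdeg : ∀ i, (q i).degree = 1 := fun i => degree_linear hn'
  have hqp : ∀ i, Prime (q i) := fun i => (irreducible_of_degree_eq_one (hdeg i)).prime
  have hmap : ∀ i, (n : RatX) * RatX.X + algebraMap ℂ RatX (μ i) = algebraMap _ RatX (q i) := by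
    intro i
    rw [hq, map_add, map_mul, IsScalarTower.algebraMap_apply ℂ (Polynomial ℂ) RatX, map_intCast (C : ℂ →+* Polynomial ℂ),
      map_intCast]
    rfl
  simp only [hmap] at e
  have hsum : ∀ (P : Polynomial ℂ) (hP : Prime P), algebraMap _ RatX P * ∑ i ∈ s,
      algebraMap ℂ RatX (c i) / algebraMap _ RatX (q i) ∈ regularAlong RatX hP := by
    intro P hP
    rw [Finset.mul_sum]
    refine sum_mem fun i _ => ?_
    rw [div_eq_mul_inv, mul_left_comm]
    exact mul_mem (constant_mem_regularAlong hP _) (mul_inv_mem_regularAlong hP (hqp i))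
  -- The sum has only simple poles, and h' + n h never has one; hence h is a polynomial.
  obtain ⟨p, rfl⟩ := exists_polynomial_of_forall_regular (g := h) fun P hP =>
    mem_regularAlong_of_simple_pole hP (c := (n : RatX)) (intCast_mem _ n) (by
      have h1 := neg_mem (hsum P hP)
      rw [← mul_neg] at h1
      convert h1 using 2
      linear_combination e)
  have hprop : IsProper (∑ i ∈ s, algebraMap ℂ RatX (c i) / algebraMap _ RatX (q i)) := by
    classical
    refine Finset.sum_induction _ IsProper (fun _ _ => IsProper.add) isProper_zero fun i _ => ?_
    refine ⟨C (c i), q i, ?_, ?_⟩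
    · rw [hdeg]
      exact degree_C_le.trans_lt (by norm_num)
    · rw [IsScalarTower.algebraMap_apply ℂ (Polynomial ℂ) RatX]
      rfl
  -- The sum is a proper fraction and equals a polynomial, so both vanish; then n p = -p'
  -- contradicts degrees unless p = 0.
  have h0 : -(C (n : ℂ) * p + derivative p) = 0 := by
    refine hprop.eq_zero_of_eq_algebraMap ?_
    rw [map_neg, map_add, map_mul, ← deriv_algebraMap, map_intCast (C : ℂ →+* Polynomial ℂ), map_intCast]
    linear_combination e
  by_contra hp
  have hp0 : p ≠ 0 := by rintro rfl; simp at hp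
  have h1 : C (n : ℂ) * p = -derivative p := by linear_combination -h0
  have h2 := degree_derivative_lt hp0
  rw [← degree_neg, ← h1, degree_C_mul hn'] at h2
  exact lt_irrefl _ h2

/-- Residues of an equation for the coefficients in an expansion in powers of `y`. -/
lemma eq_zero_of_deriv_eq_sum {ι : Type*} (s : Finset ι) (c μ : ι → ℂ)
    (hμ : ∀ i ∈ s, μ i ≠ 0) (hinj : Set.InjOn μ s) (c₀ : ℂ) {h : RatX}
    (e : RatX.X * RatX.deriv h + algebraMap ℂ RatX c₀ + ∑ i ∈ s, algebraMap ℂ RatX (c i) *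
      (RatX.X * (algebraMap ℂ RatX (μ i) / (1 - algebraMap ℂ RatX (μ i) * RatX.X))) = 0) :
    c₀ = 0 ∧ RatX.deriv h = 0 := by
  classical
  -- The residues of h' as a function of the pole: the poles 1/μ_i are distinct and nonzero, so they
  -- do not interfere with the pole at 0 coming from c₀ / x.
  have hr : ∃ r : ℂ → ℂ, r 0 = -c₀ ∧ ∀ i ∈ s, r (μ i)⁻¹ = c i := by
    refine ⟨fun z => if h : ∃ i ∈ s, (μ i)⁻¹ = z then c h.choose else -c₀, ?_, ?_⟩
    · beta_reduce
      rw [dif_neg]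
      rintro ⟨i, hi, h⟩
      exact inv_ne_zero (hμ i hi) h
    · intro i hi
      have h : ∃ j ∈ s, (μ j)⁻¹ = (μ i)⁻¹ := ⟨i, hi, rfl⟩
      beta_reduce
      rw [dif_pos h, hinj h.choose_spec.1 hi (inv_injective h.choose_spec.2)]
  obtain ⟨r, hr0, hr⟩ := hr
  have h0s : (0 : ℂ) ∉ s.image fun i => (μ i)⁻¹ := by
    intro h
    obtain ⟨i, hi, h⟩ := Finset.mem_image.1 h
    exact inv_ne_zero (hμ i hi) h
  have hd : RatX.deriv h = ∑ z ∈ insert 0 (s.image fun i => (μ i)⁻¹),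
      algebraMap ℂ RatX (r z) / (RatX.X - algebraMap ℂ RatX z) := by
    rw [Finset.sum_insert h0s, Finset.sum_image fun i hi j hj hij =>
      hinj hi hj (inv_injective hij), hr0, map_zero, sub_zero, map_neg]
    have hs : ∑ i ∈ s, algebraMap ℂ RatX (r (μ i)⁻¹) / (RatX.X - algebraMap ℂ RatX (μ i)⁻¹) =
        -∑ i ∈ s, algebraMap ℂ RatX (c i) *
          (algebraMap ℂ RatX (μ i) / (1 - algebraMap ℂ RatX (μ i) * RatX.X)) := by
      rw [← Finset.sum_neg_distrib]
      refine Finset.sum_congr rfl fun i hi => ?_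
      rw [hr i hi, map_inv₀]
      have h1 : algebraMap ℂ RatX (μ i) ≠ 0 := by simpa using hμ i hi
      exact div_sub_inv_eq _ _ h1
    have e' : RatX.X * RatX.deriv h + algebraMap ℂ RatX c₀ + RatX.X * ∑ i ∈ s,
        algebraMap ℂ RatX (c i) *
          (algebraMap ℂ RatX (μ i) / (1 - algebraMap ℂ RatX (μ i) * RatX.X)) = 0 := by
      rw [Finset.mul_sum]
      rw [← e]
      congr 1
      exact Finset.sum_congr rfl fun i _ => by ring
    rw [hs]
    generalize ∑ i ∈ s, algebraMap ℂ RatX (c i) *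
      (algebraMap ℂ RatX (μ i) / (1 - algebraMap ℂ RatX (μ i) * RatX.X)) = A at e'
    have hX := X_ne_zero
    field_simp
    linear_combination e'
  have hres := fun z hz => residue_eq_zero_of_eq_deriv _ r h hd (c := z) hz
  constructor
  · have := hres 0 (Finset.mem_insert_self _ _)
    rw [hr0] at this
    exact neg_eq_zero.1 this
  · rw [hd]
    refine Finset.sum_eq_zero fun z hz => ?_
    rw [hres z hz, map_zero, zero_div]

end RatX

/-! ### Laurent coefficients of a formal integral; poles at x = 0 and degree in x. -/

namespace RatXY

open Polynomial
open HahnSeries hiding C coeff_zero coeff_add coeff_sub coeff leadingCoeff_eq_zero map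

lemma x_mul_eiTerm (p : ℤ) (μ : ℂ) :
    x * eiTerm p μ = const (p * exp μ) * x ^ p * (p * y + const μ)⁻¹ := by
  rw [eiTerm, zpow_sub_one₀ x_ne_zero, const_mul, const_intCast]
  field_simp [x_ne_zero]

/-- As a logarithmic derivative times a power of y, the term visibly has no pole at x = 0 or x = ∞.
-/
lemma x_mul_liTerm (r : ℕ) (μ : ℂ) :
    x * liTerm r μ = -(y ^ r * (xD (1 - const μ * x) / (1 - const μ * x))) := by
  rw [liTerm, xD_apply, map_sub, D.leibniz, D_const, D_x, D.map_one_eq_zero]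
  simp only [smul_eq_mul]
  ring

lemma x_mul_eiTerm' (p : ℤ) (μ : ℂ) :
    x * eiTerm p μ = const (exp μ) * x ^ p * (xD (p * y + const μ) / (p * y + const μ)) := by
  rw [x_mul_eiTerm, xD_apply, map_add, D.leibniz, D_const, D_y, ← const_intCast, D_const, const_mul]
  simp only [smul_eq_mul, mul_zero, add_zero]
  field_simp [x_ne_zero]

/-- The formal derivative, multiplied by `x`. -/
lemma x_mul_eq_of_formal {E : LogExpr} {f : RatXY} (h : E.Formal f) :
    x * f = xD E.H + ∑ μ ∈ E.S, const μ * (xD (E.K μ) / E.K μ) +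
      ∑ i ∈ E.a.support, const (E.a i) * (x * eiTerm i.1 i.2) +
      ∑ i ∈ E.b.support, if i.1 = 1 then const (E.b i) * (x * liTerm i.2.1 i.2.2) else 0 := by
  have h1 : ∑ μ ∈ E.S, const μ * (xD (E.K μ) / E.K μ) =
      x * ∑ μ ∈ E.S, const μ * (D (E.K μ) / E.K μ) := by
    rw [Finset.mul_sum]
    exact Finset.sum_congr rfl fun μ _ => by rw [xD_apply, mul_div_assoc, mul_left_comm]
  have h2 : ∑ i ∈ E.a.support, const (E.a i) * (x * eiTerm i.1 i.2) =
      x * ∑ i ∈ E.a.support, const (E.a i) * eiTerm i.1 i.2 := by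
    rw [Finset.mul_sum]
    exact Finset.sum_congr rfl fun i _ => mul_left_comm _ _ _
  have h3 : (∑ i ∈ E.b.support,
      if i.1 = 1 then const (E.b i) * (x * liTerm i.2.1 i.2.2) else 0) =
      x * ∑ i ∈ E.b.support, if i.1 = 1 then const (E.b i) * liTerm i.2.1 i.2.2 else 0 := by
    rw [Finset.mul_sum]
    refine Finset.sum_congr rfl fun i _ => ?_
    split_ifs
    · exact mul_left_comm _ _ _
    · exact (mul_zero x).symm
  rw [h1, h2, h3, xD_apply, ← mul_add, ← mul_add, ← mul_add, (LogExpr.formal_iff.1 h).1]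
  rfl

lemma order_expandX {g : RatXY} (hg : g ≠ 0) {ε : ℤ} (hε : ε ≠ 0) :
    (expandX ε hε g).order = (laurentHom ε (Bivariate.swap (num g))).order -
      (laurentHom ε (Bivariate.swap (den g))).order := by
  have h1 := congrArg (expandX ε hε) (mul_den g)
  rw [map_mul, expandX_algebraMap, expandX_algebraMap] at h1
  rw [← h1, order_mul ((_root_.map_ne_zero _).2 hg), add_sub_cancel_right]
  rw [← expandX_algebraMap hε]
  exact (_root_.map_ne_zero _).2 (algebraMap_ne_zero (den_ne_zero g))

lemma order_expandY {g : RatXY} (hg : g ≠ 0) :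
    (expandY g).order = (laurentHom (-1) (num g)).order - (laurentHom (-1) (den g)).order := by
  have h1 := congrArg expandY (mul_den g)
  rw [map_mul, expandY_algebraMap, expandY_algebraMap] at h1
  rw [← h1, order_mul ((_root_.map_ne_zero _).2 hg), add_sub_cancel_right]
  rw [← expandY_algebraMap]
  exact (_root_.map_ne_zero _).2 (algebraMap_ne_zero (den_ne_zero g))

lemma swap_ne_zero {p : Polynomial (Polynomial ℂ)} (hp : p ≠ 0) :
    (Bivariate.swap (R := ℂ)) p ≠ 0 :=
  (map_ne_zero_iff _ (Bivariate.swap (R := ℂ)).injective).2 hp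

lemma degX_eq {g : RatXY} (hg : g ≠ 0) :
    degX g = ((-(expandX (-1) (by norm_num) g).order : ℤ) : WithBot ℤ) := by
  rw [degX, if_neg hg, order_expandX hg, order_laurentHom_neg_one (swap_ne_zero (num_ne_zero hg)),
    order_laurentHom_neg_one (swap_ne_zero (den_ne_zero g)), natDegree_swap, natDegree_swap]
  congr 1
  ring

lemma degY_eq {g : RatXY} (hg : g ≠ 0) :
    degY g = ((-(expandY g).order : ℤ) : WithBot ℤ) := by
  rw [degY, if_neg hg, order_expandY hg, order_laurentHom_neg_one (num_ne_zero hg),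
    order_laurentHom_neg_one (den_ne_zero g)]
  congr 1
  ring

end RatXY

namespace LaurentSeries

lemma coeff_C_mul {k : Type*} [Field k] (a : k) (F : LaurentSeries k) (n : ℤ) :
    (HahnSeries.C a * F).coeff n = a * F.coeff n := by
  rw [HahnSeries.C_apply, HahnSeries.coeff_single_mul, sub_zero]

lemma single_one_zpow {k : Type*} [Field k] (a n : ℤ) :
    (HahnSeries.single a (1 : k)) ^ n = HahnSeries.single (a * n) 1 := by
  have h : ∀ m : ℕ, (HahnSeries.single a (1 : k)) ^ m = HahnSeries.single (a * m) 1 := fun m => by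
    rw [HahnSeries.single_pow, one_pow, nsmul_eq_mul, mul_comm]
  obtain ⟨m, rfl | rfl⟩ := n.eq_nat_or_neg
  · rw [zpow_natCast, h]
  · rw [zpow_neg, zpow_natCast, h]
    refine inv_eq_of_mul_eq_one_right ?_
    rw [HahnSeries.single_mul_single]
    simp

end LaurentSeries

namespace RatXY

open Polynomial
open HahnSeries hiding C coeff_zero coeff_add coeff_sub coeff leadingCoeff_eq_zero map

section Place

variable {ε : ℤ} {m : ℤ}

lemma coeff_expandX_xD_div (hε : ε * ε = 1) (hε0 : ε ≠ 0) (g : RatXY) (hm : m < 0) :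
    (expandX ε hε0 (xD g / g)).coeff m = 0 := by
  rw [map_div₀, expandX_xD hε]
  exact LaurentSeries.coeff_div_eq_zero
    (fun n hn => LaurentSeries.coeff_eulerDeriv_eq_zero _ _ hn) hm

lemma coeff_expandX_eiTerm (hε0 : ε ≠ 0) (c : ℂ) (p : ℤ) (μ : ℂ) :
    (expandX ε hε0 (const c * (x * eiTerm p μ))).coeff m = if ε * p = m then
      algebraMap ℂ RatX (c * (p * exp μ)) / (p * RatX.X + algebraMap ℂ RatX μ) else 0 := by
  have h1 : expandX ε hε0 (p * y + const μ)⁻¹ =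
      HahnSeries.C (p * RatX.X + algebraMap ℂ RatX μ)⁻¹ := by
    rw [map_inv₀, map_inv₀, map_add, map_add, map_mul, map_mul, expandX_y, expandX_const,
      map_intCast, map_intCast]
  have h2 : const c * (x * eiTerm p μ) =
      const (c * (p * exp μ)) * ((p * y + const μ)⁻¹ * x ^ p) := by
    rw [x_mul_eiTerm, const_mul c]
    ring
  rw [h2, map_mul, map_mul, h1, expandX_const, map_zpow₀, expandX_x,
    LaurentSeries.single_one_zpow, LaurentSeries.coeff_C_mul, LaurentSeries.coeff_C_mul,
    coeff_single, div_eq_mul_inv]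
  by_cases h : ε * p = m
  · rw [if_pos h, if_pos h.symm, mul_one]
  · rw [if_neg h, if_neg (Ne.symm h), mul_zero, mul_zero]

lemma coeff_expandX_liTerm (hε : ε * ε = 1) (hε0 : ε ≠ 0) (c : ℂ) (r : ℕ) (μ : ℂ) (hm : m < 0) :
    (expandX ε hε0 (const c * (x * liTerm r μ))).coeff m = 0 := by
  have h : const c * (x * liTerm r μ) =
      const (-c) * (y ^ r * (xD (1 - const μ * x) / (1 - const μ * x))) := by
    rw [x_mul_liTerm, const_neg]
    ring
  rw [h, map_mul, map_mul, map_pow, expandX_const, expandX_y, ← map_pow,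
    LaurentSeries.coeff_C_mul, LaurentSeries.coeff_C_mul, coeff_expandX_xD_div hε hε0 _ hm,
    mul_zero, mul_zero]

/-- At negative indices logarithms and polylogarithms drop out, and only the Ei terms with p = ε m
remain. The shift m - ε comes from the factor x = T^ε. -/
lemma coeff_expandX_of_formal {E : LogExpr} {f : RatXY} (h : E.Formal f) (hε : ε * ε = 1)
    (hε0 : ε ≠ 0) (hm : m < 0) :
    (expandX ε hε0 f).coeff (m - ε) = ((ε * m : ℤ) : RatX) * (expandX ε hε0 E.H).coeff m +
      RatX.deriv ((expandX ε hε0 E.H).coeff m) +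
      ∑ i ∈ E.a.support.filter (fun i => i.1 = ε * m),
        algebraMap ℂ RatX (E.a i * (i.1 * exp i.2)) /
          (((ε * m : ℤ) : RatX) * RatX.X + algebraMap ℂ RatX i.2) := by
  have h1 : (expandX ε hε0 f).coeff (m - ε) = (expandX ε hε0 (x * f)).coeff m := by
    rw [map_mul, expandX_x, coeff_single_mul, one_mul]
  have hS : (∑ μ ∈ E.S, expandX ε hε0 (const μ * (xD (E.K μ) / E.K μ))).coeff m = 0 := by
    rw [HahnSeries.coeff_sum]
    refine Finset.sum_eq_zero fun μ _ => ?_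
    rw [map_mul, expandX_const, LaurentSeries.coeff_C_mul, coeff_expandX_xD_div hε hε0 _ hm,
      mul_zero]
  have hb : (∑ i ∈ E.b.support, expandX ε hε0
      (if i.1 = 1 then const (E.b i) * (x * liTerm i.2.1 i.2.2) else 0)).coeff m = 0 := by
    rw [HahnSeries.coeff_sum]
    refine Finset.sum_eq_zero fun i _ => ?_
    split_ifs
    · exact coeff_expandX_liTerm hε hε0 _ _ _ hm
    · rw [map_zero, HahnSeries.coeff_zero]
  have ha : (∑ i ∈ E.a.support, expandX ε hε0 (const (E.a i) * (x * eiTerm i.1 i.2))).coeff m =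
      ∑ i ∈ E.a.support.filter (fun i => i.1 = ε * m),
        algebraMap ℂ RatX (E.a i * (i.1 * exp i.2)) /
          (((ε * m : ℤ) : RatX) * RatX.X + algebraMap ℂ RatX i.2) := by
    rw [HahnSeries.coeff_sum, Finset.sum_filter]
    refine Finset.sum_congr rfl fun i _ => ?_
    rw [coeff_expandX_eiTerm]
    have hiff : ε * i.1 = m ↔ i.1 = ε * m := by
      constructor
      · rintro rfl
        rw [← mul_assoc, hε, one_mul]
      · intro h
        rw [h, ← mul_assoc, hε, one_mul]
    by_cases hi : i.1 = ε * m
    · rw [if_pos hi, if_pos (hiff.2 hi), ← hi]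
    · rw [if_neg hi, if_neg (mt hiff.1 hi)]
  rw [h1, x_mul_eq_of_formal h, map_add, map_add, map_add, map_sum, map_sum, map_sum,
    HahnSeries.coeff_add, HahnSeries.coeff_add, HahnSeries.coeff_add, hS, ha, hb, expandX_xD hε,
    LaurentSeries.coeff_eulerDeriv, add_zero, add_zero]

/-- Polar terms of `H` in `x` lead to terms of `f`. -/
lemma coeff_expandX_ne_zero {E : LogExpr} {f : RatXY} (h : E.Formal f) (hε : ε * ε = 1)
    (hε0 : ε ≠ 0) (hm : m < 0) (hH : (expandX ε hε0 E.H).coeff m ≠ 0) :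
    (expandX ε hε0 f).coeff (m - ε) ≠ 0 := by
  intro h0
  rw [coeff_expandX_of_formal h hε hε0 hm] at h0
  exact hH (RatX.eq_zero_of_deriv_add_sum _ (fun i : ℤ × ℂ => E.a i * (i.1 * exp i.2))
    (fun i : ℤ × ℂ => i.2) (mul_ne_zero hε0 hm.ne) h0)

lemma coeff_expandY_xD_div (g : RatXY) (hm : m < 0) : (expandY (xD g / g)).coeff m = 0 := by
  rw [map_div₀, expandY_xD]
  refine LaurentSeries.coeff_div_eq_zero (fun n hn => ?_) hm
  rw [coeff_expandYDeriv, coeff_eq_zero_of_lt_order hn, coeff_eq_zero_of_lt_order (by omega)]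
  simp

lemma coeff_expandY_liTerm (c : ℂ) (r : ℕ) (μ : ℂ) :
    (expandY (const c * (x * liTerm r μ))).coeff m = if m = -r then
      algebraMap ℂ RatX c * (RatX.X * (algebraMap ℂ RatX μ / (1 - algebraMap ℂ RatX μ * RatX.X)))
      else 0 := by
  have h : expandY (const c * (x * liTerm r μ)) = HahnSeries.C (algebraMap ℂ RatX c *
      (RatX.X * (algebraMap ℂ RatX μ / (1 - algebraMap ℂ RatX μ * RatX.X)))) *
        single (-(r : ℤ)) 1 := by
    rw [liTerm]
    simp only [map_mul, map_div₀, map_sub, map_one, map_pow, expandY_x, expandY_y, expandY_const]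
    rw [single_pow, one_pow, nsmul_eq_mul, mul_neg_one]
    ring
  rw [h, LaurentSeries.coeff_C_mul, coeff_single]
  by_cases hr : m = -r
  · rw [if_pos hr, if_pos hr, mul_one]
  · rw [if_neg hr, if_neg hr, mul_zero]

lemma coeff_expandY_eiTerm (c : ℂ) (p : ℤ) (μ : ℂ) (hm : m < 0) :
    (expandY (const c * (x * eiTerm p μ))).coeff m = 0 := by
  rw [x_mul_eiTerm', map_mul, map_mul, map_mul, map_zpow₀, expandY_const, expandY_const, expandY_x,
    ← map_zpow₀, mul_assoc, LaurentSeries.coeff_C_mul, LaurentSeries.coeff_C_mul,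
    LaurentSeries.coeff_C_mul, coeff_expandY_xD_div _ hm, mul_zero, mul_zero, mul_zero]

/-- At y = ∞ the roles change: logarithms and Ei terms have no polar part, while a term y^r / (1 -
μx) sits at index -r. -/
lemma coeff_expandY_of_formal {E : LogExpr} {f : RatXY} (h : E.Formal f) (hm : m < 0) :
    RatX.X * (expandY f).coeff m = RatX.X * RatX.deriv ((expandY E.H).coeff m) +
      ((1 - m : ℤ) : RatX) * (expandY E.H).coeff (m - 1) +
      ∑ i ∈ E.b.support.filter (fun i => i.1 = 1 ∧ m = -i.2.1), algebraMap ℂ RatX (E.b i) *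
        (RatX.X * (algebraMap ℂ RatX i.2.2 / (1 - algebraMap ℂ RatX i.2.2 * RatX.X))) := by
  have h1 : RatX.X * (expandY f).coeff m = (expandY (x * f)).coeff m := by
    rw [map_mul, expandY_x, LaurentSeries.coeff_C_mul]
  have hS : (∑ μ ∈ E.S, expandY (const μ * (xD (E.K μ) / E.K μ))).coeff m = 0 := by
    rw [HahnSeries.coeff_sum]
    refine Finset.sum_eq_zero fun μ _ => ?_
    rw [map_mul, expandY_const, LaurentSeries.coeff_C_mul, coeff_expandY_xD_div _ hm, mul_zero]
  have ha : (∑ i ∈ E.a.support, expandY (const (E.a i) * (x * eiTerm i.1 i.2))).coeff m = 0 := by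
    rw [HahnSeries.coeff_sum]
    exact Finset.sum_eq_zero fun i _ => coeff_expandY_eiTerm _ _ _ hm
  have hb : (∑ i ∈ E.b.support, expandY
      (if i.1 = 1 then const (E.b i) * (x * liTerm i.2.1 i.2.2) else 0)).coeff m =
      ∑ i ∈ E.b.support.filter (fun i => i.1 = 1 ∧ m = -i.2.1), algebraMap ℂ RatX (E.b i) *
        (RatX.X * (algebraMap ℂ RatX i.2.2 / (1 - algebraMap ℂ RatX i.2.2 * RatX.X))) := by
    rw [HahnSeries.coeff_sum, Finset.sum_filter]
    refine Finset.sum_congr rfl fun i _ => ?_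
    by_cases hi : i.1 = 1
    · simp only [hi, true_and, if_true]
      exact coeff_expandY_liTerm _ _ _
    · simp [hi]
  rw [h1, x_mul_eq_of_formal h, map_add, map_add, map_add, map_sum, map_sum, map_sum,
    HahnSeries.coeff_add, HahnSeries.coeff_add, HahnSeries.coeff_add, hS, ha, hb, expandY_xD,
    coeff_expandYDeriv, add_zero, add_zero]

end Place

/-- At x = ∞ a polar coefficient of H at index m forces a nonzero coefficient of f at m + 1, which
bounds the degree of H by that of f plus one. -/
lemma degX_le_of_formal {E : LogExpr} {f : RatXY} (h : E.Formal f) :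
    degX E.H ≤ max 0 (degX f + 1) := by
  by_cases hH : E.H = 0
  · rw [degX, if_pos hH]; exact bot_le
  rw [degX_eq hH]
  set m := (expandX (-1) (by norm_num) E.H).order with hm
  by_cases hm0 : m < 0
  · have h1 := coeff_expandX_ne_zero h (ε := -1) (by norm_num) (by norm_num) hm0 (fun h0 =>
      hH ((_root_.map_eq_zero _).1 (coeff_order_eq_zero.1 h0)))
    have hf : f ≠ 0 := by rintro rfl; simp at h1
    have h2 := order_le_of_coeff_ne_zero h1
    refine le_max_of_le_right ?_
    rw [degX_eq hf, ← WithBot.coe_one, ← WithBot.coe_add, WithBot.coe_le_coe]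
    omega
  · refine le_max_of_le_left ?_
    rw [← WithBot.coe_zero, WithBot.coe_le_coe]
    omega

lemma polyX_pow_dvd_iff {p : Polynomial (Polynomial ℂ)} (hp : p ≠ 0) (n : ℕ) :
    polyX ^ n ∣ p ↔ (n : ℤ) ≤ (laurentHom 1 (Bivariate.swap p)).order := by
  rw [le_order_laurentHom_one_iff (swap_ne_zero hp)]
  have h1 : ∀ q, Bivariate.swap (polyX ^ n * q) = X ^ n * Bivariate.swap (R := ℂ) q := fun q => by
    rw [map_mul, map_pow, polyX, Bivariate.swap_X]
  constructor
  · rintro ⟨q, hq⟩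
    exact ⟨Bivariate.swap q, by rw [hq, h1]⟩
  · rintro ⟨q, hq⟩
    refine ⟨Bivariate.swap q, (Bivariate.swap (R := ℂ)).injective ?_⟩
    rw [h1, Bivariate.swap_swap_apply, hq]

/-- At x = 0 the Ei terms may have poles of any order, so the argument for other primes fails; the
coefficient equation replaces it, with a shift from m to m - 1. -/
lemma pow_succ_polyX_dvd_den {E : LogExpr} {f : RatXY} (h : E.Formal f) {n : ℕ}
    (hd : polyX ^ (n + 1) ∣ den E.H) : polyX ^ (n + 2) ∣ den f := by
  have hH : E.H ≠ 0 := by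
    intro hH
    have h1 : den E.H ∣ 1 := den_dvd (p := 0) (by rw [hH]; simp)
    exact prime_polyX.not_isUnit (isUnit_of_dvd_one
      (((dvd_pow_self polyX n.succ_ne_zero).trans hd).trans h1))
  have hnum : (laurentHom 1 (Bivariate.swap (num E.H))).order < 1 := by
    by_contra hlt
    have h1 := (polyX_pow_dvd_iff (num_ne_zero hH) 1).2 (by simpa using hlt)
    rw [pow_one] at h1
    exact prime_polyX.not_isUnit (isRelPrime_num_den E.H h1
      ((dvd_pow_self polyX n.succ_ne_zero).trans hd))
  have hden := (polyX_pow_dvd_iff (den_ne_zero _) _).1 hd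
  have hord := order_expandX hH (ε := 1) one_ne_zero
  have hm : (expandX 1 one_ne_zero E.H).order < 0 := by push_cast at hden; omega
  have h1 := coeff_expandX_ne_zero h (ε := 1) (by norm_num) one_ne_zero hm (fun h0 =>
      hH ((_root_.map_eq_zero _).1 (coeff_order_eq_zero.1 h0)))
  have hf : f ≠ 0 := by rintro rfl; simp at h1
  have h2 := order_le_of_coeff_ne_zero h1
  rw [polyX_pow_dvd_iff (den_ne_zero _)]
  have h3 := order_expandX hf (ε := 1) one_ne_zero
  have h4 := (polyX_pow_dvd_iff (num_ne_zero hf) 0).1 (by simp)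
  push_cast at hden h4 ⊢
  omega

lemma denReduced_of_formal {E : LogExpr} {f : RatXY} (h : E.Formal f) : DenReduced E.H f := by
  intro P hP hd
  have key : ∀ n : ℕ, P ^ (n + 1) ∣ den E.H → P ^ (n + 2) ∣ den f := by
    intro n hn
    by_cases hx : Associated P polyX
    · exact ((hx.pow_pow (n := n + 2)).dvd).trans
        (pow_succ_polyX_dvd_den h ((hx.pow_pow (n := n + 1)).symm.dvd.trans hn))
    · exact pow_succ_dvd_den h hP hx hn
  have hfin : FiniteMultiplicity P (den E.H) :=
    FiniteMultiplicity.of_prime_left hP.prime (den_ne_zero _)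
  obtain ⟨n, hn⟩ : ∃ n, multiplicity P (den E.H) = n + 1 := by
    have h1 := (hfin.pow_dvd_iff_le_multiplicity (k := 1)).1 (by rwa [pow_one])
    exact ⟨multiplicity P (den E.H) - 1, by omega⟩
  rw [hfin.emultiplicity_eq_multiplicity, hn]
  have h2 := key n ((hfin.pow_dvd_iff_le_multiplicity).2 hn.ge)
  have h3 := le_emultiplicity_of_pow_dvd h2
  exact_mod_cast h3

end RatXY

/-! ### The degree in y and the exceptional term c y. -/

namespace RatXY

open Polynomial
open HahnSeries hiding C coeff_zero coeff_add coeff_sub coeff leadingCoeff_eq_zero map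

lemma degY_le_of_coeff {g : RatXY} {N : ℤ} (h : ∀ n < -N, (expandY g).coeff n = 0) :
    degY g ≤ (N : WithBot ℤ) := by
  by_cases hg : g = 0
  · rw [degY, if_pos hg]; exact bot_le
  rw [degY_eq hg, WithBot.coe_le_coe]
  by_contra hlt
  refine hg ((_root_.map_eq_zero _).1 (coeff_order_eq_zero.1 (h (expandY g).order ?_)))
  omega

lemma le_degY_of_coeff {g : RatXY} {n : ℤ} (h : (expandY g).coeff n ≠ 0) :
    ((-n : ℤ) : WithBot ℤ) ≤ degY g := by
  have hg : g ≠ 0 := by rintro rfl; simp at h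
  rw [degY_eq hg, WithBot.coe_le_coe]
  have := order_le_of_coeff_ne_zero h
  omega

/-- A constant coefficient at m - 1 contributes a residue at x = 0, which neither a derivative nor
the polylogarithmic terms can cancel. -/
lemma eq_zero_of_coeff_expandY_eq_zero {E : LogExpr} {f : RatXY} (h : E.Formal f) {m : ℤ}
    (hm : m < 0) (hf : (expandY f).coeff m = 0) {c : ℂ}
    (hc : (expandY E.H).coeff (m - 1) = algebraMap ℂ RatX c) :
    c = 0 ∧ RatX.deriv ((expandY E.H).coeff m) = 0 := by
  have h1 := coeff_expandY_of_formal h hm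
  rw [hf, hc, mul_zero] at h1
  have e : ((1 - m : ℤ) : RatX) * algebraMap ℂ RatX c =
      algebraMap ℂ RatX (((1 - m : ℤ) : ℂ) * c) := by rw [map_mul, map_intCast]
  rw [e] at h1
  have h2 := RatX.eq_zero_of_deriv_eq_sum _ (fun i => E.b i) (fun i : ℕ × ℕ × ℂ => i.2.2)
    (fun i hi => (E.b_index i (Finset.mem_filter.1 hi).1).2) ?_ _ h1.symm
  · refine ⟨(mul_eq_zero.1 h2.1).resolve_left ?_, h2.2⟩
    have : (1 - m : ℤ) ≠ 0 := by omega
    exact_mod_cast this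
  -- The filter fixes p = 1 and r = -m, so an index is determined by μ.
  · rintro ⟨p, r, μ⟩ hi ⟨p', r', μ'⟩ hj (rfl : μ = μ')
    obtain ⟨-, h1, h2⟩ := Finset.mem_filter.1 hi
    obtain ⟨-, h3, h4⟩ := Finset.mem_filter.1 hj
    simp only at h1 h2 h3 h4
    have : r = r' := by omega
    rw [h1, h3, this]

/-- Let m < 0 be the order of H at y = ∞. If f has a nonzero coefficient at some index at most m +
1, the bound holds for H itself. Otherwise the equation at m makes the leading coefficient of H a
constant c. -/
lemma exists_degY_le_of_formal {E : LogExpr} {f : RatXY} (h : E.Formal f) :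
    ∃ c : ℂ, degY (E.H - const c * y) ≤ max 0 (degY f + 1) := by
  set F := expandY E.H with hF
  have hlow : ∀ n < F.order, F.coeff n = 0 := fun n hn => coeff_eq_zero_of_lt_order hn
  have hzero : ∀ n < F.order, F.coeff n = algebraMap ℂ RatX 0 := fun n hn => by
    rw [map_zero, hlow n hn]
  rcases le_or_gt 0 F.order with hm | hm
  · refine ⟨0, le_max_of_le_left ?_⟩
    rw [const_zero, zero_mul, sub_zero]
    exact degY_le_of_coeff (N := 0) fun n hn => hlow n (by omega)
  have hF0 : F.coeff F.order ≠ 0 := by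
    intro h0
    rw [coeff_order_eq_zero.1 h0] at hm
    simp at hm
  have hbound : ∀ n ≤ F.order + 1, (expandY f).coeff n ≠ 0 →
      degY E.H ≤ max 0 (degY f + 1) := by
    intro n hn hf
    refine le_max_of_le_right ((degY_le_of_coeff (N := -F.order) fun n hn =>
      hlow n (by omega)).trans ?_)
    calc ((-F.order : ℤ) : WithBot ℤ) ≤ ((-n + 1 : ℤ) : WithBot ℤ) :=
          WithBot.coe_le_coe.2 (by omega)
      _ = ((-n : ℤ) : WithBot ℤ) + 1 := rfl
      _ ≤ degY f + 1 := by gcongr; exact le_degY_of_coeff hf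
  by_cases hf : ∃ n ≤ F.order + 1, (expandY f).coeff n ≠ 0
  · obtain ⟨n, hn, hf⟩ := hf
    exact ⟨0, by simpa [const_zero] using hbound n hn hf⟩
  push Not at hf
  obtain ⟨c, hc⟩ := RatX.exists_const_of_deriv_eq_zero (eq_zero_of_coeff_expandY_eq_zero h hm
    (hf _ (by omega)) (hzero _ (by omega))).2
  have hc0 : c ≠ 0 := by
    rintro rfl
    rw [map_zero] at hc
    exact hF0 hc
  -- If m + 1 were negative, the equation there would give c = 0. So the polar part of H is exactly
  -- c y.
  have hm1 : F.order = -1 := by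
    by_contra hne
    refine hc0 (eq_zero_of_coeff_expandY_eq_zero h (m := F.order + 1) (by omega)
      (hf _ le_rfl) (c := c) ?_).1
    rw [add_sub_cancel_right]
    exact hc
  refine ⟨c, le_max_of_le_left (degY_le_of_coeff (N := 0) fun n hn => ?_)⟩
  rw [map_sub, map_mul, expandY_const, expandY_y, HahnSeries.coeff_sub,
    LaurentSeries.coeff_C_mul, coeff_single]
  rcases eq_or_ne n (-1) with rfl | hne
  · rw [if_pos rfl, mul_one, sub_eq_zero, ← hc, hm1]
  · rw [if_neg hne, mul_zero, sub_zero]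
    exact hlow n (by omega)

end RatXY

namespace LogExpr

open RatXY

/-- A multiple of `y` can be moved from the rational part to the logarithmic sum. -/
lemma Formal.exists_sub_const_mul_y {E : LogExpr} {f : RatXY} (h : E.Formal f) (c : ℂ) :
    ∃ E' : LogExpr, E'.H = E.H - const c * y ∧ E'.Formal f := by
  classical
  have h1 : ∀ μ, (if μ ∈ E.S then E.K μ else 1) ≠ 0 := fun μ => by
    split_ifs with hμ
    exacts [E.K_ne_zero μ hμ, one_ne_zero]
  have h2 : ∀ μ, (if μ = c then x else 1) ≠ 0 := fun μ => by
    split_ifs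
    exacts [x_ne_zero, one_ne_zero]
  -- The logarithm with coefficient c gets the extra factor x, since D(c y) = c / x = c D(x) / x.
  refine ⟨⟨E.a, E.b, insert c E.S, fun μ => (if μ ∈ E.S then E.K μ else 1) *
    (if μ = c then x else 1), E.H - const c * y, E.a_index, E.b_index,
    fun μ _ => mul_ne_zero (h1 μ) (h2 μ)⟩, rfl, ?_⟩
  have hmul : ∀ a b : RatXY, a ≠ 0 → b ≠ 0 → D (a * b) / (a * b) = D a / a + D b / b := by
    intro a b ha hb
    rw [D.leibniz, smul_eq_mul, smul_eq_mul]
    field_simp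
    ring
  have hsum : ∑ μ ∈ insert c E.S, const μ *
      (D ((if μ ∈ E.S then E.K μ else 1) * (if μ = c then x else 1)) /
        ((if μ ∈ E.S then E.K μ else 1) * (if μ = c then x else 1))) =
      ∑ μ ∈ E.S, const μ * (D (E.K μ) / E.K μ) + const c * x⁻¹ := by
    simp only [fun μ => hmul _ _ (h1 μ) (h2 μ), mul_add, Finset.sum_add_distrib]
    congr 1
    · rw [← Finset.sum_subset (Finset.subset_insert c E.S)]
      · exact Finset.sum_congr rfl fun μ hμ => by rw [if_pos hμ]
      · intro μ _ hμ
        rw [if_neg hμ, D.map_one_eq_zero, zero_div, mul_zero]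
    · rw [Finset.sum_eq_single_of_mem c (Finset.mem_insert_self _ _)]
      · rw [if_pos rfl, D_x, one_div]
      · intro μ _ hμ
        rw [if_neg hμ, D.map_one_eq_zero, zero_div, mul_zero]
  refine ⟨?_, h.2⟩
  dsimp only
  rw [hsum, map_sub, D.leibniz, D_const, D_y, smul_zero, add_zero, smul_eq_mul]
  rw [h.1]
  ring

end LogExpr

theorem mainTheorem9 (f : RatXY) (hf : RatXY.AdmitsTelescoper f) :
    (∃ E : LogExpr, E.IsIntegralOf f ∧
      RatXY.DenReduced E.H f ∧
      RatXY.degX E.H ≤ max 0 (RatXY.degX f + 1) ∧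
      RatXY.degY E.H ≤ max 0 (RatXY.degY f + 1)) ∧
    (∀ E : LogExpr, E.IsIntegralOf f →
      RatXY.DenReduced E.H f ∧
      RatXY.degX E.H ≤ max 0 (RatXY.degX f + 1) ∧
      ∃ c : ℂ, RatXY.degY (E.H - RatXY.const c * RatXY.y) ≤ max 0 (RatXY.degY f + 1)) ∧
    (∀ E : LogExpr, E.IsIntegralOf f → E.H = 0 → RatXY.SimplePolesAwayFromZero f) ∧
    (∀ E : LogExpr, E.IsIntegralOf f → RatXY.SimplePolesAwayFromZero f →
      RatXY.IsLaurent E.H) := by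
  refine ⟨?_, fun E hE => ⟨RatXY.denReduced_of_formal hE.formal,
    RatXY.degX_le_of_formal hE.formal, RatXY.exists_degY_le_of_formal hE.formal⟩,
    fun E hE h0 => RatXY.simplePolesAwayFromZero_of_formal hE.formal h0,
    fun E hE hs => RatXY.isLaurent_of_formal hE.formal hs⟩
  obtain ⟨L, R, hL, hLR⟩ := hf.exists_aeval_eq
  obtain ⟨E₀, hE₀⟩ := RatXY.formallyIntegrable_of_telescoper hL hLR
  -- The correction by c y is made on the formal integral; the passage to an analytic integral
  -- leaves H unchanged, so the bound survives.
  obtain ⟨c, hc⟩ := RatXY.exists_degY_le_of_formal hE₀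
  obtain ⟨E₁, hH₁, hE₁⟩ := hE₀.exists_sub_const_mul_y c
  obtain ⟨E, hH, hE⟩ := hE₁.exists_isIntegralOf
  refine ⟨E, hE, RatXY.denReduced_of_formal hE.formal, RatXY.degX_le_of_formal hE.formal, ?_⟩
  rwa [hH, hH₁]
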